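/- Let $m\ge 1$ and let $r$ be a prime with $\gcd(r,m)=1$. Let $L\subset\mathbb{R}^3$ be an $m$-periodic link: an oriented (polygonal) link, disjoint from the vertical axis and invariant under the rotation of order $m$ by the angle $2\pi/m$ about this axis, whose projection to the horizontal plane is a link diagram $D$. The rotation acts on the Khovanov complex $C^{*,*}(D;\mathbb{F}_r)$, which becomes a bigraded complex of modules over the group algebra $\Lambda=\mathbb{F}_r[\mathbb{Z}/m]$. For a finitely generated $\Lambda$-module $M$ put $$\mathrm{EKh}^{i,k}(L;M)=\mathrm{Ext}^i_\Lambda(M,C^{*,k}(D;\mathbb{F}_r))=H^i\big(\mathrm{Tot}\,\mathrm{Hom}_\Lambda(P_*,C^{*,k}(D;\mathbb{F}_r))\big),$$ where $P_*\to M$ is a projective resolution, and $$\mathrm{EJ}(L;M)=\sum_{i,k}(-1)^i q^k\dim_{\mathbb{F}_r}\mathrm{EKh}^{i,k}(L;M)\in\mathbb{Z}[q,q^{-1}].$$ Let $\mathrm{J}(L)\in\mathbb{Z}[q,q^{-1}]$ be the unreduced Jones polynomial, normalized so that the unknot has value $q+q^{-1}$ and $q^{-2}\mathrm{J}(L_+)-q^{2}\mathrm{J}(L_-)=(q^{-1}-q)\mathrm{J}(L_0)$;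 explicitly, $\mathrm{J}(L)=(-1)^{n_-}q^{n_+-2n_-}\sum_S(-q)^{|S|}(q+q^{-1})^{c(S)}$, where $n_\pm$ are the numbers of positive and negative crossings of $D$, the sum is over all Kauffman states, given by the set $S$ of 1-smoothed crossings, and $c(S)$ is the number of circles of the smoothed diagram. For $d\mid m$ let $f_{d,r}$ be the multiplicative order of $r$ modulo $d$ (so $f_{1,r}=1$). Let $C(m,r)_d$ be the set of cyclotomic cosets $\chi=\{ar^k : k\ge 0\}\subset\mathbb{Z}/m$ with $\gcd(a,m)=d$. Let $\xi$ be a primitive $m$-th root of unity in an extension field of $\mathbb{F}_r$. For a cyclotomic coset $\chi$ let $V_\chi=\mathbb{F}_r[X]/\big(\prod_{u\in\chi}(X-\xi^u)\big)$, and let $\mathbb{F}_r[\xi_d]=\mathbb{F}_r[X]/(\Phi_d)$, where $\Phi_d$ is the $d$-th cyclotomic polynomial; on both, the generator of $\mathbb{Z}/m$ acts as multiplication by $X$. For $d\mid m$ put $$\mathrm{EJ}_{\chi,r}(L)=\frac{1}{f_{m/d,r}}\,\mathrm{EJ}(L;V_\chi)\quad(\chi\in C(m,r)_d),\qquad \mathrm{EJ}_{d,r}(L)=\sum_{\chi\in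 C(m,r)_{m/d}}\mathrm{EJ}_{\chi,r}(L).$$ Then for every $d\mid m$ and every $\chi\in C(m,r)_d$ the spaces $\mathrm{EKh}^{*,*}(L;V_\chi)$ and $\mathrm{EKh}^{*,*}(L;\mathbb{F}_r[\xi_d])$ have finite total dimension, the polynomial $\mathrm{EJ}_{\chi,r}(L)$ has integer coefficients, and $f_{d,r}\,\mathrm{EJ}_{d,r}(L)=\mathrm{EJ}(L;\mathbb{F}_r[\xi_d])$. Moreover, $$\mathrm{J}(L)=\sum_{d\mid m}f_{d,r}\,\mathrm{EJ}_{d,r}(L).$$ -/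

import Mathlib

open Polynomial

/-! ## Representations of a finite cyclic group -/

/-- The group algebra `F[ℤ/m]`. -/
abbrev CyclicAlgebra (F : Type) [Field F] (m : ℕ) : Type :=
  MonoidAlgebra F (Multiplicative (ZMod m))

/-- The representation of `ℤ/m` in which the generator `1` acts by `T`, where `T ^ m = 1`. -/
noncomputable def cyclicRep {F : Type} [Field F] {m : ℕ} [NeZero m] {V : Type}
    [AddCommGroup V] [Module F V] (T : Module.End F V) (hT : T ^ m = 1) :
    Representation F (Multiplicative (ZMod m)) V where
  toFun g := T ^ (Multiplicative.toAdd g).val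
  map_one' := by simp
  map_mul' g h := by
    rw [toAdd_mul, ZMod.val_add, ← pow_add]
    exact (pow_eq_pow_mod _ hT).symm

section CyclicModule

variable {F : Type} [Field F] {m : ℕ} [NeZero m] {V : Type} [AddCommGroup V] [Module F V]

/-- The vector space `V`, regarded as a module over `F[ℤ/m]` on which the generator of `ℤ/m` acts
by `T`. -/
def CyclicModule (T : Module.End F V) (_ : T ^ m = 1) : Type := V

variable (T : Module.End F V) (hT : T ^ m = 1)

instance : AddCommGroup (CyclicModule T hT) := inferInstanceAs (AddCommGroup V)

instance : Module F (CyclicModule T hT) := inferInstanceAs (Module F V)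

/-- The identity map from `V` regarded as an `F[ℤ/m]`-module to `V`. -/
def CyclicModule.toVec : CyclicModule T hT ≃ₗ[F] V := LinearEquiv.refl F V

noncomputable instance : Module (CyclicAlgebra F m) (CyclicModule T hT) :=
  Module.compHom V (cyclicRep T hT).asAlgebraHom.toRingHom

theorem CyclicModule.toVec_smul (a : CyclicAlgebra F m) (v : CyclicModule T hT) :
    CyclicModule.toVec T hT (a • v) =
      (cyclicRep T hT).asAlgebraHom a (CyclicModule.toVec T hT v) := rfl

instance : IsScalarTower F (CyclicAlgebra F m) (CyclicModule T hT) where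
  smul_assoc c a v := by
    refine (CyclicModule.toVec T hT).injective ?_
    rw [CyclicModule.toVec_smul, map_smul, map_smul, CyclicModule.toVec_smul]
    rfl

/-- A linear map that commutes with `T` is linear over `F[ℤ/m]`. -/
noncomputable def CyclicModule.mapOfCommute (d : Module.End F V) (hd : Commute d T) :
    CyclicModule T hT →ₗ[CyclicAlgebra F m] CyclicModule T hT where
  toFun v := (CyclicModule.toVec T hT).symm (d (CyclicModule.toVec T hT v))
  map_add' v w := by simp
  map_smul' a v := by
    refine (CyclicModule.toVec T hT).injective ?_
    simp only [RingHom.id_apply, LinearEquiv.apply_symm_apply, CyclicModule.toVec_smul]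
    induction a using MonoidAlgebra.induction_linear with
    | zero => simp
    | add x y hx hy => simp [hx, hy]
    | single g c =>
      have h := LinearMap.congr_fun (hd.pow_right (Multiplicative.toAdd g).val).eq
        (CyclicModule.toVec T hT v)
      simp only [Module.End.mul_apply] at h
      simp only [Representation.asAlgebraHom_single, LinearMap.smul_apply, map_smul]
      congr 1

end CyclicModule

/-! ## Signs -/

section Signs

variable {α : Type} [LinearOrder α]

/-- The sign `(-1)^#{s ∈ S : s < c}` of `c ∧ S` relative to the increasing ordering of
`S ∪ {c}`. -/
def wedgeSign (c : α) (S : Finset α) : ℤ :=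
  (-1) ^ (S.filter (fun s => s < c)).card

/-- The sign of the bijection `S → σ(S)` induced by a permutation `σ`, where `S` and `σ(S)` are
listed in increasing order. -/
def inversionSign (σ : Equiv.Perm α) (S : Finset α) : ℤ :=
  (-1) ^ ((S ×ˢ S).filter (fun p => p.1 < p.2 ∧ σ p.2 < σ p.1)).card

theorem inversionSign_one (S : Finset α) : inversionSign (1 : Equiv.Perm α) S = 1 := by
  unfold inversionSign
  rw [Finset.filter_eq_empty_iff.2]
  · simp
  · rintro ⟨a, b⟩ - ⟨h1, h2⟩
    exact lt_asymm h1 h2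

theorem inversionSign_sq (σ : Equiv.Perm α) (S : Finset α) :
    inversionSign σ S * inversionSign σ S = 1 := by
  unfold inversionSign
  rw [← pow_add, ← two_mul, pow_mul]
  simp

theorem inversionSign_mul (τ σ : Equiv.Perm α) (S : Finset α) :
    inversionSign (τ * σ) S =
      inversionSign τ (S.map σ.toEmbedding) * inversionSign σ S := by
  unfold inversionSign
  rw [← pow_add]
  set A := (S ×ˢ S).filter (fun p => p.1 < p.2 ∧ σ p.1 < σ p.2 ∧ τ (σ p.2) < τ (σ p.1)) with hA
  set B := (S ×ˢ S).filter (fun p => p.1 < p.2 ∧ σ p.2 < σ p.1 ∧ τ (σ p.1) < τ (σ p.2)) with hB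
  set C := (S ×ˢ S).filter (fun p => p.1 < p.2 ∧ σ p.2 < σ p.1 ∧ τ (σ p.2) < τ (σ p.1)) with hC
  have h1 : ((S ×ˢ S).filter (fun p => p.1 < p.2 ∧ (τ * σ) p.2 < (τ * σ) p.1)).card
      = A.card + C.card := by
    rw [← Finset.card_union_of_disjoint]
    · congr 1
      ext ⟨a, b⟩
      simp only [hA, hC, Finset.mem_filter, Finset.mem_product, Finset.mem_union]
      constructor
      · rintro ⟨h, hab, h'⟩
        rcases lt_trichotomy (σ a) (σ b) with h2 | h2 | h2
        · exact Or.inl ⟨h, hab, h2, h'⟩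
        · exact absurd (σ.injective h2) hab.ne
        · exact Or.inr ⟨h, hab, h2, h'⟩
      · rintro (⟨h, hab, -, h'⟩ | ⟨h, hab, -, h'⟩) <;> exact ⟨h, hab, h'⟩
    · rw [Finset.disjoint_left]
      rintro ⟨a, b⟩ h h'
      simp only [hA, hC, Finset.mem_filter] at h h'
      exact lt_asymm h.2.2.1 h'.2.2.1
  have h2 : ((S ×ˢ S).filter (fun p => p.1 < p.2 ∧ σ p.2 < σ p.1)).card
      = B.card + C.card := by
    rw [← Finset.card_union_of_disjoint]
    · congr 1
      ext ⟨a, b⟩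
      simp only [hB, hC, Finset.mem_filter, Finset.mem_product, Finset.mem_union]
      constructor
      · rintro ⟨h, hab, h'⟩
        rcases lt_trichotomy (τ (σ a)) (τ (σ b)) with h2 | h2 | h2
        · exact Or.inl ⟨h, hab, h', h2⟩
        · exact absurd (σ.injective (τ.injective h2)) hab.ne
        · exact Or.inr ⟨h, hab, h', h2⟩
      · rintro (⟨h, hab, h', -⟩ | ⟨h, hab, h', -⟩) <;> exact ⟨h, hab, h'⟩
    · rw [Finset.disjoint_left]
      rintro ⟨a, b⟩ h h'
      simp only [hB, hC, Finset.mem_filter] at h h'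
      exact lt_asymm h.2.2.2 h'.2.2.2
  have h3 : ((S.map σ.toEmbedding ×ˢ S.map σ.toEmbedding).filter
      (fun p => p.1 < p.2 ∧ τ p.2 < τ p.1)).card = A.card + B.card := by
    have hBB : B.card = (B.map (Equiv.prodComm α α).toEmbedding).card := by simp
    rw [hBB, ← Finset.card_union_of_disjoint]
    · symm
      apply Finset.card_bij (fun p _ => (σ p.1, σ p.2))
      · rintro ⟨a, b⟩ h
        simp only [hA, hB, Finset.mem_filter, Finset.mem_product, Finset.mem_union,
          Finset.mem_map_equiv, Equiv.prodComm_symm, Equiv.prodComm_apply, Prod.swap_prod_mk] at h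
        simp only [Finset.mem_filter, Finset.mem_product, Finset.mem_map_equiv,
          Equiv.symm_apply_apply]
        tauto
      · rintro ⟨a, b⟩ - ⟨a', b'⟩ - h
        simpa using h
      · rintro ⟨x, y⟩ h
        simp only [Finset.mem_filter, Finset.mem_product, Finset.mem_map_equiv] at h
        refine ⟨(σ.symm x, σ.symm y), ?_, by simp⟩
        simp only [hA, hB, Finset.mem_filter, Finset.mem_product, Finset.mem_union,
          Finset.mem_map_equiv, Equiv.prodComm_symm, Equiv.prodComm_apply, Prod.swap_prod_mk,
          Equiv.apply_symm_apply]
        rcases lt_trichotomy (σ.symm x) (σ.symm y) with h2 | h2 | h2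
        · tauto
        · exact absurd (σ.symm.injective h2) h.2.1.ne
        · tauto
    · rw [Finset.disjoint_left]
      rintro ⟨a, b⟩ h h'
      simp only [hA, hB, Finset.mem_filter, Finset.mem_map_equiv, Equiv.prodComm_symm,
        Equiv.prodComm_apply, Prod.swap_prod_mk] at h h'
      exact lt_asymm h.2.1 h'.2.1
  rw [h1, h2, h3, show A.card + B.card + (B.card + C.card) = (A.card + C.card) + 2 * B.card by ring,
    pow_add _ _ (2 * B.card), pow_mul]
  simp

theorem wedgeSign_map (σ : Equiv.Perm α) (S : Finset α) (c : α) (hc : c ∉ S) :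
    wedgeSign (σ c) (S.map σ.toEmbedding) * inversionSign σ S =
      inversionSign σ (insert c S) * wedgeSign c S := by
  unfold wedgeSign inversionSign
  rw [← pow_add, ← pow_add]
  set X := S.filter (fun a => a < c ∧ σ c < σ a) with hX
  set Y := S.filter (fun a => c < a ∧ σ a < σ c) with hY
  set Z := S.filter (fun a => a < c ∧ σ a < σ c) with hZ
  have h1 : (S.filter (fun s => s < c)).card = Z.card + X.card := by
    rw [← Finset.card_union_of_disjoint]
    · congr 1
      ext a
      simp only [hX, hZ, Finset.mem_filter, Finset.mem_union]
      constructor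
      · rintro ⟨h, hab⟩
        rcases lt_trichotomy (σ a) (σ c) with h2 | h2 | h2
        · tauto
        · exact absurd (σ.injective h2) hab.ne
        · tauto
      · tauto
    · rw [Finset.disjoint_left]
      intro a h h'
      simp only [hX, hZ, Finset.mem_filter] at h h'
      exact lt_asymm h.2.2 h'.2.2
  have h2 : ((S.map σ.toEmbedding).filter (fun s => s < σ c)).card = Z.card + Y.card := by
    rw [← Finset.card_union_of_disjoint]
    · symm
      apply Finset.card_bij (fun a _ => σ a)
      · intro a h
        simp only [hZ, hY, Finset.mem_filter, Finset.mem_union] at h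
        simp only [Finset.mem_filter, Finset.mem_map_equiv, Equiv.symm_apply_apply]
        tauto
      · intro a _ b _ h
        exact σ.injective h
      · intro x h
        simp only [Finset.mem_filter, Finset.mem_map_equiv] at h
        refine ⟨σ.symm x, ?_, by simp⟩
        simp only [hZ, hY, Finset.mem_filter, Finset.mem_union, Equiv.apply_symm_apply]
        rcases lt_trichotomy (σ.symm x) c with h2 | h2 | h2
        · tauto
        · exact absurd h.1 (by rw [h2]; exact hc)
        · tauto
    · rw [Finset.disjoint_left]
      intro a h h'
      simp only [hZ, hY, Finset.mem_filter] at h h'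
      exact lt_asymm h.2.1 h'.2.1
  have h3 : ((insert c S ×ˢ insert c S).filter (fun p => p.1 < p.2 ∧ σ p.2 < σ p.1)).card =
      ((S ×ˢ S).filter (fun p => p.1 < p.2 ∧ σ p.2 < σ p.1)).card + (X.card + Y.card) := by
    have hX' : X.card = (X.image (fun a => (a, c))).card :=
      (Finset.card_image_of_injective _ (fun a b h => (Prod.mk.inj h).1)).symm
    have hY' : Y.card = (Y.image (fun a => (c, a))).card :=
      (Finset.card_image_of_injective _ (fun a b h => (Prod.mk.inj h).2)).symm
    rw [hX', hY', ← Finset.card_union_of_disjoint, ← Finset.card_union_of_disjoint]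
    · congr 1
      ext ⟨a, b⟩
      simp only [hX, hY, Finset.mem_filter, Finset.mem_product, Finset.mem_union, Finset.mem_image,
        Finset.mem_insert, Prod.mk.injEq]
      constructor
      · rintro ⟨⟨rfl | ha, rfl | hb⟩, h, h'⟩
        · exact absurd h (lt_irrefl _)
        · exact Or.inr (Or.inr ⟨b, ⟨hb, h, h'⟩, rfl, rfl⟩)
        · exact Or.inr (Or.inl ⟨a, ⟨ha, h, h'⟩, rfl, rfl⟩)
        · exact Or.inl ⟨⟨ha, hb⟩, h, h'⟩
      · rintro (⟨⟨ha, hb⟩, h, h'⟩ | ⟨x, ⟨hx, h, h'⟩, rfl, rfl⟩ | ⟨x, ⟨hx, h, h'⟩, rfl, rfl⟩)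
        · exact ⟨⟨Or.inr ha, Or.inr hb⟩, h, h'⟩
        · exact ⟨⟨Or.inr hx, Or.inl rfl⟩, h, h'⟩
        · exact ⟨⟨Or.inl rfl, Or.inr hx⟩, h, h'⟩
    · rw [Finset.disjoint_left]
      rintro ⟨a, b⟩ h h'
      simp only [hX, hY, Finset.mem_filter, Finset.mem_product, Finset.mem_union, Finset.mem_image,
        Prod.mk.injEq] at h h'
      obtain ⟨x, hx, rfl, rfl⟩ | ⟨x, hx, rfl, rfl⟩ := h'
      · exact hc h.1.2
      · exact hc h.1.1
    · rw [Finset.disjoint_left]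
      rintro ⟨a, b⟩ h h'
      simp only [hX, hY, Finset.mem_filter, Finset.mem_image,
        Prod.mk.injEq] at h h'
      obtain ⟨x, hx, rfl, rfl⟩ := h
      obtain ⟨y, hy, rfl, rfl⟩ := h'
      exact hc hx.1
  rw [h1, h2, h3]
  set I := ((S ×ˢ S).filter (fun p => p.1 < p.2 ∧ σ p.2 < σ p.1)).card
  rw [show I + (X.card + Y.card) + (Z.card + X.card) = (Z.card + Y.card + I) + 2 * X.card by ring,
    pow_add _ _ (2 * X.card), pow_mul]
  simp

end Signs

/-! ## Polygonal links and their projections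

Three-space is `ℂ × ℝ`; links are projected along the last coordinate to the plane `ℂ`. -/

/-- An oriented polygonal link in `ℝ³ = ℂ × ℝ`.  The edges are the segments from `pos i` to
`pos (next i)`, so that the cycles of the permutation `next` are the components. -/
structure PolygonalLink where
  size : ℕ
  next : Equiv.Perm (Fin size)
  pos : Fin size → ℂ × ℝ
  next_ne : ∀ i, next i ≠ i
  pos_injective : Function.Injective pos
  embedded : ∀ i j, i ≠ j →
    segment ℝ (pos i) (pos (next i)) ∩ segment ℝ (pos j) (pos (next j)) ⊆
      {pos i, pos (next i)} ∩ {pos j, pos (next j)}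

namespace PolygonalLink

variable (L : PolygonalLink)

/-- The direction of the projection of the `i`-th edge. -/
noncomputable def dir (i : Fin L.size) : ℂ := (L.pos (L.next i)).1 - (L.pos i).1

/-- The determinant of the directions of the projections of two edges. -/
noncomputable def planarDet (i j : Fin L.size) : ℝ :=
  ((starRingEnd ℂ) (L.dir i) * L.dir j).im

/-- The `i`-th edge passes over the `j`-th edge. -/
def Over (i j : Fin L.size) : Prop :=
  ∃ (w : ℂ) (h₁ h₂ : ℝ), h₂ < h₁ ∧
    (w, h₁) ∈ segment ℝ (L.pos i) (L.pos (L.next i)) ∧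
    (w, h₂) ∈ segment ℝ (L.pos j) (L.pos (L.next j))

def Crosses (i j : Fin L.size) : Prop := L.Over i j ∨ L.Over j i

/-- The projection of the link to the plane is a link diagram: its only singularities are transverse
double points, which are not vertices.  The polygon is assumed to be subdivided finely enough that
each edge takes part in at most one crossing. -/
structure Regular : Prop where
  proj_injective : Function.Injective fun i => (L.pos i).1
  proj_vertex : ∀ v i, (L.pos v).1 ∈ segment ℝ (L.pos i).1 (L.pos (L.next i)).1 →
    v = i ∨ v = L.next i
  transverse : ∀ i j, L.Over i j → L.planarDet i j ≠ 0
  simple : ∀ i j k, L.Crosses i j → L.Crosses i k → j = k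

end PolygonalLink

/-- The rotation of `ℝ³` about the vertical axis by the angle `2π/m`. -/
noncomputable def axisRotation (m : ℕ) : (ℂ × ℝ) →ₗ[ℝ] (ℂ × ℝ) :=
  (LinearMap.mulLeft ℝ (Complex.exp (2 * Real.pi * Complex.I / m))).prodMap LinearMap.id

/-- An `m`-periodic link with an `m`-periodic diagram: a polygonal link that is disjoint from the
vertical axis and invariant under the rotation by `2π/m`, whose projection is a link diagram.
`rotVertex` and `rotEdge` are the permutations of the vertices and edges that the rotation induces;
the rotation need not preserve the orientation. -/
structure PeriodicLink (m : ℕ) extends PolygonalLink where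
  regular : toPolygonalLink.Regular
  off_axis : ∀ i, ∀ x ∈ segment ℝ (pos i) (pos (next i)), x.1 ≠ 0
  rotVertex : Equiv.Perm (Fin size)
  rotEdge : Equiv.Perm (Fin size)
  pos_rotVertex : ∀ i, pos (rotVertex i) = axisRotation m (pos i)
  ends_rotEdge : ∀ i, s(rotEdge i, next (rotEdge i)) = s(rotVertex i, rotVertex (next i))

/-! ## Crossings, smoothings, enhanced states -/

namespace PeriodicLink

variable {m : ℕ} (L : PeriodicLink m)

/-- A crossing is a pair consisting of its upper edge and its lower edge. -/
def Crossing : Type := {c : Fin L.size × Fin L.size // L.Over c.1 c.2}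

variable {L} in
def Crossing.upper (c : L.Crossing) : Fin L.size := c.1.1

variable {L} in
def Crossing.lower (c : L.Crossing) : Fin L.size := c.1.2

variable {L} in
theorem Crossing.upper_injective : Function.Injective (Crossing.upper (L := L)) := by
  rintro ⟨⟨i, j⟩, h⟩ ⟨⟨i', j'⟩, h'⟩ hc
  obtain rfl : i = i' := hc
  obtain rfl : j = j' := L.regular.simple i j j' (Or.inl h) (Or.inl h')
  rfl

/-- The crossings are ordered by their upper edges. -/
noncomputable instance : LinearOrder L.Crossing :=
  LinearOrder.lift' Crossing.upper Crossing.upper_injective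

instance : Finite L.Crossing := by unfold Crossing; infer_instance

noncomputable instance : Fintype L.Crossing := Fintype.ofFinite _

variable {L} in
/-- Positive crossings (right-handed, writhe `+1`). -/
def Crossing.IsPositive (c : L.Crossing) : Prop := 0 < L.planarDet c.upper c.lower

open scoped Classical in
/-- The number of positive crossings. -/
noncomputable def nPos : ℕ := (Finset.univ.filter fun c : L.Crossing => c.IsPositive).card

open scoped Classical in
/-- The number of negative crossings. -/
noncomputable def nNeg : ℕ := (Finset.univ.filter fun c : L.Crossing => ¬ c.IsPositive).card

/-- A Kauffman state is given by the set `S` of the crossings that are 1-smoothed, the others being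
0-smoothed.  `Joined S v w` holds if the vertices `v` and `w` are the ends of an elementary arc of the
smoothed diagram: of an edge without crossings, or of one of the two arcs that replace a crossing.
The 0-smoothing of a positive and the 1-smoothing of a negative crossing are compatible with
the orientation, the other ones are not. -/
inductive Joined (S : Finset L.Crossing) : Fin L.size → Fin L.size → Prop
  | edge (i) (h : ∀ j, ¬ L.Crosses i j) : Joined S i (L.next i)
  | oriented₁ (c : L.Crossing) (h : c.IsPositive ↔ c ∉ S) : Joined S c.upper (L.next c.lower)
  | oriented₂ (c : L.Crossing) (h : c.IsPositive ↔ c ∉ S) : Joined S c.lower (L.next c.upper)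
  | unoriented₁ (c : L.Crossing) (h : ¬ (c.IsPositive ↔ c ∉ S)) : Joined S c.upper c.lower
  | unoriented₂ (c : L.Crossing) (h : ¬ (c.IsPositive ↔ c ∉ S)) :
      Joined S (L.next c.upper) (L.next c.lower)

/-- The circles of the smoothed diagram. -/
def Circles (S : Finset L.Crossing) : Type := Quot (L.Joined S)

/-- The circle through a vertex. -/
def circle (S : Finset L.Crossing) (v : Fin L.size) : L.Circles S := Quot.mk _ v

instance (S : Finset L.Crossing) : Finite (L.Circles S) := by unfold Circles; infer_instance

noncomputable instance (S : Finset L.Crossing) : Fintype (L.Circles S) := Fintype.ofFinite _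

/-- An enhanced Kauffman state: a Kauffman state with a labelling of its circles by `true` (the
element `1` of `A = F[X]/(X²)`) or `false` (the element `X`).  The labelling is given as a function
on the vertices that is constant along the circles. -/
def EnhancedState : Type :=
  {E : Finset L.Crossing × (Fin L.size → Bool) // ∀ v w, L.Joined E.1 v w → E.2 v = E.2 w}

instance : Finite L.EnhancedState := by unfold EnhancedState; infer_instance

noncomputable instance : Fintype L.EnhancedState := Fintype.ofFinite _

namespace EnhancedState

variable {L}

/-- The set of 1-smoothed crossings. -/
def state (E : L.EnhancedState) : Finset L.Crossing := E.1.1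

/-- The label of the circle through a vertex. -/
def label (E : L.EnhancedState) : Fin L.size → Bool := E.1.2

/-- The labelling as a function on the circles. -/
def circleLabel (E : L.EnhancedState) : L.Circles E.state → Bool := Quot.lift E.label E.2

/-- The homological degree. -/
noncomputable def hDegree (E : L.EnhancedState) : ℤ := E.state.card - L.nNeg

/-- The quantum degree; `1` has degree `1` and `X` has degree `-1`. -/
noncomputable def qDegree (E : L.EnhancedState) : ℤ :=
  (∑ x, if E.circleLabel x then 1 else -1) + E.state.card + L.nPos - 2 * L.nNeg

end EnhancedState

end PeriodicLink

/-! ## The Khovanov complex -/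

/-- The coefficient of `c` in the product `a * b` in `A = F[X]/(X²)`. -/
def mulCoeff : Bool → Bool → Bool → ℤ
  | true, true, true => 1
  | true, false, false => 1
  | false, true, false => 1
  | _, _, _ => 0

/-- The coefficient of `b ⊗ c` in `Δ(a)`, where `Δ(1) = 1 ⊗ X + X ⊗ 1` and `Δ(X) = X ⊗ X`. -/
def comulCoeff : Bool → Bool → Bool → ℤ
  | true, true, false => 1
  | true, false, true => 1
  | false, false, false => 1
  | _, _, _ => 0

namespace PeriodicLink

variable {m : ℕ} (L : PeriodicLink m)

/-- The labels agree on all circles of the first state that do not pass through `u` or `u'`. -/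
def AgreeOff (E E' : L.EnhancedState) (u u' : Fin L.size) : Prop :=
  ∀ v, L.circle E.state v ≠ L.circle E.state u → L.circle E.state v ≠ L.circle E.state u' →
    E'.label v = E.label v

open scoped Classical in
/-- Let the smoothings of `E` and `E'` differ at a single crossing, at which two arcs through the
vertices `u` and `u'` are replaced by two other arcs through `u` and `u'`.  This is the coefficient
of `E'` in the image of `E` under the map induced by the saddle cobordism: the multiplication if two
circles are merged, the comultiplication if a circle is split, and the identity on the circles that
do not pass through `u` or `u'`. -/
noncomputable def saddleCoeff (E E' : L.EnhancedState) (u u' : Fin L.size) : ℤ :=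
  if L.AgreeOff E E' u u' then
    if L.circle E.state u ≠ L.circle E.state u' ∧
        L.circle E'.state u = L.circle E'.state u' then
      mulCoeff (E.label u) (E.label u') (E'.label u)
    else if L.circle E.state u = L.circle E.state u' ∧
        L.circle E'.state u ≠ L.circle E'.state u' then
      comulCoeff (E.label u) (E'.label u) (E'.label u')
    else 0
  else 0

open scoped Classical in
/-- The coefficient of `E'` in the image of `E` under the edge map of the cube of resolutions that
changes the smoothing of `c` from 0 to 1.  Both before and after the change, the two arcs at `c` pass
through the two ends of the upper edge of `c`. -/
noncomputable def edgeCoeff (c : L.Crossing) (E E' : L.EnhancedState) : ℤ :=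
  if c ∉ E.state ∧ E'.state = insert c E.state then
    L.saddleCoeff E E' c.upper (L.next c.upper)
  else 0

/-- The coefficient of `E'` in the differential of `E`. -/
noncomputable def diffCoeff (E E' : L.EnhancedState) : ℤ :=
  ∑ c : L.Crossing, wedgeSign c E.state * L.edgeCoeff c E E'

variable (F : Type) [Field F]

/-- The underlying vector space of the Khovanov complex, with basis the enhanced states. -/
abbrev Chain : Type := L.EnhancedState → F

/-- The differential of the Khovanov complex. -/
noncomputable def khDiff : L.Chain F →ₗ[F] L.Chain F :=
  Matrix.mulVecLin (Matrix.of fun E' E => (L.diffCoeff E E' : F))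

/-- The part of the Khovanov complex in homological degree `i` and quantum degree `k`. -/
def khGraded (i k : ℤ) : Submodule F (L.Chain F) where
  carrier := {f | ∀ E, f E ≠ 0 → E.hDegree = i ∧ E.qDegree = k}
  zero_mem' := fun E h => absurd rfl h
  add_mem' := by
    intro f g hf hg E h
    by_cases hfE : f E = 0
    · exact hg E (by simpa [hfE] using h)
    · exact hf E hfE
  smul_mem' := by
    intro a f hf E h
    exact hf E (by intro h0; simp [h0] at h)

/-! ## The action of the rotation -/

end PeriodicLink

theorem axisRotation_pow (m : ℕ) [NeZero m] : axisRotation m ^ m = 1 := by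
  have key : ∀ (n : ℕ) (p : ℂ × ℝ), (axisRotation m ^ n) p =
      (Complex.exp (2 * Real.pi * Complex.I / m) ^ n * p.1, p.2) := by
    intro n
    induction n with
    | zero => intro p; simp
    | succ n ih =>
      intro p
      rw [pow_succ', Module.End.mul_apply, ih]
      simp [axisRotation, pow_succ', mul_assoc]
  refine LinearMap.ext fun p => ?_
  rw [key, (Complex.isPrimitiveRoot_exp m (NeZero.ne m)).pow_eq_one]
  simp

theorem Equiv.Perm.rel_of_rel_apply {α : Type} [Finite α] (e : Equiv.Perm α) (R : α → α → Prop)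
    (h : ∀ x y, R x y → R (e x) (e y)) (x y : α) (hxy : R (e x) (e y)) : R x y := by
  have key : ∀ n : ℕ, ∀ x y, R x y → R ((e ^ n) x) ((e ^ n) y) := by
    intro n
    induction n with
    | zero => intro x y h; simpa using h
    | succ n ih =>
      intro x y hxy
      rw [pow_succ', Equiv.Perm.mul_apply, Equiv.Perm.mul_apply]
      exact h _ _ (ih _ _ hxy)
  have h2 := key (orderOf e - 1) _ _ hxy
  have h3 : e ^ (orderOf e - 1) * e = 1 := by
    rw [← pow_succ, Nat.sub_add_cancel (orderOf_pos e), pow_orderOf_eq_one]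
  rw [← Equiv.Perm.mul_apply, ← Equiv.Perm.mul_apply, h3] at h2
  simpa using h2

namespace PeriodicLink

variable {m : ℕ} (L : PeriodicLink m)

theorem ends_cases (i : Fin L.size) :
    (L.rotVertex i = L.rotEdge i ∧ L.rotVertex (L.next i) = L.next (L.rotEdge i)) ∨
    (L.rotVertex i = L.next (L.rotEdge i) ∧ L.rotVertex (L.next i) = L.rotEdge i) := by
  have h := L.ends_rotEdge i
  rw [Sym2.eq_iff] at h
  rcases h with ⟨h1, h2⟩ | ⟨h1, h2⟩
  · exact Or.inl ⟨h1.symm, h2.symm⟩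
  · exact Or.inr ⟨h2.symm, h1.symm⟩

theorem mem_rotEdge (i : Fin L.size) (x : ℂ × ℝ)
    (hx : x ∈ segment ℝ (L.pos i) (L.pos (L.next i))) :
    axisRotation m x ∈ segment ℝ (L.pos (L.rotEdge i)) (L.pos (L.next (L.rotEdge i))) := by
  have h : axisRotation m x ∈ segment ℝ (L.pos (L.rotVertex i)) (L.pos (L.rotVertex (L.next i))) := by
    rw [L.pos_rotVertex, L.pos_rotVertex]
    have := image_segment ℝ (axisRotation m).toAffineMap (L.pos i) (L.pos (L.next i))
    simp only [LinearMap.coe_toAffineMap] at this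
    rw [← this]
    exact ⟨x, hx, rfl⟩
  rcases L.ends_cases i with ⟨h1, h2⟩ | ⟨h1, h2⟩
  · rwa [h1, h2] at h
  · rwa [h1, h2, segment_symm] at h

theorem over_rotEdge (i j : Fin L.size) (h : L.Over i j) :
    L.Over (L.rotEdge i) (L.rotEdge j) := by
  obtain ⟨w, h₁, h₂, hlt, hi, hj⟩ := h
  exact ⟨Complex.exp (2 * Real.pi * Complex.I / m) * w, h₁, h₂, hlt,
    L.mem_rotEdge i _ hi, L.mem_rotEdge j _ hj⟩

theorem crosses_rotEdge_iff (i j : Fin L.size) :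
    L.Crosses (L.rotEdge i) (L.rotEdge j) ↔ L.Crosses i j := by
  have h : ∀ i j, L.Crosses i j → L.Crosses (L.rotEdge i) (L.rotEdge j) := by
    rintro i j (h | h)
    · exact Or.inl (L.over_rotEdge _ _ h)
    · exact Or.inr (L.over_rotEdge _ _ h)
  exact ⟨L.rotEdge.rel_of_rel_apply L.Crosses h i j, h i j⟩

theorem edge_eq_of_ends {i j : Fin L.size} (h : s(i, L.next i) = s(j, L.next j)) : i = j := by
  by_contra hij
  rw [Sym2.eq_iff] at h
  rcases h with ⟨h1, -⟩ | ⟨h1, h2⟩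
  · exact hij h1
  · have hmem : midpoint ℝ (L.pos i) (L.pos (L.next i)) ∈
        segment ℝ (L.pos i) (L.pos (L.next i)) := midpoint_mem_segment _ _
    have hmem' : midpoint ℝ (L.pos i) (L.pos (L.next i)) ∈
        segment ℝ (L.pos j) (L.pos (L.next j)) := by
      rw [h2, ← h1, segment_symm, ← h2]
      exact hmem
    have hne : L.pos i ≠ L.pos (L.next i) := fun h => L.next_ne i (L.pos_injective h).symm
    have := (L.embedded i j hij ⟨hmem, hmem'⟩).1
    simp only [Set.mem_insert_iff, Set.mem_singleton_iff, midpoint_eq_left_iff,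
      midpoint_eq_right_iff] at this
    exact this.elim hne hne

theorem pos_rotVertex_pow (n : ℕ) (i : Fin L.size) :
    L.pos ((L.rotVertex ^ n) i) = (axisRotation m ^ n) (L.pos i) := by
  induction n with
  | zero => simp
  | succ n ih => rw [pow_succ', pow_succ', Equiv.Perm.mul_apply, Module.End.mul_apply,
      L.pos_rotVertex, ih]

theorem rotVertex_pow [NeZero m] : L.rotVertex ^ m = 1 := by
  refine Equiv.ext fun i => L.pos_injective ?_
  rw [L.pos_rotVertex_pow, axisRotation_pow]
  rfl

theorem ends_rotEdge_pow (n : ℕ) (i : Fin L.size) :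
    s((L.rotEdge ^ n) i, L.next ((L.rotEdge ^ n) i)) =
      s((L.rotVertex ^ n) i, (L.rotVertex ^ n) (L.next i)) := by
  induction n with
  | zero => simp
  | succ n ih =>
    rw [pow_succ', pow_succ']
    simp only [Equiv.Perm.mul_apply]
    rw [L.ends_rotEdge]
    have := congrArg (Sym2.map L.rotVertex) ih
    simpa using this

theorem rotEdge_pow [NeZero m] : L.rotEdge ^ m = 1 := by
  refine Equiv.ext fun i => L.edge_eq_of_ends ?_
  rw [L.ends_rotEdge_pow, L.rotVertex_pow]
  rfl

/-- The permutation of the crossings that the rotation induces. -/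
noncomputable def rotCrossing : Equiv.Perm L.Crossing :=
  Equiv.ofBijective
    (fun c => ⟨(L.rotEdge c.upper, L.rotEdge c.lower), L.over_rotEdge _ _ c.2⟩)
    (Finite.injective_iff_bijective.1 (by
      intro c c' h
      refine Crossing.upper_injective (L.rotEdge.injective ?_)
      exact congrArg (fun x => x.1.1) h))

theorem rotCrossing_upper (c : L.Crossing) : (L.rotCrossing c).upper = L.rotEdge c.upper := rfl

theorem rotCrossing_lower (c : L.Crossing) : (L.rotCrossing c).lower = L.rotEdge c.lower := rfl

theorem rotCrossing_pow [NeZero m] : L.rotCrossing ^ m = 1 := by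
  have key : ∀ (n : ℕ) (c : L.Crossing),
      ((L.rotCrossing ^ n) c).upper = (L.rotEdge ^ n) c.upper := by
    intro n
    induction n with
    | zero => intro c; rfl
    | succ n ih =>
      intro c
      rw [pow_succ', pow_succ', Equiv.Perm.mul_apply, Equiv.Perm.mul_apply, rotCrossing_upper, ih]
  refine Equiv.ext fun c => Crossing.upper_injective ?_
  rw [key, L.rotEdge_pow]
  rfl

/-- The action of the rotation on the Kauffman states. -/
noncomputable def rotState (S : Finset L.Crossing) : Finset L.Crossing :=
  S.map L.rotCrossing.toEmbedding

theorem mem_rotState (S : Finset L.Crossing) (c : L.Crossing) :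
    L.rotCrossing c ∈ L.rotState S ↔ c ∈ S := by
  simp [rotState]

theorem dir_rotEdge (i : Fin L.size) :
    (L.rotVertex i = L.rotEdge i ∧ L.rotVertex (L.next i) = L.next (L.rotEdge i) ∧
      L.dir (L.rotEdge i) = Complex.exp (2 * Real.pi * Complex.I / m) * L.dir i) ∨
    (L.rotVertex i = L.next (L.rotEdge i) ∧ L.rotVertex (L.next i) = L.rotEdge i ∧
      L.dir (L.rotEdge i) = - (Complex.exp (2 * Real.pi * Complex.I / m) * L.dir i)) := by
  have hv : ∀ v, (L.pos (L.rotVertex v)).1 =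
      Complex.exp (2 * Real.pi * Complex.I / m) * (L.pos v).1 := by
    intro v
    rw [L.pos_rotVertex]
    rfl
  rcases L.ends_cases i with ⟨h1, h2⟩ | ⟨h1, h2⟩
  · refine Or.inl ⟨h1, h2, ?_⟩
    rw [PolygonalLink.dir, PolygonalLink.dir, ← h2, ← h1, hv, hv, mul_sub]
  · refine Or.inr ⟨h1, h2, ?_⟩
    rw [PolygonalLink.dir, PolygonalLink.dir, ← h1, ← h2]
    rw [hv, hv]
    ring

theorem det_rot (u v z : ℂ) (hz : (starRingEnd ℂ) z * z = 1) :
    ((starRingEnd ℂ) (z * u) * (z * v)).im = ((starRingEnd ℂ) u * v).im := by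
  rw [map_mul, show (starRingEnd ℂ) z * (starRingEnd ℂ) u * (z * v) =
    ((starRingEnd ℂ) z * z) * ((starRingEnd ℂ) u * v) by ring, hz, one_mul]

theorem conj_rot (m : ℕ) : (starRingEnd ℂ) (Complex.exp (2 * Real.pi * Complex.I / m)) *
    Complex.exp (2 * Real.pi * Complex.I / m) = 1 := by
  rw [← Complex.exp_conj, ← Complex.exp_add]
  rw [show (starRingEnd ℂ) (2 * Real.pi * Complex.I / m) + 2 * Real.pi * Complex.I / m = 0 by
    simp [map_div₀, Complex.conj_ofNat, neg_div]]
  exact Complex.exp_zero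

theorem joined_rot (S : Finset L.Crossing) (v w : Fin L.size) (h : L.Joined S v w) :
    L.Joined (L.rotState S) (L.rotVertex v) (L.rotVertex w) ∨
    L.Joined (L.rotState S) (L.rotVertex w) (L.rotVertex v) := by
  have hpos : ∀ c : L.Crossing, L.planarDet c.upper c.lower ≠ 0 := fun c =>
    L.regular.transverse _ _ c.2
  have hneg : ∀ x : ℝ, x ≠ 0 → (0 < -x ↔ ¬ 0 < x) := by
    intro x hx
    rw [neg_pos, not_lt]
    exact ⟨le_of_lt, fun h => lt_of_le_of_ne h hx⟩
  have hc : ∀ c : L.Crossing,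
      ((L.rotVertex c.upper = L.rotEdge c.upper ∧
        L.rotVertex (L.next c.upper) = L.next (L.rotEdge c.upper)) ∧
       (L.rotVertex c.lower = L.rotEdge c.lower ∧
        L.rotVertex (L.next c.lower) = L.next (L.rotEdge c.lower)) ∧
       (((L.rotCrossing c).IsPositive ↔ L.rotCrossing c ∉ L.rotState S) ↔
        (c.IsPositive ↔ c ∉ S))) ∨
      ((L.rotVertex c.upper = L.rotEdge c.upper ∧
        L.rotVertex (L.next c.upper) = L.next (L.rotEdge c.upper)) ∧
       (L.rotVertex c.lower = L.next (L.rotEdge c.lower) ∧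
        L.rotVertex (L.next c.lower) = L.rotEdge c.lower) ∧
       (((L.rotCrossing c).IsPositive ↔ L.rotCrossing c ∉ L.rotState S) ↔
        ¬ (c.IsPositive ↔ c ∉ S))) ∨
      ((L.rotVertex c.upper = L.next (L.rotEdge c.upper) ∧
        L.rotVertex (L.next c.upper) = L.rotEdge c.upper) ∧
       (L.rotVertex c.lower = L.rotEdge c.lower ∧
        L.rotVertex (L.next c.lower) = L.next (L.rotEdge c.lower)) ∧
       (((L.rotCrossing c).IsPositive ↔ L.rotCrossing c ∉ L.rotState S) ↔
        ¬ (c.IsPositive ↔ c ∉ S))) ∨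
      ((L.rotVertex c.upper = L.next (L.rotEdge c.upper) ∧
        L.rotVertex (L.next c.upper) = L.rotEdge c.upper) ∧
       (L.rotVertex c.lower = L.next (L.rotEdge c.lower) ∧
        L.rotVertex (L.next c.lower) = L.rotEdge c.lower) ∧
       (((L.rotCrossing c).IsPositive ↔ L.rotCrossing c ∉ L.rotState S) ↔
        (c.IsPositive ↔ c ∉ S))) := by
    intro c
    have hcc := hpos c
    simp only [Crossing.IsPositive, mem_rotState, rotCrossing_upper, rotCrossing_lower,
      PolygonalLink.planarDet] at hcc ⊢
    rcases L.dir_rotEdge c.upper with ⟨a1, a2, a3⟩ | ⟨a1, a2, a3⟩ <;>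
    rcases L.dir_rotEdge c.lower with ⟨b1, b2, b3⟩ | ⟨b1, b2, b3⟩
    · refine Or.inl ⟨⟨a1, a2⟩, ⟨b1, b2⟩, ?_⟩
      rw [a3, b3, det_rot _ _ _ (conj_rot m)]
    · refine Or.inr (Or.inl ⟨⟨a1, a2⟩, ⟨b1, b2⟩, ?_⟩)
      rw [a3, b3, mul_neg, Complex.neg_im, det_rot _ _ _ (conj_rot m), hneg _ hcc]
      tauto
    · refine Or.inr (Or.inr (Or.inl ⟨⟨a1, a2⟩, ⟨b1, b2⟩, ?_⟩))
      rw [a3, b3, map_neg, neg_mul, Complex.neg_im, det_rot _ _ _ (conj_rot m), hneg _ hcc]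
      tauto
    · refine Or.inr (Or.inr (Or.inr ⟨⟨a1, a2⟩, ⟨b1, b2⟩, ?_⟩))
      rw [a3, b3, map_neg, neg_mul_neg, det_rot _ _ _ (conj_rot m)]
  have o₁ := fun c => Joined.oriented₁ (L := L) (S := L.rotState S) (L.rotCrossing c)
  have o₂ := fun c => Joined.oriented₂ (L := L) (S := L.rotState S) (L.rotCrossing c)
  have u₁ := fun c => Joined.unoriented₁ (L := L) (S := L.rotState S) (L.rotCrossing c)
  have u₂ := fun c => Joined.unoriented₂ (L := L) (S := L.rotState S) (L.rotCrossing c)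
  simp only [rotCrossing_upper, rotCrossing_lower] at o₁ o₂ u₁ u₂
  cases h with
  | edge i hi =>
    have h' : ∀ j, ¬ L.Crosses (L.rotEdge v) j := by
      intro j hj
      obtain ⟨j, rfl⟩ := L.rotEdge.surjective j
      exact hi j ((L.crosses_rotEdge_iff v j).1 hj)
    have := Joined.edge (S := L.rotState S) _ h'
    rcases L.ends_cases v with ⟨h1, h2⟩ | ⟨h1, h2⟩ <;> rw [h1, h2] <;> tauto
  | oriented₁ c h =>
    specialize o₁ c; specialize o₂ c; specialize u₁ c; specialize u₂ c
    rcases hc c with ⟨⟨a1, a2⟩, ⟨b1, b2⟩, e⟩ | ⟨⟨a1, a2⟩, ⟨b1, b2⟩, e⟩ |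
      ⟨⟨a1, a2⟩, ⟨b1, b2⟩, e⟩ | ⟨⟨a1, a2⟩, ⟨b1, b2⟩, e⟩ <;>
    simp only [e, h, a1, a2, b1, b2, not_true_eq_false, not_false_eq_true, forall_const] at * <;>
    tauto
  | oriented₂ c h =>
    specialize o₁ c; specialize o₂ c; specialize u₁ c; specialize u₂ c
    rcases hc c with ⟨⟨a1, a2⟩, ⟨b1, b2⟩, e⟩ | ⟨⟨a1, a2⟩, ⟨b1, b2⟩, e⟩ |
      ⟨⟨a1, a2⟩, ⟨b1, b2⟩, e⟩ | ⟨⟨a1, a2⟩, ⟨b1, b2⟩, e⟩ <;>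
    simp only [e, h, a1, a2, b1, b2, not_true_eq_false, not_false_eq_true, forall_const] at * <;>
    tauto
  | unoriented₁ c h =>
    specialize o₁ c; specialize o₂ c; specialize u₁ c; specialize u₂ c
    rcases hc c with ⟨⟨a1, a2⟩, ⟨b1, b2⟩, e⟩ | ⟨⟨a1, a2⟩, ⟨b1, b2⟩, e⟩ |
      ⟨⟨a1, a2⟩, ⟨b1, b2⟩, e⟩ | ⟨⟨a1, a2⟩, ⟨b1, b2⟩, e⟩ <;>
    simp only [e, h, a1, a2, b1, b2, not_true_eq_false, not_false_eq_true, forall_const] at * <;>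
    tauto
  | unoriented₂ c h =>
    specialize o₁ c; specialize o₂ c; specialize u₁ c; specialize u₂ c
    rcases hc c with ⟨⟨a1, a2⟩, ⟨b1, b2⟩, e⟩ | ⟨⟨a1, a2⟩, ⟨b1, b2⟩, e⟩ |
      ⟨⟨a1, a2⟩, ⟨b1, b2⟩, e⟩ | ⟨⟨a1, a2⟩, ⟨b1, b2⟩, e⟩ <;>
    simp only [e, h, a1, a2, b1, b2, not_true_eq_false, not_false_eq_true, forall_const] at * <;>
    tauto

theorem circle_rot_eq (S : Finset L.Crossing) (v w : Fin L.size)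
    (h : L.circle S v = L.circle S w) :
    L.circle (L.rotState S) (L.rotVertex v) = L.circle (L.rotState S) (L.rotVertex w) := by
  have h' := Quot.eqvGen_exact h
  clear h
  induction h' with
  | rel x y h =>
    rcases L.joined_rot S x y h with h | h
    · exact Quot.sound h
    · exact (Quot.sound h).symm
  | refl x => rfl
  | symm x y _ ih => exact ih.symm
  | trans x y z _ _ ih1 ih2 => exact ih1.trans ih2

/-- The permutation of the pairs of a state and a vertex that the rotation induces. -/
noncomputable def rotPair : Equiv.Perm (Finset L.Crossing × Fin L.size) :=
  Equiv.prodCongr (Equiv.finsetCongr L.rotCrossing) L.rotVertex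

theorem circle_rot_iff (S : Finset L.Crossing) (v w : Fin L.size) :
    L.circle (L.rotState S) (L.rotVertex v) = L.circle (L.rotState S) (L.rotVertex w) ↔
      L.circle S v = L.circle S w := by
  refine ⟨fun h => ?_, L.circle_rot_eq S v w⟩
  have := L.rotPair.rel_of_rel_apply
    (fun x y => x.1 = y.1 ∧ L.circle x.1 x.2 = L.circle x.1 y.2)
    (by
      rintro ⟨S, v⟩ ⟨S', w⟩ ⟨rfl, h⟩
      exact ⟨rfl, L.circle_rot_eq S v w h⟩) (S, v) (S, w) ⟨rfl, h⟩
  exact this.2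

theorem EnhancedState.label_eq {L : PeriodicLink m} (E : L.EnhancedState) {v w : Fin L.size}
    (h : L.circle E.state v = L.circle E.state w) : E.label v = E.label w :=
  congrArg E.circleLabel h

theorem EnhancedState.ext {L : PeriodicLink m} {E E' : L.EnhancedState}
    (h : E.state = E'.state) (h' : ∀ v, E.label v = E'.label v) : E = E' :=
  Subtype.ext (Prod.ext h (funext h'))

/-- The action of the rotation on the enhanced states. -/
noncomputable def rotEnhanced : Equiv.Perm L.EnhancedState :=
  Equiv.ofBijective
    (fun E => ⟨(L.rotState E.state, fun v => E.label (L.rotVertex.symm v)), by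
      intro v w h
      refine E.label_eq ((L.circle_rot_iff _ _ _).1 ?_)
      rw [Equiv.apply_symm_apply, Equiv.apply_symm_apply]
      exact Quot.sound h⟩)
    (Finite.injective_iff_bijective.1 (by
      intro E E' h
      have h1 : L.rotState E.state = L.rotState E'.state := congrArg (fun x => x.1.1) h
      have h2 : (fun v => E.label (L.rotVertex.symm v)) = fun v => E'.label (L.rotVertex.symm v) :=
        congrArg (fun x => x.1.2) h
      refine EnhancedState.ext (Finset.map_injective _ h1) fun v => ?_
      simpa using congrFun h2 (L.rotVertex v)))

theorem rotEnhanced_state (E : L.EnhancedState) :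
    (L.rotEnhanced E).state = L.rotState E.state := rfl

theorem rotEnhanced_label (E : L.EnhancedState) (v : Fin L.size) :
    (L.rotEnhanced E).label (L.rotVertex v) = E.label v :=
  congrArg E.label (L.rotVertex.symm_apply_apply v)

theorem rotEnhanced_pow_state (n : ℕ) (E : L.EnhancedState) :
    ((L.rotEnhanced ^ n) E).state = E.state.map (L.rotCrossing ^ n).toEmbedding := by
  induction n with
  | zero => exact Finset.map_refl.symm
  | succ n ih =>
    rw [pow_succ', Equiv.Perm.mul_apply, rotEnhanced_state, ih, rotState, Finset.map_map, pow_succ']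
    rfl

theorem rotEnhanced_pow_label (n : ℕ) (E : L.EnhancedState) (v : Fin L.size) :
    ((L.rotEnhanced ^ n) E).label ((L.rotVertex ^ n) v) = E.label v := by
  induction n with
  | zero => rfl
  | succ n ih =>
    rw [pow_succ', Equiv.Perm.mul_apply, pow_succ', Equiv.Perm.mul_apply, rotEnhanced_label, ih]

theorem rotEnhanced_pow [NeZero m] : L.rotEnhanced ^ m = 1 := by
  refine Equiv.ext fun E => EnhancedState.ext ?_ fun v => ?_
  · rw [rotEnhanced_pow_state, rotCrossing_pow]
    exact Finset.map_refl
  · have := L.rotEnhanced_pow_label m E v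
    rwa [rotVertex_pow] at this

theorem mulCoeff_comm (a b c : Bool) : mulCoeff a b c = mulCoeff b a c := by
  cases a <;> cases b <;> cases c <;> rfl

theorem comulCoeff_comm (a b c : Bool) : comulCoeff a b c = comulCoeff a c b := by
  cases a <;> cases b <;> cases c <;> rfl

theorem circle_rotEnhanced_iff (E : L.EnhancedState) (v w : Fin L.size) :
    L.circle (L.rotEnhanced E).state (L.rotVertex v) =
      L.circle (L.rotEnhanced E).state (L.rotVertex w) ↔ L.circle E.state v = L.circle E.state w :=
  L.circle_rot_iff _ _ _

theorem saddleCoeff_rot (E E' : L.EnhancedState) (u u' : Fin L.size) :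
    L.saddleCoeff (L.rotEnhanced E) (L.rotEnhanced E') (L.rotVertex u) (L.rotVertex u') =
      L.saddleCoeff E E' u u' := by
  have h : L.AgreeOff (L.rotEnhanced E) (L.rotEnhanced E') (L.rotVertex u) (L.rotVertex u') ↔
      L.AgreeOff E E' u u' := by
    unfold AgreeOff
    rw [← Equiv.forall_congr_right L.rotVertex]
    simp only [rotEnhanced_label, ne_eq, circle_rotEnhanced_iff]
  classical
  unfold saddleCoeff
  rw [rotEnhanced_label, rotEnhanced_label, rotEnhanced_label, rotEnhanced_label]
  refine if_congr h (if_congr ?_ rfl (if_congr ?_ rfl rfl)) rfl <;>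
    simp only [ne_eq, circle_rotEnhanced_iff]

theorem saddleCoeff_comm (E E' : L.EnhancedState) (u u' : Fin L.size) :
    L.saddleCoeff E E' u u' = L.saddleCoeff E E' u' u := by
  have e1 : L.AgreeOff E E' u u' ↔ L.AgreeOff E E' u' u :=
    ⟨fun h v h1 h2 => h v h2 h1, fun h v h1 h2 => h v h2 h1⟩
  classical
  unfold saddleCoeff
  refine if_congr e1 ?_ rfl
  have e2 : (L.circle E.state u ≠ L.circle E.state u' ∧
      L.circle E'.state u = L.circle E'.state u') ↔ (L.circle E.state u' ≠ L.circle E.state u ∧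
      L.circle E'.state u' = L.circle E'.state u) :=
    and_congr ne_comm eq_comm
  have e3 : (L.circle E.state u = L.circle E.state u' ∧
      L.circle E'.state u ≠ L.circle E'.state u') ↔ (L.circle E.state u' = L.circle E.state u ∧
      L.circle E'.state u' ≠ L.circle E'.state u) :=
    and_congr eq_comm ne_comm
  by_cases h : L.circle E.state u ≠ L.circle E.state u' ∧
      L.circle E'.state u = L.circle E'.state u'
  · rw [if_pos h, if_pos (e2.1 h), mulCoeff_comm, E'.label_eq h.2]
  · rw [if_neg h, if_neg (mt e2.2 h)]
    by_cases h : L.circle E.state u = L.circle E.state u' ∧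
        L.circle E'.state u ≠ L.circle E'.state u'
    · rw [if_pos h, if_pos (e3.1 h), comulCoeff_comm, E.label_eq h.1]
    · rw [if_neg h, if_neg (mt e3.2 h)]

theorem edgeCoeff_rot (c : L.Crossing) (E E' : L.EnhancedState) :
    L.edgeCoeff (L.rotCrossing c) (L.rotEnhanced E) (L.rotEnhanced E') = L.edgeCoeff c E E' := by
  have hins : L.rotState (insert c E.state) = insert (L.rotCrossing c) (L.rotState E.state) := by
    simp [rotState, Finset.map_insert]
  have h1 : (L.rotState E'.state = insert (L.rotCrossing c) (L.rotState E.state)) ↔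
      E'.state = insert c E.state := by
    rw [← hins]
    exact (Finset.map_injective _).eq_iff
  have h2 : L.saddleCoeff (L.rotEnhanced E) (L.rotEnhanced E') (L.rotEdge c.upper)
      (L.next (L.rotEdge c.upper)) = L.saddleCoeff E E' c.upper (L.next c.upper) := by
    rcases L.ends_cases c.upper with ⟨a1, a2⟩ | ⟨a1, a2⟩
    · rw [← a2, ← a1, saddleCoeff_rot]
    · rw [saddleCoeff_comm, ← a1, ← a2, saddleCoeff_rot]
  unfold edgeCoeff
  simp only [rotEnhanced_state, mem_rotState, h1, rotCrossing_upper, h2]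

/-- The sign with which the rotation acts on an enhanced state. -/
noncomputable def rotSign (E : L.EnhancedState) : ℤ := inversionSign L.rotCrossing E.state

theorem diffCoeff_rot (E E' : L.EnhancedState) :
    L.diffCoeff (L.rotEnhanced E) (L.rotEnhanced E') * L.rotSign E =
      L.rotSign E' * L.diffCoeff E E' := by
  unfold diffCoeff
  rw [Finset.sum_mul, Finset.mul_sum, ← Equiv.sum_comp L.rotCrossing]
  refine Finset.sum_congr rfl fun c _ => ?_
  rw [L.edgeCoeff_rot]
  by_cases h : c ∉ E.state ∧ E'.state = insert c E.state
  · have := wedgeSign_map L.rotCrossing E.state c h.1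
    rw [← h.2] at this
    rw [rotEnhanced_state, rotState, rotSign, rotSign, mul_right_comm, this]
    ring
  · have : L.edgeCoeff c E E' = 0 := by
      unfold edgeCoeff
      exact if_neg h
    rw [this]
    ring

variable (F : Type) [Field F]

/-- The action of the rotation on the Khovanov complex.  A smoothing `S` contributes with the
orientation line of `S`, so that the sign of the induced bijection of crossings appears. -/
noncomputable def khRot : Module.End F (L.Chain F) where
  toFun f E := (L.rotSign (L.rotEnhanced.symm E) : F) * f (L.rotEnhanced.symm E)
  map_add' f g := by ext E; simp [mul_add]
  map_smul' a f := by ext E; simp [mul_left_comm]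

theorem khRot_apply (f : L.Chain F) (E : L.EnhancedState) :
    L.khRot F f (L.rotEnhanced E) = (L.rotSign E : F) * f E := by
  simp [khRot]

theorem khRot_pow_apply (n : ℕ) (f : L.Chain F) (E : L.EnhancedState) :
    (L.khRot F ^ n) f ((L.rotEnhanced ^ n) E) =
      (inversionSign (L.rotCrossing ^ n) E.state : F) * f E := by
  induction n with
  | zero => simp [inversionSign_one]
  | succ n ih =>
    rw [pow_succ', Module.End.mul_apply, pow_succ', Equiv.Perm.mul_apply, khRot_apply, ih, pow_succ',
      inversionSign_mul, rotSign, rotEnhanced_pow_state]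
    push_cast
    ring

theorem khRot_pow [NeZero m] : L.khRot F ^ m = 1 := by
  refine LinearMap.ext fun f => funext fun E => ?_
  have := L.khRot_pow_apply F m f E
  rw [rotEnhanced_pow, rotCrossing_pow, inversionSign_one] at this
  simpa using this

theorem khDiff_khRot (f : L.Chain F) :
    L.khDiff F (L.khRot F f) = L.khRot F (L.khDiff F f) := by
  funext E'
  obtain ⟨E', rfl⟩ := L.rotEnhanced.surjective E'
  rw [khRot_apply]
  simp only [khDiff, Matrix.mulVecLin_apply, Matrix.mulVec, dotProduct, Matrix.of_apply]
  rw [← Equiv.sum_comp L.rotEnhanced, Finset.mul_sum]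
  refine Finset.sum_congr rfl fun E _ => ?_
  rw [khRot_apply, ← mul_assoc, ← mul_assoc]
  have := congrArg (Int.cast : ℤ → F) (L.diffCoeff_rot E E')
  push_cast at this
  rw [this]

/-- The Khovanov complex as a module over the group algebra. -/
abbrev ChainModule [NeZero m] : Type := CyclicModule (L.khRot F) (L.khRot_pow F)

/-- The differential of the Khovanov complex as a map of modules over the group algebra. -/
noncomputable def khDiffEquivariant [NeZero m] :
    L.ChainModule F →ₗ[CyclicAlgebra F m] L.ChainModule F :=
  CyclicModule.mapOfCommute _ _ (L.khDiff F) (LinearMap.ext (L.khDiff_khRot F))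

end PeriodicLink

/-! ## Equivariant Khovanov homology and the Jones polynomials -/

namespace PeriodicLink

variable {m : ℕ} [NeZero m] (L : PeriodicLink m) {F : Type} [Field F]
  (M : ModuleCat.{0} (CyclicAlgebra F m))

/-- The product of the modules `Hom(P a, C)`, where `P` is a projective resolution of `M` over the
group algebra and `C` is the Khovanov complex. -/
def EKhCochain : Type :=
  ∀ a : ℕ, (CategoryTheory.projectiveResolution M).complex.X a →ₗ[CyclicAlgebra F m] L.ChainModule F

noncomputable instance : AddCommGroup (L.EKhCochain M) :=
  inferInstanceAs (AddCommGroup (∀ a : ℕ,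
    (CategoryTheory.projectiveResolution M).complex.X a →ₗ[CyclicAlgebra F m] L.ChainModule F))

noncomputable instance : Module F (L.EKhCochain M) :=
  inferInstanceAs (Module F (∀ a : ℕ,
    (CategoryTheory.projectiveResolution M).complex.X a →ₗ[CyclicAlgebra F m] L.ChainModule F))

/-- The differential of the total complex of `Hom(P, C)`, given on `Hom(P a, C)` by composition with
the Khovanov differential, with the sign `(-1) ^ a`, and with the differential of `P`.  (For `a = 0`
the second term vanishes, since then `P.d a (a - 1) = 0`.) -/
noncomputable def ekhDiff : L.EKhCochain M →ₗ[F] L.EKhCochain M where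
  toFun φ a := (-1 : F) ^ a • (L.khDiffEquivariant F ∘ₗ φ a) +
    φ (a - 1) ∘ₗ ((CategoryTheory.projectiveResolution M).complex.d a (a - 1)).hom
  map_add' φ ψ := by
    funext a
    change (-1 : F) ^ a • (L.khDiffEquivariant F ∘ₗ (φ a + ψ a)) + (φ (a - 1) + ψ (a - 1)) ∘ₗ _ =
      ((-1 : F) ^ a • (L.khDiffEquivariant F ∘ₗ φ a) + φ (a - 1) ∘ₗ _) +
      ((-1 : F) ^ a • (L.khDiffEquivariant F ∘ₗ ψ a) + ψ (a - 1) ∘ₗ _)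
    rw [LinearMap.comp_add, LinearMap.add_comp, smul_add]
    abel
  map_smul' c φ := by
    funext a
    change (-1 : F) ^ a • (L.khDiffEquivariant F ∘ₗ (c • φ a)) + (c • φ (a - 1)) ∘ₗ _ =
      c • ((-1 : F) ^ a • (L.khDiffEquivariant F ∘ₗ φ a) + φ (a - 1) ∘ₗ _)
    refine LinearMap.ext fun x => ?_
    have h : ∀ y, L.khDiffEquivariant F (c • y) = c • L.khDiffEquivariant F y :=
      (L.khDiff F).map_smul c
    simp [h, smul_comm c]

/-- The degree `i` part, of quantum degree `k`, of the total complex of `Hom(P, C)`: the sum over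
`a + b = i` of `Hom(P a, C^{b,k})`. -/
noncomputable def ekhGraded (i k : ℤ) : Submodule F (L.EKhCochain M) where
  carrier := {φ | ∀ (a : ℕ) x, CyclicModule.toVec _ _ (φ a x) ∈ L.khGraded F (i - (a : ℤ)) k}
  zero_mem' := fun _ _ => Submodule.zero_mem _
  add_mem' hφ hψ := fun a x => Submodule.add_mem _ (hφ a x) (hψ a x)
  smul_mem' c _ hφ := fun a x => Submodule.smul_mem _ c (hφ a x)

/-- The equivariant Khovanov homology `EKh^{i,k}(L; M) = Ext^i(M, C^{*,k})`: cocycles modulo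
coboundaries in the total complex of `Hom(P, C)`. -/
abbrev EKh (i k : ℤ) : Type :=
  ↥(LinearMap.ker (L.ekhDiff M) ⊓ L.ekhGraded M i k) ⧸
    ((L.ekhGraded M (i - 1) k).map (L.ekhDiff M)).submoduleOf
      (LinearMap.ker (L.ekhDiff M) ⊓ L.ekhGraded M i k)

/-- The total equivariant Khovanov homology is finite-dimensional. -/
def EKhFinite : Prop :=
  (∀ i k, Module.Finite F (L.EKh M i k)) ∧ {p : ℤ × ℤ | Nontrivial (L.EKh M p.1 p.2)}.Finite

/-- The equivariant Jones polynomial `EJ(L; M)`: the value at `t = -1` of the equivariant Khovanov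
polynomial `∑ t^i q^k dim EKh^{i,k}(L; M)`. -/
noncomputable def equivariantJones : LaurentPolynomial ℤ :=
  ∑ᶠ p : ℤ × ℤ, LaurentPolynomial.C ((p.1.negOnePow : ℤ) * Module.finrank F (L.EKh M p.1 p.2)) *
    LaurentPolynomial.T p.2

end PeriodicLink

/-- The (unreduced) Jones polynomial in Khovanov's normalization, as the Kauffman state sum
`(-1)^{n₋} q^{n₊ - 2n₋} ∑_S (-q)^{|S|} (q + q⁻¹)^{#circles(S)}`; its value on the unknot is
`q + q⁻¹`. -/
noncomputable def PeriodicLink.jones {m : ℕ} (L : PeriodicLink m) : LaurentPolynomial ℤ :=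
  (-1) ^ L.nNeg * LaurentPolynomial.T ((L.nPos : ℤ) - 2 * L.nNeg) *
    ∑ S : Finset L.Crossing, (-LaurentPolynomial.T 1) ^ S.card *
      (LaurentPolynomial.T 1 + LaurentPolynomial.T (-1)) ^ Fintype.card (L.Circles S)

/-! ## The modules `V_χ` and `F_r[ξ_d]` -/

/-- The `F[ℤ/m]`-module `F[X]/(f)`, where `f` divides `X^m - 1` and the generator of `ℤ/m` acts by
multiplication by `X`. -/
noncomputable def polyModule {F : Type} [Field F] (m : ℕ) [NeZero m] (f : F[X])
    (hf : f ∣ X ^ m - 1) : ModuleCat.{0} (CyclicAlgebra F m) :=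
  ModuleCat.of _ (CyclicModule (m := m) (LinearMap.mulLeft F (AdjoinRoot.root f)) (by
    have h : AdjoinRoot.root f ^ m = 1 := by
      have := AdjoinRoot.mk_eq_zero.2 hf
      simpa [sub_eq_zero] using this
    rw [LinearMap.pow_mulLeft, h, LinearMap.mulLeft_one]
    rfl))

/-- The cyclotomic coset mod `r` of `a` in `ℤ/m`. -/
noncomputable def cyclotomicCoset (m r : ℕ) [NeZero m] (a : ZMod m) : Finset (ZMod m) := by
  classical
  exact Finset.univ.filter fun b => ∃ k : ℕ, a * (r : ZMod m) ^ k = b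

/-- The set `C(m,r)` of cyclotomic cosets mod `r` in `ℤ/m`. -/
def CyclotomicCosets (m r : ℕ) [NeZero m] : Type :=
  {χ : Finset (ZMod m) // ∃ a, χ = cyclotomicCoset m r a}

instance (m r : ℕ) [NeZero m] : Finite (CyclotomicCosets m r) := by
  unfold CyclotomicCosets; infer_instance

noncomputable instance (m r : ℕ) [NeZero m] : Fintype (CyclotomicCosets m r) := Fintype.ofFinite _

/-- The set `C(m,r)_d` of the cyclotomic cosets whose elements `a` satisfy `gcd(a, m) = d`. -/
noncomputable def cosetsOfGcd (m r : ℕ) [NeZero m] (d : ℕ) : Finset (CyclotomicCosets m r) := by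
  classical
  exact Finset.univ.filter fun χ => ∀ a ∈ χ.1, Nat.gcd a.val m = d

/-- The multiplicative order `f_{d,r}` of `r` modulo `d`. -/
noncomputable def multOrder (d r : ℕ) : ℕ := orderOf (r : ZMod d)

section Cosets

variable {m r : ℕ} [NeZero m] [Fact r.Prime] {K : Type*} [Field K] [Algebra (ZMod r) K] {ξ : K}

theorem exists_cosetPoly (hξ : IsPrimitiveRoot ξ m) (χ : CyclotomicCosets m r) :
    ∃ f : (ZMod r)[X], f.map (algebraMap (ZMod r) K) = ∏ u ∈ χ.1, (X - C (ξ ^ u.val)) := by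
  classical
  have : CharP K r := charP_of_injective_algebraMap (algebraMap (ZMod r) K).injective r
  set P : K[X] := ∏ u ∈ χ.1, (X - C (ξ ^ u.val)) with hP
  have hfix : ∀ x : K, x ^ r = x → x ∈ (algebraMap (ZMod r) K).range := by
    intro x hx
    obtain ⟨n, rfl⟩ := (mem_bot_iff_intCast r K).1
      ((Subfield.mem_bot_iff_pow_eq_self K r).2 hx)
    exact ⟨n, map_intCast _ n⟩
  have hinj : ∀ u v : ZMod m, ξ ^ u.val = ξ ^ v.val → u = v := fun u v h =>
    ZMod.val_injective m (hξ.pow_inj (ZMod.val_lt u) (ZMod.val_lt v) h)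
  have hfrob : ∀ u : ZMod m, (ξ ^ u.val) ^ r = ξ ^ (u * (r : ZMod m)).val := by
    intro u
    rw [← pow_mul, ZMod.val_mul, ZMod.val_natCast, Nat.mul_mod_mod]
    exact pow_eq_pow_mod _ hξ.pow_eq_one
  have hmap : P.map (frobenius K r) = P := by
    rw [hP, Polynomial.map_prod]
    have h1 : ∀ u ∈ χ.1, (X - C (ξ ^ u.val)).map (frobenius K r) =
        X - C (ξ ^ (u * (r : ZMod m)).val) := by
      intro u _
      rw [Polynomial.map_sub, Polynomial.map_X, Polynomial.map_C, frobenius_def, hfrob]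
    rw [Finset.prod_congr rfl h1]
    have hri : Set.InjOn (fun u : ZMod m => u * (r : ZMod m)) χ.1 := by
      intro u _ v _ h
      refine hinj u v (frobenius_inj K r ?_)
      rw [frobenius_def, frobenius_def, hfrob, hfrob]
      exact congrArg (fun w : ZMod m => ξ ^ w.val) h
    have himg : χ.1.image (fun u : ZMod m => u * (r : ZMod m)) = χ.1 := by
      refine Finset.eq_of_subset_of_card_le ?_ (Finset.card_image_of_injOn hri).ge
      intro b hb
      obtain ⟨u, hu, rfl⟩ := Finset.mem_image.1 hb
      obtain ⟨a, ha⟩ := χ.2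
      rw [ha] at hu ⊢
      simp only [cyclotomicCoset, Finset.mem_filter, Finset.mem_univ, true_and] at hu ⊢
      obtain ⟨k, rfl⟩ := hu
      exact ⟨k + 1, by rw [pow_succ, mul_assoc]⟩
    conv_rhs => rw [← himg, Finset.prod_image hri]
  have hlift : P ∈ Polynomial.lifts (algebraMap (ZMod r) K) := by
    rw [Polynomial.lifts_iff_coeff_lifts]
    intro n
    apply hfix
    have := congrArg (fun Q => Polynomial.coeff Q n) hmap
    simpa [Polynomial.coeff_map, frobenius_def] using this
  exact (Polynomial.mem_lifts _).1 hlift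

/-- The polynomial `f_χ = ∏_{u ∈ χ} (X - ξ^u)` with coefficients in `F_r`, where `ξ` is a primitive
`m`-th root of unity in an extension of `F_r`. -/
noncomputable def cosetPoly (hξ : IsPrimitiveRoot ξ m) (χ : CyclotomicCosets m r) : (ZMod r)[X] :=
  (exists_cosetPoly hξ χ).choose

theorem cosetPoly_map (hξ : IsPrimitiveRoot ξ m) (χ : CyclotomicCosets m r) :
    (cosetPoly hξ χ).map (algebraMap (ZMod r) K) = ∏ u ∈ χ.1, (X - C (ξ ^ u.val)) :=
  (exists_cosetPoly hξ χ).choose_spec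

theorem cosetPoly_dvd (hξ : IsPrimitiveRoot ξ m) (χ : CyclotomicCosets m r) :
    cosetPoly hξ χ ∣ X ^ m - 1 := by
  classical
  rw [← Polynomial.map_dvd_map' (algebraMap (ZMod r) K), cosetPoly_map]
  rw [Polynomial.map_sub, Polynomial.map_pow, Polynomial.map_X, Polynomial.map_one,
    X_pow_sub_one_eq_prod (NeZero.pos m) hξ]
  have hinj : Set.InjOn (fun u : ZMod m => ξ ^ u.val) χ.1 := fun u _ v _ h =>
    ZMod.val_injective m (hξ.pow_inj (ZMod.val_lt u) (ZMod.val_lt v) h)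
  rw [← Finset.prod_image (f := fun z => X - C z) hinj]
  refine Finset.prod_dvd_prod_of_subset _ _ _ fun z hz => ?_
  obtain ⟨u, -, rfl⟩ := Finset.mem_image.1 hz
  rw [Polynomial.mem_nthRootsFinset (NeZero.pos m), ← pow_mul, mul_comm, pow_mul, hξ.pow_eq_one,
    one_pow]

/-- The module `V_χ = F_r[X]/(f_χ)`. -/
noncomputable def cosetModule (hξ : IsPrimitiveRoot ξ m) (χ : CyclotomicCosets m r) :
    ModuleCat.{0} (CyclicAlgebra (ZMod r) m) :=
  polyModule m (cosetPoly hξ χ) (cosetPoly_dvd hξ χ)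

end Cosets

/-- The module `F_r[ξ_d] = F_r[X]/(Φ_d)`, for a divisor `d` of `m`. -/
noncomputable def cyclotomicModule (m r : ℕ) [NeZero m] [Fact r.Prime] (d : ℕ) (hd : d ∣ m) :
    ModuleCat.{0} (CyclicAlgebra (ZMod r) m) :=
  polyModule m (cyclotomic d (ZMod r))
    ((cyclotomic.dvd_X_pow_sub_one d (ZMod r)).trans
      (by obtain ⟨k, rfl⟩ := hd; exact pow_one_sub_dvd_pow_mul_sub_one X d k))

/-! ## The normalized equivariant Jones polynomials -/

/-- The inclusion `ℤ[q, q⁻¹] → ℚ[q, q⁻¹]`. -/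
noncomputable def laurentToRat : LaurentPolynomial ℤ →+* LaurentPolynomial ℚ :=
  AddMonoidAlgebra.mapRingHom ℤ (Int.castRingHom ℚ)

namespace PeriodicLink

variable {m r : ℕ} [NeZero m] [Fact r.Prime] {K : Type*} [Field K] [Algebra (ZMod r) K] {ξ : K}

/-- `EJ_{χ,r}(L) = (1 / f_{m/d,r}) EJ(L; V_χ)`, for `χ ∈ C(m,r)_d`. -/
noncomputable def jonesCoset (L : PeriodicLink m) (hξ : IsPrimitiveRoot ξ m) (d : ℕ)
    (χ : CyclotomicCosets m r) : LaurentPolynomial ℚ :=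
  (1 / (multOrder (m / d) r : ℚ)) • laurentToRat (L.equivariantJones (cosetModule hξ χ))

variable (r) in
/-- `EJ_{d,r}(L)`, the sum of the polynomials `EJ_{χ,r}(L)` over all `χ ∈ C(m,r)_{m/d}`. -/
noncomputable def jonesDivisor (L : PeriodicLink m) (hξ : IsPrimitiveRoot ξ m) (d : ℕ) :
    LaurentPolynomial ℚ :=
  ∑ χ ∈ cosetsOfGcd m r (m / d), L.jonesCoset hξ (m / d) χ

end PeriodicLink

open Polynomial

/-! ## Winding angles -/

/-! The algebra is short. Since `r` does not divide `m`, Maschke's theorem makes `Λ` semisimple, so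
every module `M` is projective and `EKh(L; M)` is the cohomology of `Hom_Λ(M, C)`
(`exists_ekh_equiv`). An Euler characteristic can be computed before passing to cohomology, so
`EJ(L; M)` is the alternating sum of the dimensions of `Hom_Λ(M, C^{i,k})`. For `M = F_r[X]/(f)`
with `f ∣ X^m - 1`, a homomorphism amounts to the image of `1`, which can be any vector killed by
`f(T)`, where `T` is the rotation; so what is counted is `dim ker f(T)` on `C^{i,k}`
(`equivariantJones_polyModule`).

These dimensions add over coprime factors. As `X^m - 1` is separable and is the product of the
`Φ_d`, the contributions of the `F_r[ξ_d]` add up to `dim C^{i,k}`, whose Euler characteristic is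
the Kauffman state sum (`jones_eq`). As `Φ_d` is the product of the `f_χ` (`prod_cosetPoly`), the
sum over cosets gives `EJ(L; F_r[ξ_d])`. Each `f_χ` is irreducible of degree `f_{m/d,r}`, so `ker
f_χ(T)` is a vector space over a field of that degree, and its dimension is divisible by it; this
gives integrality.

Comparing chains with cohomology requires that the combinatorial differential squares to zero and
has bidegree `(1, 0)`. Both rest on planarity: changing one smoothing must merge two circles or
split one (`circle_insert_ne_iff`). The winding number of the diagram, taken modulo 2 along the
edges, yields a source-sink orientation (`exists_isAlternating`). With it the circles of every
smoothing become the cycles of a permutation of the vertices, and changing a smoothing multiplies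
this permutation by a transposition, which always splits or joins cycles. The degree statement then
follows by comparing labels. For the square of the differential, the edge maps are linear over the
variables of the circles, so the faces of the cube need only be compared on the units of the
smoothings; there, counting circles leaves six patterns of mergers and splits. -/

theorem Equiv.Perm.sum_arg_div_coe {ι : Type} [Fintype ι] (σ : Equiv.Perm ι) (A : ι → ℂ)
    (hA : ∀ j, A j ≠ 0) : ((∑ j, (A (σ j) / A j).arg : ℝ) : Real.Angle) = 0 := by
  have key : ∀ s : Finset ι, ((∑ j ∈ s, (A (σ j) / A j).arg : ℝ) : Real.Angle) =
      ∑ j ∈ s, (((A (σ j)).arg : Real.Angle) - ((A j).arg : Real.Angle)) := by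
    classical
    intro s
    induction s using Finset.induction_on with
    | empty => simp
    | insert a s ha ih =>
      rw [Finset.sum_insert ha, Finset.sum_insert ha, Real.Angle.coe_add, ih,
        Complex.arg_div_coe_angle (hA _) (hA _)]
  rw [key, Finset.sum_sub_distrib, Equiv.sum_comp σ (fun j => ((A j).arg : Real.Angle)), sub_self]

/-- The values lie in one coset of the discrete group `2πℤ`, and the interval is connected. A total
angle is therefore constant wherever no single term meets the cut of `arg`. -/
theorem ContinuousOn.eq_of_coe_angle_eq {f : ℝ → ℝ} (hf : ContinuousOn f (Set.Icc 0 1))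
    (θ : Real.Angle) (h : ∀ t ∈ Set.Icc (0 : ℝ) 1, (f t : Real.Angle) = θ)
    {s t : ℝ} (hs : s ∈ Set.Icc (0 : ℝ) 1) (ht : t ∈ Set.Icc (0 : ℝ) 1) : f s = f t := by
  have hmaps : Set.MapsTo (fun x => f x - f s) (Set.Icc 0 1)
      (AddSubgroup.zmultiples (2 * Real.pi) : Set ℝ) := by
    intro x hx
    have := (h x hx).trans (h s hs).symm
    obtain ⟨k, hk⟩ := Real.Angle.angle_eq_iff_two_pi_dvd_sub.1 this
    refine AddSubgroup.mem_zmultiples_iff.2 ⟨k, ?_⟩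
    simp only [zsmul_eq_mul]
    linarith
  have hd : DiscreteTopology (AddSubgroup.zmultiples (2 * Real.pi) : Set ℝ) :=
    inferInstanceAs (DiscreteTopology (AddSubgroup.zmultiples (2 * Real.pi)))
  have : f t - f s = f s - f s :=
    isPreconnected_Icc.constant_of_mapsTo ⟨hd⟩ (hf.sub continuousOn_const) hmaps ht hs
  linarith

theorem Complex.exists_eq_neg_mul_of_div_notMem_slitPlane {a b : ℂ} (ha : a ≠ 0) (hb : b ≠ 0)
    (h : a / b ∉ Complex.slitPlane) : ∃ s : ℝ, 0 < s ∧ a = -(s * b) := by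
  rw [Complex.mem_slitPlane_iff, not_or, not_lt, not_not] at h
  have h' : a / b = (((a / b).re : ℝ) : ℂ) := Complex.ext rfl (by simp [h.2])
  refine ⟨-(a / b).re, ?_, ?_⟩
  · have : (a / b).re ≠ 0 := by
      intro h0
      rw [h0] at h'
      exact div_ne_zero ha hb (by simpa using h')
    exact neg_pos.2 (lt_of_le_of_ne h.1 this)
  · push_cast
    rw [← h']
    field_simp

theorem Complex.arg_div_pos_smul {a b : ℂ} {s t : ℝ} (hs : 0 < s) (ht : 0 < t) :
    ((s * a) / (t * b)).arg = (a / b).arg := by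
  rw [show (s * a) / (t * b) = ((s / t : ℝ) : ℂ) * (a / b) by push_cast; ring]
  exact Complex.arg_real_mul _ (div_pos hs ht)

/-! ### Projected edges and their crossings. -/

namespace PeriodicLink

variable {m : ℕ} (L : PeriodicLink m)

/-- The projection of a vertex. -/
noncomputable def vert (i : Fin L.size) : ℂ := (L.pos i).1

theorem dir_eq (i : Fin L.size) : L.dir i = L.vert (L.next i) - L.vert i := rfl

theorem dir_ne_zero (i : Fin L.size) : L.dir i ≠ 0 := by
  rw [dir_eq, sub_ne_zero]
  exact fun h => L.next_ne i (L.regular.proj_injective h)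

/-- A component with only two vertices would run through the same segment twice, as two distinct
edges with the same ends. -/
theorem next_next_ne (i : Fin L.size) : L.next (L.next i) ≠ i := by
  intro h
  refine L.next_ne i (L.edge_eq_of_ends (i := L.next i) (j := i) ?_)
  rw [h, Sym2.eq_swap]

/-- The point with parameter `t` of the projection of an edge. -/
noncomputable def pt (i : Fin L.size) (t : ℝ) : ℂ := L.vert i + t * L.dir i

theorem pt_mem_segment (i : Fin L.size) {t : ℝ} (ht : t ∈ Set.Icc (0 : ℝ) 1) :
    L.pt i t ∈ segment ℝ (L.pos i).1 (L.pos (L.next i)).1 := by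
  rw [segment_eq_image']
  exact ⟨t, ht, by simp [pt, vert, PolygonalLink.dir]⟩

theorem exists_height (i : Fin L.size) {p : ℂ}
    (h : p ∈ segment ℝ (L.pos i).1 (L.pos (L.next i)).1) :
    ∃ a : ℝ, (p, a) ∈ segment ℝ (L.pos i) (L.pos (L.next i)) := by
  have := image_segment ℝ (LinearMap.fst ℝ ℂ ℝ).toAffineMap (L.pos i) (L.pos (L.next i))
  simp only [LinearMap.coe_toAffineMap, LinearMap.fst_apply] at this
  rw [← this] at h
  obtain ⟨⟨w, a⟩, hw, rfl⟩ := h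
  exact ⟨a, hw⟩

theorem exists_pt_eq (i : Fin L.size) {p : ℂ}
    (h : p ∈ segment ℝ (L.pos i).1 (L.pos (L.next i)).1) :
    ∃ t ∈ Set.Icc (0 : ℝ) 1, L.pt i t = p := by
  rw [segment_eq_image'] at h
  obtain ⟨t, ht, rfl⟩ := h
  exact ⟨t, ht, by simp [pt, vert, PolygonalLink.dir]⟩

theorem _root_.PolygonalLink.Crosses.symm' {L : PeriodicLink m} {i j : Fin L.size} (h : L.Crosses i j) :
    L.Crosses j i := Or.symm h

theorem planarDet_swap (i j : Fin L.size) : L.planarDet j i = -L.planarDet i j := by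
  simp only [PolygonalLink.planarDet, Complex.mul_im, Complex.conj_re, Complex.conj_im]
  ring

theorem planarDet_ne_zero {i j : Fin L.size} (h : L.Crosses i j) : L.planarDet i j ≠ 0 := by
  rcases h with h | h
  · exact L.regular.transverse _ _ h
  · rw [planarDet_swap, neg_ne_zero]
    exact L.regular.transverse _ _ h

theorem _root_.PolygonalLink.Crosses.exists_point {L : PeriodicLink m} {i j : Fin L.size} (h : L.Crosses i j) :
    ∃ s ∈ Set.Icc (0 : ℝ) 1, ∃ t ∈ Set.Icc (0 : ℝ) 1, L.pt i s = L.pt j t ∧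
      ∃ a b, a ≠ b ∧ (L.pt i s, a) ∈ segment ℝ (L.pos i) (L.pos (L.next i)) ∧
        (L.pt i s, b) ∈ segment ℝ (L.pos j) (L.pos (L.next j)) := by
  have key : ∀ (w : ℂ) (a b : ℝ), a ≠ b → (w, a) ∈ segment ℝ (L.pos i) (L.pos (L.next i)) →
      (w, b) ∈ segment ℝ (L.pos j) (L.pos (L.next j)) →
      ∃ s ∈ Set.Icc (0 : ℝ) 1, ∃ t ∈ Set.Icc (0 : ℝ) 1, L.pt i s = L.pt j t ∧
      ∃ a b, a ≠ b ∧ (L.pt i s, a) ∈ segment ℝ (L.pos i) (L.pos (L.next i)) ∧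
        (L.pt i s, b) ∈ segment ℝ (L.pos j) (L.pos (L.next j)) := by
    intro w a b hab h1 h2
    have hp : ∀ (k : Fin L.size) (a : ℝ), (w, a) ∈ segment ℝ (L.pos k) (L.pos (L.next k)) →
        w ∈ segment ℝ (L.pos k).1 (L.pos (L.next k)).1 := by
      intro k a h
      have := image_segment ℝ (LinearMap.fst ℝ ℂ ℝ).toAffineMap (L.pos k) (L.pos (L.next k))
      simp only [LinearMap.coe_toAffineMap, LinearMap.fst_apply] at this
      rw [← this]
      exact ⟨_, h, rfl⟩
    obtain ⟨s, hs, hsw⟩ := L.exists_pt_eq i (hp i a h1)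
    obtain ⟨t, ht, htw⟩ := L.exists_pt_eq j (hp j b h2)
    exact ⟨s, hs, t, ht, hsw.trans htw.symm, a, b, hab, by rwa [hsw], by rwa [hsw]⟩
  rcases h with ⟨w, a, b, hab, h1, h2⟩ | ⟨w, a, b, hab, h1, h2⟩
  · exact key w a b hab.ne' h1 h2
  · exact key w b a hab.ne h2 h1

theorem pos_height_unique (i : Fin L.size) {p : ℂ} {a b : ℝ}
    (ha : (p, a) ∈ segment ℝ (L.pos i) (L.pos (L.next i)))
    (hb : (p, b) ∈ segment ℝ (L.pos i) (L.pos (L.next i))) : a = b := by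
  rw [segment_eq_image'] at ha hb
  obtain ⟨s, -, hs⟩ := ha
  obtain ⟨t, -, ht⟩ := hb
  have h1 := congrArg Prod.fst hs
  have h2 := congrArg Prod.fst ht
  simp only [Prod.fst_add, Prod.smul_fst, Prod.fst_sub] at h1 h2
  have h3 : (s - t : ℝ) • L.dir i = 0 := by
    have := h1.trans h2.symm
    rw [PolygonalLink.dir, sub_smul, sub_eq_zero]
    exact add_left_cancel this
  have h4 : s = t := by
    rcases smul_eq_zero.1 h3 with h | h
    · linarith
    · exact absurd h (L.dir_ne_zero i)
  subst h4
  exact congrArg Prod.snd (hs.symm.trans ht)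

theorem _root_.PolygonalLink.Crosses.ne {L : PeriodicLink m} {i j : Fin L.size} (h : L.Crosses i j) : j ≠ i := by
  rintro rfl
  apply L.planarDet_ne_zero h
  have := L.planarDet_swap j j
  linarith

/-- By transversality the projections of two consecutive edges meet only in the projection of their
common vertex. There the two edges have the same height, whereas a crossing needs two different
heights. -/
theorem _root_.PolygonalLink.Crosses.ne_next {L : PeriodicLink m} {i j : Fin L.size} (h : L.Crosses i j) :
    j ≠ L.next i := by
  rintro rfl
  obtain ⟨s, hs, t, ht, hst, a, b, hab, h1, h2⟩ := h.exists_point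
  -- transversality forces the common point to be the common vertex
  have hdet := L.planarDet_ne_zero h
  have e : ((s - 1 : ℝ) : ℂ) * L.dir i = t * L.dir (L.next i) := by
    have : L.pt i s = L.vert (L.next i) + (s - 1 : ℝ) * L.dir i := by
      rw [pt, dir_eq]; push_cast; ring
    rw [this, pt] at hst
    exact add_left_cancel hst
  have ht0 : t = 0 := by
    by_contra ht0
    apply hdet
    have : L.dir (L.next i) = ((s - 1) / t : ℝ) * L.dir i := by
      have ht0' : (t : ℂ) ≠ 0 := by exact_mod_cast ht0
      push_cast at e ⊢
      rw [div_mul_eq_mul_div, eq_div_iff ht0', mul_comm, ← e]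
    rw [PolygonalLink.planarDet, this]
    simp only [Complex.mul_im, Complex.mul_re, Complex.conj_re, Complex.conj_im,
      Complex.ofReal_re, Complex.ofReal_im]
    ring
  have hp : L.pt i s = (L.pos (L.next i)).1 := by
    rw [hst, ht0]; simp [pt, vert]
  rw [hp] at h1 h2
  have e1 := L.pos_height_unique i h1 (b := (L.pos (L.next i)).2) (right_mem_segment ℝ _ _)
  have e2 := L.pos_height_unique _ h2 (b := (L.pos (L.next i)).2) (left_mem_segment ℝ _ _)
  exact hab (e1.trans e2.symm)

theorem _root_.PolygonalLink.Crosses.next_ne {L : PeriodicLink m} {i j : Fin L.size} (h : L.Crosses i j) :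
    L.next j ≠ i := fun e => h.symm'.ne_next e.symm

/-- Two edges without a common vertex whose projections meet cross each other. -/
theorem crosses_of_mem {i j : Fin L.size} {p : ℂ} (hij : j ≠ i) (h1 : L.next j ≠ i)
    (h2 : j ≠ L.next i) (hi : p ∈ segment ℝ (L.pos i).1 (L.pos (L.next i)).1)
    (hj : p ∈ segment ℝ (L.pos j).1 (L.pos (L.next j)).1) : L.Crosses i j := by
  obtain ⟨a, ha⟩ := L.exists_height i hi
  obtain ⟨b, hb⟩ := L.exists_height j hj
  rcases lt_trichotomy a b with h | h | h
  · exact Or.inr ⟨p, b, a, h, hb, ha⟩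
  -- Equal heights give a common point in space, which `embedded` permits only at a common vertex.
  · subst h
    have := L.embedded i j hij.symm ⟨ha, hb⟩
    obtain ⟨hl, hr⟩ := this
    simp only [Set.mem_insert_iff, Set.mem_singleton_iff] at hl hr
    rcases hl with hl | hl <;> rcases hr with hr | hr <;> rw [hl] at hr <;>
      have := L.pos_injective hr
    · exact absurd this.symm hij
    · exact absurd this.symm h1
    · exact absurd this.symm h2
    · exact absurd (L.next.injective this).symm hij
  · exact Or.inl ⟨p, a, b, h, ha, hb⟩

/-- The directions in which the vertices are seen from a point of an edge; for the ends of
the edge they are continued to the ends. -/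
noncomputable def sight (i : Fin L.size) (t : ℝ) (v : Fin L.size) : ℂ :=
  if v = i then -L.dir i else if v = L.next i then L.dir i else L.vert v - L.pt i t

theorem sight_self (i : Fin L.size) (t : ℝ) : L.sight i t i = -L.dir i := by simp [sight]

theorem sight_next (i : Fin L.size) (t : ℝ) : L.sight i t (L.next i) = L.dir i := by
  simp [sight, L.next_ne i]

theorem sight_of_ne {i v : Fin L.size} (h : v ≠ i) (h' : v ≠ L.next i) (t : ℝ) :
    L.sight i t v = L.vert v - L.pt i t := by simp [sight, h, h']

theorem sight_ne_zero (i : Fin L.size) {t : ℝ} (ht : t ∈ Set.Icc (0 : ℝ) 1) (v : Fin L.size) :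
    L.sight i t v ≠ 0 := by
  by_cases h : v = i
  · subst h
    rw [sight_self]
    exact neg_ne_zero.2 (L.dir_ne_zero _)
  by_cases h' : v = L.next i
  · subst h'
    rw [sight_next]
    exact L.dir_ne_zero _
  rw [L.sight_of_ne h h', sub_ne_zero]
  intro e
  have := L.pt_mem_segment i ht
  rw [← e] at this
  exact (L.regular.proj_vertex v i this).elim h h'

theorem continuous_sight (i v : Fin L.size) : Continuous fun t => L.sight i t v := by
  unfold sight pt
  split_ifs <;> fun_prop

/-- Off the slit plane the quotient is a negative real number. For an edge `j` disjoint from edge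
`i` this puts the viewing point between the ends of `j`, so the edges cross. For an adjacent edge
the shared vertex is seen in the direction of edge `i`, and a negative quotient means that the two
projections overlap along a segment, which `proj_vertex` forbids. -/
theorem sight_div_mem_slitPlane (i j : Fin L.size) (hij : j ≠ i) {t : ℝ}
    (ht : t ∈ Set.Icc (0 : ℝ) 1) (hc : ¬ L.Crosses i j) :
    L.sight i t (L.next j) / L.sight i t j ∈ Complex.slitPlane := by
  by_contra hcon
  obtain ⟨s, hs, e⟩ := Complex.exists_eq_neg_mul_of_div_notMem_slitPlane
    (L.sight_ne_zero i ht _) (L.sight_ne_zero i ht _) hcon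
  by_cases h1 : L.next j = i
  · have h2 : j ≠ L.next i := by
      rintro rfl
      exact L.next_next_ne i h1
    rw [h1, sight_self, L.sight_of_ne hij h2] at e
    have hs' : (s : ℂ) ≠ 0 := by exact_mod_cast hs.ne'
    -- Vertex `j` lies on the ray from vertex `i` along edge `i`: either on that edge, or beyond its
    -- end, and then that end lies on edge `j`.
    have e' : L.vert j = L.vert i + ((t + 1 / s : ℝ) : ℂ) * L.dir i := by
      have : L.dir i = s * (L.vert j - L.pt i t) := neg_injective e
      rw [pt] at this
      push_cast
      field_simp
      linear_combination -this
    have hpos : 0 < t + 1 / s := add_pos_of_nonneg_of_pos ht.1 (by positivity)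
    by_cases hle : t + 1 / s ≤ 1
    · have := L.pt_mem_segment i ⟨hpos.le, hle⟩
      rw [pt, ← e'] at this
      exact (L.regular.proj_vertex j i this).elim hij h2
    · push Not at hle
      have hmem : (L.pos (L.next i)).1 ∈ segment ℝ (L.pos j).1 (L.pos (L.next j)).1 := by
        rw [h1, segment_symm, segment_eq_image']
        refine ⟨1 / (t + 1 / s), ⟨by positivity, (div_le_one hpos).2 hle.le⟩, ?_⟩
        change L.vert i + (1 / (t + 1 / s)) • (L.vert j - L.vert i) = L.vert (L.next i)
        rw [e', add_sub_cancel_left, Complex.real_smul, ← mul_assoc, ← Complex.ofReal_mul,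
          one_div_mul_cancel hpos.ne', dir_eq]
        simp
      rcases L.regular.proj_vertex _ _ hmem with h | h
      · exact h2 h.symm
      · exact L.next_ne i (h.trans h1)
  by_cases h2 : j = L.next i
  · subst h2
    rw [sight_next, L.sight_of_ne h1 (L.next_ne _)] at e
    set k := L.next (L.next i) with hk
    -- The following edge turns straight back: its end lies on edge `i`, or beyond the start of edge
    -- `i`, and then that start lies on the following edge.
    have e' : L.vert k = L.vert i + ((t - s : ℝ) : ℂ) * L.dir i := by
      rw [pt] at e
      push_cast
      linear_combination e
    by_cases hle : 0 ≤ t - s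
    · have := L.pt_mem_segment i (t := t - s) ⟨hle, by linarith [ht.2]⟩
      rw [pt, ← e'] at this
      exact (L.regular.proj_vertex k i this).elim h1 (L.next_ne _)
    · push Not at hle
      have hpos : 0 < 1 - (t - s) := by linarith
      have hmem : (L.pos i).1 ∈ segment ℝ (L.pos (L.next i)).1 (L.pos (L.next (L.next i))).1 := by
        rw [segment_eq_image']
        refine ⟨1 / (1 - (t - s)), ⟨by positivity, (div_le_one hpos).2 (by linarith)⟩, ?_⟩
        change L.vert (L.next i) + (1 / (1 - (t - s))) • (L.vert k - L.vert (L.next i)) = L.vert i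
        have h3 : L.vert k - L.vert (L.next i) = ((1 - (t - s) : ℝ) : ℂ) * (-L.dir i) := by
          rw [e', dir_eq]; push_cast; ring
        rw [h3, Complex.real_smul, ← mul_assoc, ← Complex.ofReal_mul,
          one_div_mul_cancel hpos.ne', dir_eq]
        simp
      rcases L.regular.proj_vertex _ _ hmem with h | h
      · exact hij h.symm
      · exact h1 h.symm
  rw [L.sight_of_ne h1 (fun h => hij (L.next.injective h)), L.sight_of_ne hij h2] at e
  refine hc (L.crosses_of_mem hij h1 h2 (L.pt_mem_segment i ht) ?_)
  -- If `p` is the viewing point, `e` reads `next j - p = -s (j - p)`, so `p` divides the edge,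
  -- starting from its end, at the parameter `s / (1 + s)`.
  rw [segment_symm, segment_eq_image']
  have hpos : 0 < 1 + s := by linarith
  refine ⟨s / (1 + s), ⟨by positivity, (div_le_one hpos).2 (by linarith)⟩, ?_⟩
  change L.vert (L.next j) + (s / (1 + s)) • (L.vert j - L.vert (L.next j)) = L.pt i t
  have hpos' : (1 + s : ℂ) ≠ 0 := by exact_mod_cast hpos.ne'
  rw [Complex.real_smul]
  push_cast
  field_simp
  linear_combination e

/-- The total angle under which the diagram is seen from a point of an edge. -/
noncomputable def angleSum (i : Fin L.size) (t : ℝ) : ℝ :=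
  ∑ j, (L.sight i t (L.next j) / L.sight i t j).arg

theorem angleSum_coe (i : Fin L.size) {t : ℝ} (ht : t ∈ Set.Icc (0 : ℝ) 1) :
    (L.angleSum i t : Real.Angle) = 0 :=
  L.next.sum_arg_div_coe _ (L.sight_ne_zero i ht)

theorem arg_sight_self (i : Fin L.size) (t : ℝ) :
    (L.sight i t (L.next i) / L.sight i t i).arg = Real.pi := by
  rw [sight_next, sight_self, div_neg, div_self (L.dir_ne_zero i), Complex.arg_neg_one]

/-- Edge `i` contributes the constant `π`, every other term stays off the cut of `arg` by
`sight_div_mem_slitPlane`, and the total is always a multiple of `2π`. -/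
theorem angleSum_of_not_crosses (i : Fin L.size) (h : ∀ j, ¬ L.Crosses i j) :
    L.angleSum i 0 = L.angleSum i 1 := by
  refine ContinuousOn.eq_of_coe_angle_eq ?_ 0 (fun t ht => L.angleSum_coe i ht)
    (by simp) (by simp)
  unfold angleSum
  refine continuousOn_finsetSum _ fun j _ => ?_
  by_cases hj : j = i
  · subst hj
    simp only [arg_sight_self]
    exact continuousOn_const
  · intro t ht
    refine ContinuousAt.continuousWithinAt ?_
    refine ContinuousAt.comp (g := Complex.arg)
      (f := fun t => L.sight i t (L.next j) / L.sight i t j)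
      (Complex.continuousAt_arg (L.sight_div_mem_slitPlane i j hj ht (h j))) ?_
    exact (L.continuous_sight i _).continuousAt.div (L.continuous_sight i _).continuousAt
      (L.sight_ne_zero i ht _)

/-- Both sums are taken at the same vertex and differ only in the terms of the two edges that meet
there. In each sum the edge one stands on contributes `π`, and the other edge contributes the
turning angle `arg (dir (next i) / dir i)`; the two terms are merely exchanged. -/
theorem angleSum_next (i : Fin L.size) : L.angleSum (L.next i) 0 = L.angleSum i 1 := by
  classical
  have hp0 : L.pt (L.next i) 0 = L.vert (L.next i) := by simp [pt]
  have hp1 : L.pt i 1 = L.vert (L.next i) := by simp [pt, dir_eq]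
  have h0 : ∀ w, w ≠ L.next i → L.sight (L.next i) 0 w = L.vert w - L.vert (L.next i) := by
    intro w hw
    by_cases h : w = L.next (L.next i)
    · subst h
      rw [sight_next, dir_eq]
    · rw [L.sight_of_ne hw h, hp0]
  have h1 : ∀ w, w ≠ L.next i → L.sight i 1 w = L.vert w - L.vert (L.next i) := by
    intro w hw
    by_cases h : w = i
    · subst h
      rw [sight_self, dir_eq, neg_sub]
    · rw [L.sight_of_ne h hw, hp1]
  have hne : i ≠ L.next i := (L.next_ne i).symm
  unfold angleSum
  rw [← Finset.add_sum_erase _ _ (Finset.mem_univ i),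
    ← Finset.add_sum_erase (Finset.univ.erase i) _
      (Finset.mem_erase.2 ⟨hne.symm, Finset.mem_univ (L.next i)⟩),
    ← Finset.add_sum_erase (a := i) Finset.univ
      (fun j => (L.sight i 1 (L.next j) / L.sight i 1 j).arg) (Finset.mem_univ i),
    ← Finset.add_sum_erase (Finset.univ.erase i)
      (fun j => (L.sight i 1 (L.next j) / L.sight i 1 j).arg)
      (Finset.mem_erase.2 ⟨hne.symm, Finset.mem_univ (L.next i)⟩)]
  rw [arg_sight_self, arg_sight_self]
  have e1 : (L.sight (L.next i) 0 (L.next i) / L.sight (L.next i) 0 i).arg =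
      (L.sight i 1 (L.next (L.next i)) / L.sight i 1 (L.next i)).arg := by
    rw [sight_self, h0 i hne, sight_next, h1 _ (L.next_ne _), ← dir_eq, ← neg_sub, ← dir_eq,
      neg_div_neg_eq]
  rw [e1, ← add_assoc, ← add_assoc, add_comm Real.pi]
  congr 1
  refine Finset.sum_congr rfl fun j hj => ?_
  simp only [Finset.mem_erase, Finset.mem_univ, and_true] at hj
  have hj' : L.next j ≠ L.next i := fun h => hj.2 (L.next.injective h)
  rw [h0 _ hj', h0 _ hj.1, h1 _ hj', h1 _ hj.1]

/-- The total angle, with the angle of the edge `k` replaced by that of the complementary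
rays. -/
noncomputable def angleSum' (i k : Fin L.size) (t : ℝ) : ℝ :=
  ∑ j ∈ Finset.univ.erase k, (L.sight i t (L.next j) / L.sight i t j).arg +
    (-(L.sight i t (L.next k) / L.sight i t k)).arg

theorem angleSum_eq (i k : Fin L.size) (t : ℝ) : L.angleSum i t = L.angleSum' i k t +
    ((L.sight i t (L.next k) / L.sight i t k).arg -
      (-(L.sight i t (L.next k) / L.sight i t k)).arg) := by
  unfold angleSum angleSum'
  rw [← Finset.sum_erase_add _ _ (Finset.mem_univ k)]
  ring

/-- Up to the positive factor `1 / |sight k|²`, the imaginary part is the signed area spanned by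
edge `k` as seen from the moving point. It is affine in `t`, vanishes at the crossing, and changes
at a rate given by the determinant of the two directions. -/
theorem exists_im_sight {i k : Fin L.size} (h : L.Crosses i k) {t₀ t₁ : ℝ}
    (h0 : L.pt i t₀ = L.pt k t₁) {t : ℝ} (ht : t ∈ Set.Icc (0 : ℝ) 1) :
    ∃ c : ℝ, 0 < c ∧ (L.sight i t (L.next k) / L.sight i t k).im =
      c * ((t₀ - t) * L.planarDet i k) := by
  have e1 := L.sight_of_ne h.ne h.ne_next t
  have e2 := L.sight_of_ne h.next_ne (fun e => h.ne (L.next.injective e)) t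
  have hn : 0 < Complex.normSq (L.sight i t k) := Complex.normSq_pos.2 (L.sight_ne_zero i ht k)
  refine ⟨1 / Complex.normSq (L.sight i t k), by positivity, ?_⟩
  rw [Complex.div_im, ← sub_div, one_div_mul_eq_div]
  congr 1
  rw [e1, e2, PolygonalLink.planarDet]
  have h3 : L.vert k = L.pt i t₀ - t₁ * L.dir k := by rw [h0, pt]; ring
  have h4 : L.vert (L.next k) = L.vert k + L.dir k := by rw [dir_eq]; ring
  rw [h4, h3, pt, pt]
  simp only [Complex.mul_im, Complex.mul_re, Complex.sub_im, Complex.sub_re, Complex.add_re,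
    Complex.add_im, Complex.ofReal_re, Complex.ofReal_im, Complex.conj_re, Complex.conj_im]
  ring

/-- A crossing at an end of edge `i` would put a vertex on the projection of an edge not incident to
it. -/
theorem crossing_param {i k : Fin L.size} (h : L.Crosses i k) {t₀ t₁ : ℝ}
    (h0 : L.pt i t₀ = L.pt k t₁) (ht₀ : t₀ ∈ Set.Icc (0 : ℝ) 1) (ht₁ : t₁ ∈ Set.Icc (0 : ℝ) 1) :
    0 < t₀ ∧ t₀ < 1 := by
  constructor
  · refine lt_of_le_of_ne ht₀.1 ?_
    rintro rfl
    have := L.pt_mem_segment k ht₁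
    rw [← h0] at this
    have h' : L.pt i 0 = (L.pos i).1 := by simp [pt, vert]
    rw [h'] at this
    exact (L.regular.proj_vertex i k this).elim h.ne.symm h.next_ne.symm
  · refine lt_of_le_of_ne ht₀.2 ?_
    rintro rfl
    have := L.pt_mem_segment k ht₁
    rw [← h0] at this
    have h' : L.pt i 1 = (L.pos (L.next i)).1 := by simp [pt, vert, PolygonalLink.dir]
    rw [h'] at this
    exact (L.regular.proj_vertex _ k this).elim h.ne_next.symm
      (fun e => h.ne (L.next.injective e).symm)

/-- In the interior of the edge, the directions assigned to its ends are positive multiples of the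
true ones, so the convention in `sight` matters only at the ends of the edge. -/
theorem arg_sight_of_pt (i : Fin L.size) {t : ℝ} (ht : 0 < t) (ht' : t < 1) (j : Fin L.size) :
    (L.sight i t (L.next j) / L.sight i t j).arg =
      ((L.vert (L.next j) - L.pt i t) / (L.vert j - L.pt i t)).arg := by
  have key : ∀ v, ∃ s : ℝ, 0 < s ∧ L.vert v - L.pt i t = s * L.sight i t v := by
    intro v
    by_cases h : v = i
    · subst h
      refine ⟨t, ht, ?_⟩
      rw [sight_self, pt]
      ring
    by_cases h' : v = L.next i
    · subst h'
      refine ⟨1 - t, by linarith, ?_⟩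
      rw [sight_next, pt, dir_eq]
      push_cast
      ring
    · exact ⟨1, one_pos, by rw [L.sight_of_ne h h']; simp⟩
  obtain ⟨s, hs, e⟩ := key j
  obtain ⟨s', hs', e'⟩ := key (L.next j)
  rw [e, e', Complex.arg_div_pos_smul hs' hs]

theorem arg_crossing_point (k : Fin L.size) {t : ℝ} (ht : 0 < t) (ht' : t < 1) :
    ((L.vert (L.next k) - L.pt k t) / (L.vert k - L.pt k t)).arg = Real.pi := by
  rw [← L.arg_sight_of_pt k ht ht' k, arg_sight_self]

/-- Only the term of edge `k` meets the cut of `arg`, namely at the crossing. After negation its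
argument is a positive real there and is not real elsewhere, so the modified sum is continuous.
Modulo `2π` the negation adds `π` to a total that is zero. -/
theorem angleSum'_const {i k : Fin L.size} (h : L.Crosses i k) {t₀ t₁ : ℝ}
    (h0 : L.pt i t₀ = L.pt k t₁) (ht₀ : t₀ ∈ Set.Icc (0 : ℝ) 1) (ht₁ : t₁ ∈ Set.Icc (0 : ℝ) 1)
    {t : ℝ} (ht : t ∈ Set.Icc (0 : ℝ) 1) : L.angleSum' i k t = L.angleSum' i k t₀ := by
  refine ContinuousOn.eq_of_coe_angle_eq ?_ Real.pi (fun t ht => ?_) ht ht₀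
  · unfold angleSum'
    refine ContinuousOn.add (continuousOn_finsetSum _ fun j hj => ?_) ?_
    · by_cases hji : j = i
      · subst hji
        simp only [arg_sight_self]
        exact continuousOn_const
      · intro t ht
        have hc : ¬ L.Crosses i j := fun hc =>
          (Finset.mem_erase.1 hj).1 (L.regular.simple i j k hc h)
        refine ContinuousAt.continuousWithinAt ?_
        refine ContinuousAt.comp (g := Complex.arg)
          (f := fun t => L.sight i t (L.next j) / L.sight i t j)
          (Complex.continuousAt_arg (L.sight_div_mem_slitPlane i j hji ht hc)) ?_
        exact (L.continuous_sight i _).continuousAt.div (L.continuous_sight i _).continuousAt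
          (L.sight_ne_zero i ht _)
    · intro t ht
      refine ContinuousAt.continuousWithinAt ?_
      refine ContinuousAt.comp (g := Complex.arg)
        (f := fun t => -(L.sight i t (L.next k) / L.sight i t k)) (Complex.continuousAt_arg ?_)
        ((L.continuous_sight i _).continuousAt.div (L.continuous_sight i _).continuousAt
          (L.sight_ne_zero i ht _)).neg
      obtain ⟨c, hc, e⟩ := L.exists_im_sight h h0 ht
      by_cases htt : t = t₀
      · subst htt
        have h1 := L.crossing_param h h0 ht₀ ht₁
        have h2 := L.crossing_param h.symm' h0.symm ht₁ ht₀
        have h3 := L.arg_sight_of_pt i h1.1 h1.2 k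
        rw [h0, L.arg_crossing_point k h2.1 h2.2, Complex.arg_eq_pi_iff] at h3
        exact Or.inl (by simpa using h3.1)
      · refine Or.inr ?_
        rw [Complex.neg_im, e, neg_ne_zero]
        exact mul_ne_zero hc.ne' (mul_ne_zero (sub_ne_zero.2 (Ne.symm htt)) (L.planarDet_ne_zero h))
  · have hne : L.sight i t (L.next k) / L.sight i t k ≠ 0 :=
      div_ne_zero (L.sight_ne_zero i ht _) (L.sight_ne_zero i ht _)
    have e1 := L.angleSum_coe i ht
    rw [L.angleSum_eq i k, Real.Angle.coe_add, Real.Angle.coe_sub, Complex.arg_neg_coe_angle hne,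
      sub_add_cancel_left, ← sub_eq_add_neg, sub_eq_zero] at e1
    exact e1

/-- At the crossing point both edges contribute exactly `π` to the full sum, and each modified sum
replaces one of these two contributions by `0`. Both are thus the full sum at this point minus `π`.
-/
theorem angleSum'_symm {i k : Fin L.size} (h : L.Crosses i k) {t₀ t₁ : ℝ}
    (h0 : L.pt i t₀ = L.pt k t₁) (ht₀ : t₀ ∈ Set.Icc (0 : ℝ) 1) (ht₁ : t₁ ∈ Set.Icc (0 : ℝ) 1) :
    L.angleSum' i k t₀ = L.angleSum' k i t₁ := by
  have h1 := L.crossing_param h h0 ht₀ ht₁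
  have h2 := L.crossing_param h.symm' h0.symm ht₁ ht₀
  have key : ∀ {i k : Fin L.size} (_ : L.Crosses i k) {t₀ t₁ : ℝ} (_ : L.pt i t₀ = L.pt k t₁)
      (_ : 0 < t₀ ∧ t₀ < 1) (_ : 0 < t₁ ∧ t₁ < 1), L.angleSum' i k t₀ =
      ∑ j, ((L.vert (L.next j) - L.pt i t₀) / (L.vert j - L.pt i t₀)).arg - Real.pi := by
    intro i k h t₀ t₁ h0 h1 h2
    have h3 := L.arg_sight_of_pt i h1.1 h1.2 k
    rw [h0, L.arg_crossing_point k h2.1 h2.2] at h3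
    have h4 : (-(L.sight i t₀ (L.next k) / L.sight i t₀ k)).arg = 0 := by
      rw [Complex.arg_eq_pi_iff] at h3
      rw [Complex.arg_eq_zero_iff]
      simpa using ⟨h3.1.le, h3.2⟩
    have h5 := L.angleSum_eq i k t₀
    rw [h3, h4, angleSum] at h5
    simp only [L.arg_sight_of_pt i h1.1 h1.2] at h5
    linarith
  rw [key h h0 h1 h2, key h.symm' h0.symm h2 h1, h0]

/-- The half-turn that an edge contributes at its start, up to sign. -/
theorem angleSum_of_crosses {i k : Fin L.size} (h : L.Crosses i k) :
    ∃ H : ℝ, ∃ ε : ℝ, (ε = 1 ∨ ε = -1) ∧ L.angleSum i 0 = H + ε * Real.pi ∧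
      L.angleSum i 1 = H - ε * Real.pi ∧ L.angleSum k 0 = H - ε * Real.pi := by
  obtain ⟨t₀, ht₀, t₁, ht₁, h0, -⟩ := h.exists_point
  have h1 := L.crossing_param h h0 ht₀ ht₁
  have h2 := L.crossing_param h.symm' h0.symm ht₁ ht₀
  have pos : ∀ z : ℂ, 0 < z.im → z.arg - (-z).arg = Real.pi := fun z hz => by
    rw [Complex.arg_neg_eq_arg_sub_pi_of_im_pos hz]; ring
  have neg : ∀ z : ℂ, z.im < 0 → z.arg - (-z).arg = -Real.pi := fun z hz => by
    rw [Complex.arg_neg_eq_arg_add_pi_of_im_neg hz]; ring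
  have z0 : (0 : ℝ) ∈ Set.Icc (0 : ℝ) 1 := by simp
  have z1 : (1 : ℝ) ∈ Set.Icc (0 : ℝ) 1 := by simp
  obtain ⟨c, hc, e⟩ := L.exists_im_sight h h0 z0
  obtain ⟨c', hc', e'⟩ := L.exists_im_sight h h0 z1
  obtain ⟨c'', hc'', e''⟩ := L.exists_im_sight h.symm' h0.symm z0
  have f := L.angleSum_eq i k 0
  have f' := L.angleSum_eq i k 1
  have f'' := L.angleSum_eq k i 0
  rw [L.angleSum'_const h h0 ht₀ ht₁ z0] at f
  rw [L.angleSum'_const h h0 ht₀ ht₁ z1] at f'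
  rw [L.angleSum'_const h.symm' h0.symm ht₁ ht₀ z0, ← L.angleSum'_symm h h0 ht₀ ht₁] at f''
  rw [L.planarDet_swap] at e''
  -- The constant `H` is the common value of the two modified sums, and `ε` is the sign of
  -- `planarDet i k`. The determinant changes sign when `i` and `k` are exchanged, so the sums at
  -- the starts of the two edges lie on opposite sides of `H`.
  refine ⟨L.angleSum' i k t₀, ?_⟩
  rcases lt_or_gt_of_ne (L.planarDet_ne_zero h) with hd | hd
  · refine ⟨-1, Or.inr rfl, ?_, ?_, ?_⟩
    · rw [f, neg]
      · ring
      · rw [e, sub_zero]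
        exact mul_neg_of_pos_of_neg hc (mul_neg_of_pos_of_neg h1.1 hd)
    · rw [f', pos]
      · ring
      · rw [e']
        exact mul_pos hc' (mul_pos_of_neg_of_neg (by linarith [h1.2]) hd)
    · rw [f'', pos]
      · ring
      · rw [e'', sub_zero]
        exact mul_pos hc'' (mul_pos h2.1 (by linarith))
  · refine ⟨1, Or.inl rfl, ?_, ?_, ?_⟩
    · rw [f, pos]
      · ring
      · rw [e, sub_zero]
        exact mul_pos hc (mul_pos h1.1 hd)
    · rw [f', neg]
      · ring
      · rw [e']
        exact mul_neg_of_pos_of_neg hc' (mul_neg_of_neg_of_pos (by linarith [h1.2]) hd)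
    · rw [f'', neg]
      · ring
      · rw [e'', sub_zero]
        exact mul_neg_of_pos_of_neg hc'' (mul_neg_of_pos_of_neg h2.1 (by linarith))

/-- A source-sink orientation of the diagram: each piece of the diagram between
crossings is oriented along (`true`) or against (`false`) the link, and at each crossing
two opposite ends point inwards and two outwards. -/
structure IsAlternating (o : Fin L.size → Bool) : Prop where
  next_of_not_crosses : ∀ i, (∀ j, ¬ L.Crosses i j) → o (L.next i) = o i
  next_of_crosses : ∀ i j, L.Crosses i j → o (L.next i) = !o i
  of_crosses : ∀ i j, L.Crosses i j → o j = !o i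

theorem IsAlternating.not {L : PeriodicLink m} {o : Fin L.size → Bool} (h : L.IsAlternating o) :
    L.IsAlternating fun i => !o i :=
  ⟨fun i hi => by rw [h.1 i hi], fun i j hi => by rw [h.2 i j hi], fun i j hi => by rw [h.3 i j hi]⟩

/-- The parity of the winding number at the start of each edge serves as orientation, in the manner
of a checkerboard colouring. It persists along an edge without crossings. By `angleSum_of_crosses`
the winding number changes by one from the start to the end of an edge with a crossing, and differs
by one between the starts of two crossing edges. -/
theorem exists_isAlternating : ∃ o, L.IsAlternating o := by
  have hn : ∀ i, ∃ n : ℤ, L.angleSum i 0 = 2 * Real.pi * n := by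
    intro i
    have := L.angleSum_coe i (t := 0) (by simp)
    rw [← Real.Angle.coe_zero, Real.Angle.angle_eq_iff_two_pi_dvd_sub] at this
    simpa using this
  choose n hn using hn
  have key : ∀ (i j : Fin L.size) (ε : ℝ), (ε = 1 ∨ ε = -1) →
      L.angleSum j 0 = L.angleSum i 0 - 2 * (ε * Real.pi) →
      decide (n j % 2 = 0) = !decide (n i % 2 = 0) := by
    intro i j ε hε h
    rw [hn, hn] at h
    have hpi := Real.pi_pos
    have : (n j : ℝ) = n i - ε := by
      apply mul_left_cancel₀ (mul_pos two_pos hpi).ne'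
      rw [h]
      ring
    have : n j = n i - 1 ∨ n j = n i + 1 := by
      rcases hε with rfl | rfl
      · left; exact_mod_cast this
      · right
        rw [sub_neg_eq_add] at this
        exact_mod_cast this
    rw [← decide_not, decide_eq_decide]
    omega
  refine ⟨fun i => decide (n i % 2 = 0), ⟨fun i hi => ?_, fun i j h => ?_, fun i j h => ?_⟩⟩
  · have h1 := L.angleSum_next i
    rw [← L.angleSum_of_not_crosses i hi, hn, hn] at h1
    have := mul_left_cancel₀ (mul_pos two_pos Real.pi_pos).ne' h1
    have : n (L.next i) = n i := by exact_mod_cast this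
    simp only [this]
  · obtain ⟨H, ε, hε, e1, e2, e3⟩ := L.angleSum_of_crosses h
    exact key _ _ ε hε (by rw [L.angleSum_next]; linarith)
  · obtain ⟨H, ε, hε, e1, e2, e3⟩ := L.angleSum_of_crosses h
    exact key _ _ ε hε (by linarith)

end PeriodicLink

/-! ## The circles of a smoothing as cycles of a permutation -/

namespace Equiv.Perm

variable {α : Type} [DecidableEq α] (f : Perm α) {a b : α}

theorem mul_swap_apply_left : (f * swap a b) a = f b := by simp

theorem mul_swap_apply_right : (f * swap a b) b = f a := by simp

theorem mul_swap_apply_of_ne {x : α} (h : x ≠ a) (h' : x ≠ b) : (f * swap a b) x = f x := by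
  rw [mul_apply, swap_apply_of_ne_of_ne h h']

/-- Let `n` be the first time at which `f` leads from `b` to `a`. The new permutation sends `a` to
`f b`, follows `f` up to `f ^ n b = a`, and closes up there without having visited `b`. -/
theorem not_sameCycle_mul_swap [Finite α] (hab : a ≠ b) (h : f.SameCycle a b) :
    ¬ (f * swap a b).SameCycle a b := by
  classical
  have hex : ∃ n : ℕ, (f ^ n) b = a := h.symm.exists_nat_pow_eq
  set n := Nat.find hex with hn
  have hna : (f ^ n) b = a := Nat.find_spec hex
  have hmin : ∀ j < n, (f ^ j) b ≠ a := fun j hj => Nat.find_min hex hj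
  have hn0 : n ≠ 0 := by
    intro h0
    rw [h0] at hna
    exact hab hna.symm
  have hb : ∀ j, 0 < j → j ≤ n → (f ^ j) b ≠ b := by
    intro j hj hjn hjb
    apply hmin (n - j) (by omega)
    calc (f ^ (n - j)) b = (f ^ (n - j)) ((f ^ j) b) := by rw [hjb]
      _ = a := by rw [← mul_apply, ← pow_add, Nat.sub_add_cancel hjn, hna]
  have key : ∀ i : ℕ, ∃ j, 0 < j ∧ j ≤ n ∧ ((f * swap a b) ^ i) a = (f ^ j) b := by
    intro i
    induction i with
    | zero => exact ⟨n, Nat.pos_of_ne_zero hn0, le_rfl, hna.symm⟩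
    | succ i ih =>
      obtain ⟨j, hj, hjn, e⟩ := ih
      rw [pow_succ', mul_apply, e]
      rcases hjn.lt_or_eq with hlt | rfl
      · exact ⟨j + 1, by omega, hlt, by
          rw [mul_swap_apply_of_ne _ (hmin j hlt) (hb j hj hjn), pow_succ', mul_apply]⟩
      · exact ⟨1, one_pos, by omega, by rw [hna, mul_swap_apply_left, pow_one]⟩
  intro hs
  obtain ⟨i, hi⟩ := hs.exists_nat_pow_eq
  obtain ⟨j, hj, hjn, e⟩ := key i
  exact hb j hj hjn (e.symm.trans hi)

/-- The new permutation sends `b` to `f a` and then follows the old cycle of `a`, which does not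
contain `b`, all the way round to `a`. -/
theorem sameCycle_mul_swap [Finite α] (h : ¬ f.SameCycle a b) : (f * swap a b).SameCycle a b := by
  classical
  have hex : ∃ n : ℕ, 0 < n ∧ (f ^ n) a = a :=
    ⟨orderOf f, orderOf_pos f, by rw [pow_orderOf_eq_one]; rfl⟩
  set n := Nat.find hex with hn
  have hna : 0 < n ∧ (f ^ n) a = a := Nat.find_spec hex
  have hmin : ∀ j < n, ¬ (0 < j ∧ (f ^ j) a = a) := fun j hj => Nat.find_min hex hj
  have key : ∀ j, j < n → ((f * swap a b) ^ (j + 1)) b = (f ^ (j + 1)) a := by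
    intro j
    induction j with
    | zero => intro _; simp
    | succ j ih =>
      intro hj
      rw [pow_succ', mul_apply, ih (by omega), mul_swap_apply_of_ne, pow_succ' f (j + 1), mul_apply]
      · exact fun h0 => hmin (j + 1) hj ⟨by omega, h0⟩
      · exact fun h0 => h ⟨(j + 1 : ℕ), by rw [zpow_natCast, h0]⟩
  refine SameCycle.symm ⟨n, ?_⟩
  have := key (n - 1) (by omega)
  rw [Nat.sub_add_cancel hna.1, hna.2] at this
  rw [zpow_natCast, this]

end Equiv.Perm

namespace PeriodicLink

variable {m : ℕ} (L : PeriodicLink m)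

theorem Crossing.crosses {L : PeriodicLink m} (c : L.Crossing) : L.Crosses c.upper c.lower :=
  Or.inl c.2

/-- Transversality leaves a single common point of the two projected edges, and each edge has a
single height over it. -/
theorem not_over_symm {i k : Fin L.size} (h : L.Over i k) : ¬ L.Over k i := by
  rintro ⟨w', a', b', hlt', hk', hi'⟩
  obtain ⟨w, a, b, hlt, hi, hk⟩ := h
  have hdet : L.planarDet i k ≠ 0 := L.regular.transverse i k ⟨w, a, b, hlt, hi, hk⟩
  have hp : ∀ (k : Fin L.size) (w : ℂ) (a : ℝ),
      (w, a) ∈ segment ℝ (L.pos k) (L.pos (L.next k)) → ∃ t : ℝ, L.pt k t = w := by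
    intro k w a h
    rw [segment_eq_image'] at h
    obtain ⟨t, -, ht⟩ := h
    refine ⟨t, ?_⟩
    have := congrArg Prod.fst ht
    simpa [pt, vert, PolygonalLink.dir] using this
  obtain ⟨s, hs⟩ := hp i w a hi
  obtain ⟨t, ht⟩ := hp k w b hk
  obtain ⟨s', hs'⟩ := hp i w' b' hi'
  obtain ⟨t', ht'⟩ := hp k w' a' hk'
  have e : ((s - s' : ℝ) : ℂ) * L.dir i = (t - t' : ℝ) * L.dir k := by
    have h1 : L.pt i s - L.pt i s' = L.pt k t - L.pt k t' := by rw [hs, ht, hs', ht']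
    simp only [pt] at h1
    push_cast
    linear_combination h1
  have h2 : (t - t') * L.planarDet i k = 0 := by
    have h3 := congrArg (fun z => ((starRingEnd ℂ) (L.dir i) * z).im) e
    simp only [PolygonalLink.planarDet, Complex.mul_im, Complex.mul_re, Complex.conj_re,
      Complex.conj_im, Complex.ofReal_re, Complex.ofReal_im] at h3 ⊢
    linarith
  have h4 : t = t' := by
    rcases mul_eq_zero.1 h2 with h | h
    · linarith
    · exact absurd h hdet
  obtain rfl : w = w' := by rw [← ht, ← ht', h4]
  have := L.pos_height_unique i hi hi'
  have := L.pos_height_unique k hk hk'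
  linarith

/-- By `simple` an edge determines the edge it crosses, and by `not_over_symm` it cannot be the
upper edge in one crossing and the lower edge in another. -/
theorem Crossing.eq_of_mem {L : PeriodicLink m} {c c' : L.Crossing} {i : Fin L.size}
    (h : c.upper = i ∨ c.lower = i) (h' : c'.upper = i ∨ c'.lower = i) : c = c' := by
  have low : ∀ {c c' : L.Crossing}, c.lower = c'.lower → c = c' := by
    intro c c' h
    apply Crossing.upper_injective
    have h1 := c.crosses.symm'
    rw [h] at h1
    exact L.regular.simple _ _ _ h1 c'.crosses.symm'
  have mix : ∀ {c c' : L.Crossing}, c.upper ≠ c'.lower := by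
    intro c c' h
    have h1 := c.crosses
    rw [h] at h1
    have h2 := L.regular.simple _ _ _ h1 c'.crosses.symm'
    have h3 : L.Over c.upper c.lower := c.2
    have h4 : L.Over c'.upper c'.lower := c'.2
    rw [h, h2] at h3
    exact L.not_over_symm h3 h4
  rcases h with h | h <;> rcases h' with h' | h' <;> rw [← h'] at h
  · exact Crossing.upper_injective h
  · exact absurd h mix
  · exact absurd h.symm mix
  · exact low h

open scoped Classical in
/-- The edge that crosses a given edge, or the edge itself if there is none. -/
noncomputable def opp (i : Fin L.size) : Fin L.size :=
  if h : ∃ j, L.Crosses i j then h.choose else i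

theorem opp_of_crosses {i j : Fin L.size} (h : L.Crosses i j) : L.opp i = j := by
  have hex : ∃ j, L.Crosses i j := ⟨j, h⟩
  rw [opp, dif_pos hex]
  exact L.regular.simple _ _ _ hex.choose_spec h

theorem opp_of_not_crosses {i : Fin L.size} (h : ∀ j, ¬ L.Crosses i j) : L.opp i = i := by
  rw [opp, dif_neg (by simpa using h)]

theorem opp_opp (i : Fin L.size) : L.opp (L.opp i) = i := by
  by_cases h : ∃ j, L.Crosses i j
  · obtain ⟨j, h⟩ := h
    rw [L.opp_of_crosses h, L.opp_of_crosses h.symm']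
  · push Not at h
    rw [L.opp_of_not_crosses h, L.opp_of_not_crosses h]

/-- The smoothing of the crossing on the `i`-th edge, if any, is compatible with the
orientation of the link. -/
def Oriented (S : Finset L.Crossing) (i : Fin L.size) : Prop :=
  ∀ c : L.Crossing, c.upper = i ∨ c.lower = i → (c.IsPositive ↔ c ∉ S)

theorem oriented_iff {S : Finset L.Crossing} {i : Fin L.size} {c : L.Crossing}
    (h : c.upper = i ∨ c.lower = i) : L.Oriented S i ↔ (c.IsPositive ↔ c ∉ S) := by
  refine ⟨fun h' => h' c h, fun h' c' hc' => ?_⟩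
  rwa [← Crossing.eq_of_mem h hc']

theorem exists_crossing {i j : Fin L.size} (h : L.Crosses i j) :
    ∃ c : L.Crossing, (c.upper = i ∧ c.lower = j) ∨ (c.upper = j ∧ c.lower = i) := by
  rcases h with h | h
  · exact ⟨⟨(i, j), h⟩, Or.inl ⟨rfl, rfl⟩⟩
  · exact ⟨⟨(j, i), h⟩, Or.inr ⟨rfl, rfl⟩⟩

theorem oriented_of_not_crosses (S : Finset L.Crossing) {i : Fin L.size}
    (h : ∀ j, ¬ L.Crosses i j) : L.Oriented S i := by
  rintro c (rfl | rfl)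
  · exact absurd c.crosses (h _)
  · exact absurd c.crosses.symm' (h _)

theorem oriented_opp (S : Finset L.Crossing) (i : Fin L.size) :
    L.Oriented S (L.opp i) ↔ L.Oriented S i := by
  by_cases h : ∃ j, L.Crosses i j
  · obtain ⟨j, h⟩ := h
    obtain ⟨c, hc⟩ := L.exists_crossing h
    rw [L.opp_of_crosses h, L.oriented_iff (c := c) (by tauto), L.oriented_iff (c := c) (by tauto)]
  · push Not at h
    rw [L.opp_of_not_crosses h]

/-- A half-edge `(i, b)` is the half of the `i`-th edge at its start (`b = false`) or at its
end (`b = true`).  This is its vertex. -/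
def halfVertex (h : Fin L.size × Bool) : Fin L.size := if h.2 then L.next h.1 else h.1

open scoped Classical in
/-- The half-edge to which a half-edge is connected in a smoothing. -/
noncomputable def mate (S : Finset L.Crossing) (h : Fin L.size × Bool) : Fin L.size × Bool :=
  (L.opp h.1, if L.Oriented S h.1 then !h.2 else h.2)

theorem mate_mate (S : Finset L.Crossing) (h : Fin L.size × Bool) :
    L.mate S (L.mate S h) = h := by
  obtain ⟨i, b⟩ := h
  by_cases h : L.Oriented S i <;> simp [mate, L.oriented_opp, L.opp_opp, h]

theorem circle_mate (S : Finset L.Crossing) (h : Fin L.size × Bool) :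
    L.circle S (L.halfVertex (L.mate S h)) = L.circle S (L.halfVertex h) := by
  obtain ⟨i, b⟩ := h
  by_cases hc : ∃ j, L.Crosses i j
  · obtain ⟨j, hc⟩ := hc
    obtain ⟨c, hcj⟩ := L.exists_crossing hc
    have hO := L.oriented_iff (S := S) (i := i) (c := c) (by tauto)
    unfold mate
    simp only [L.opp_of_crosses hc]
    by_cases ho : L.Oriented S i
    · rw [if_pos ho]
      have h1 := Joined.oriented₁ c (hO.1 ho)
      have h2 := Joined.oriented₂ c (hO.1 ho)
      rcases hcj with ⟨rfl, rfl⟩ | ⟨rfl, rfl⟩ <;> cases b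
      · exact (Quot.sound h1).symm
      · exact Quot.sound h2
      · exact (Quot.sound h2).symm
      · exact Quot.sound h1
    · rw [if_neg ho]
      have h1 := Joined.unoriented₁ c (fun h => ho (hO.2 h))
      have h2 := Joined.unoriented₂ c (fun h => ho (hO.2 h))
      rcases hcj with ⟨rfl, rfl⟩ | ⟨rfl, rfl⟩ <;> cases b
      · exact (Quot.sound h1).symm
      · exact (Quot.sound h2).symm
      · exact Quot.sound h1
      · exact Quot.sound h2
  · push Not at hc
    have h1 := Joined.edge (S := S) i hc
    unfold mate
    simp only [L.opp_of_not_crosses hc, if_pos (L.oriented_of_not_crosses S hc)]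
    cases b
    · exact (Quot.sound h1).symm
    · exact Quot.sound h1

theorem Joined.exists_half {L : PeriodicLink m} {S : Finset L.Crossing} {v w : Fin L.size}
    (h : L.Joined S v w) : ∃ a, L.halfVertex a = v ∧ L.halfVertex (L.mate S a) = w := by
  cases h with
  | edge i h =>
    refine ⟨(v, false), rfl, ?_⟩
    simp [mate, L.opp_of_not_crosses h, L.oriented_of_not_crosses S h, halfVertex]
  | oriented₁ c h =>
    refine ⟨(c.upper, false), rfl, ?_⟩
    simp [mate, L.opp_of_crosses c.crosses, (L.oriented_iff (c := c) (Or.inl rfl)).2 h, halfVertex]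
  | oriented₂ c h =>
    refine ⟨(c.lower, false), rfl, ?_⟩
    simp [mate, L.opp_of_crosses c.crosses.symm', (L.oriented_iff (c := c) (Or.inr rfl)).2 h,
      halfVertex]
  | unoriented₁ c h =>
    refine ⟨(c.upper, false), rfl, ?_⟩
    have := mt (L.oriented_iff (c := c) (Or.inl rfl)).1 h
    simp [mate, L.opp_of_crosses c.crosses, this, halfVertex]
  | unoriented₂ c h =>
    refine ⟨(c.upper, true), rfl, ?_⟩
    have := mt (L.oriented_iff (c := c) (Or.inl rfl)).1 h
    simp [mate, L.opp_of_crosses c.crosses, this, halfVertex]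

/-- Whether a half-edge leads away from its vertex, for a source-sink orientation. -/
def Outgoing (o : Fin L.size → Bool) (h : Fin L.size × Bool) : Bool :=
  if h.2 then !o (L.next h.1) else o h.1

/-- The half-edge leading away from a vertex. -/
def outHalf (o : Fin L.size → Bool) (v : Fin L.size) : Fin L.size × Bool :=
  if o v then (v, false) else (L.next.symm v, true)

theorem halfVertex_outHalf (o : Fin L.size → Bool) (v : Fin L.size) :
    L.halfVertex (L.outHalf o v) = v := by
  unfold outHalf halfVertex
  split_ifs <;> simp_all

theorem outgoing_outHalf (o : Fin L.size → Bool) (v : Fin L.size) :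
    L.Outgoing o (L.outHalf o v) = true := by
  unfold outHalf Outgoing
  split_ifs <;> simp_all

theorem outHalf_halfVertex {o : Fin L.size → Bool} {h : Fin L.size × Bool}
    (ho : L.Outgoing o h = true) : L.outHalf o (L.halfVertex h) = h := by
  obtain ⟨i, b⟩ := h
  cases b <;> simp_all [outHalf, Outgoing, halfVertex]

theorem outgoing_not (o : Fin L.size → Bool) (h : Fin L.size × Bool) :
    L.Outgoing (fun v => !o v) h = !L.Outgoing o h := by
  unfold Outgoing
  split_ifs <;> simp

/-- For a source-sink orientation the two halves of an edge with a crossing are both outgoing or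
both incoming, and those of the opposite edge are of the other kind. Either smoothing joins a half
of one edge to a half of the other, so all smoothings are oriented coherently at once. -/
theorem outgoing_mate {o : Fin L.size → Bool} (ho : L.IsAlternating o) (S : Finset L.Crossing)
    (h : Fin L.size × Bool) : L.Outgoing o (L.mate S h) = !L.Outgoing o h := by
  obtain ⟨i, b⟩ := h
  by_cases hc : ∃ j, L.Crosses i j
  · obtain ⟨j, hc⟩ := hc
    have h1 := ho.next_of_crosses i j hc
    have h2 := ho.next_of_crosses j i hc.symm'
    have h3 := ho.of_crosses i j hc
    simp only [mate, L.opp_of_crosses hc, Outgoing]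
    split_ifs <;> simp_all
  · push Not at hc
    have h1 := ho.next_of_not_crosses i hc
    simp only [mate, L.opp_of_not_crosses hc, Outgoing, if_pos (L.oriented_of_not_crosses S hc)]
    cases b <;> simp [h1]

/-- The step along the circles of a smoothing in the direction of a source-sink orientation. -/
noncomputable def step (S : Finset L.Crossing) (o : Fin L.size → Bool) (v : Fin L.size) :
    Fin L.size := L.halfVertex (L.mate S (L.outHalf o v))

/-- The arc ends in an incoming half-edge, which is outgoing for the reversed orientation; since
`mate` is an involution, the reversed step runs back along the same arc. -/
theorem step_not_step {o : Fin L.size → Bool} (ho : L.IsAlternating o) (S : Finset L.Crossing)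
    (v : Fin L.size) : L.step S (fun v => !o v) (L.step S o v) = v := by
  have h : L.Outgoing (fun v => !o v) (L.mate S (L.outHalf o v)) = true := by
    rw [L.outgoing_not, L.outgoing_mate ho, L.outgoing_outHalf]
    rfl
  unfold step
  rw [L.outHalf_halfVertex h, mate_mate, halfVertex_outHalf]

/-- The permutation of the vertices whose cycles are the circles of a smoothing. -/
noncomputable def circlePerm {o : Fin L.size → Bool} (ho : L.IsAlternating o)
    (S : Finset L.Crossing) : Equiv.Perm (Fin L.size) where
  toFun := L.step S o
  invFun := L.step S fun v => !o v
  left_inv := L.step_not_step ho S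
  right_inv v := by
    have := L.step_not_step ho.not S v
    simpa using this

theorem circlePerm_apply {o : Fin L.size → Bool} (ho : L.IsAlternating o)
    (S : Finset L.Crossing) (v : Fin L.size) :
    L.circlePerm ho S v = L.halfVertex (L.mate S (L.outHalf o v)) := rfl

/-- Exactly one half-edge of each elementary arc is outgoing, so the arc is one step of the
permutation from one of its ends to the other. -/
theorem circle_eq_iff_sameCycle {o : Fin L.size → Bool} (ho : L.IsAlternating o)
    (S : Finset L.Crossing) (v w : Fin L.size) :
    L.circle S v = L.circle S w ↔ (L.circlePerm ho S).SameCycle v w := by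
  constructor
  · intro h
    have h' := Quot.eqvGen_exact h
    clear h
    induction h' with
    | rel x y h =>
      obtain ⟨a, rfl, rfl⟩ := h.exists_half
      by_cases ha : L.Outgoing o a = true
      · refine ⟨1, ?_⟩
        rw [zpow_one, circlePerm_apply, L.outHalf_halfVertex ha]
      · refine Equiv.Perm.SameCycle.symm ⟨1, ?_⟩
        have hb : L.Outgoing o (L.mate S a) = true := by
          rw [L.outgoing_mate ho]
          simpa using ha
        rw [zpow_one, circlePerm_apply, L.outHalf_halfVertex hb, mate_mate]
    | refl x => exact Equiv.Perm.SameCycle.refl _ _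
    | symm x y _ ih => exact ih.symm
    | trans x y z _ _ ih1 ih2 => exact ih1.trans ih2
  · intro h
    obtain ⟨n, rfl⟩ := h.exists_nat_pow_eq
    clear h
    induction n with
    | zero => rfl
    | succ n ih =>
      rw [ih, pow_succ', Equiv.Perm.mul_apply, circlePerm_apply, circle_mate, halfVertex_outHalf]

/-- When `o c.upper` is true, both halves of the upper edge are outgoing, at the vertices `c.upper`
and `next c.upper`. Changing the smoothing exchanges their mates and affects no other outgoing
half-edge. -/
theorem circlePerm_insert {o : Fin L.size → Bool} (ho : L.IsAlternating o)
    {S : Finset L.Crossing} {c : L.Crossing} (hc : c ∉ S) (hoc : o c.upper = true) :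
    L.circlePerm ho (insert c S) =
      L.circlePerm ho S * Equiv.swap c.upper (L.next c.upper) := by
  classical
  have hO : L.Oriented (insert c S) c.upper ↔ ¬ L.Oriented S c.upper := by
    rw [L.oriented_iff (c := c) (Or.inl rfl), L.oriented_iff (c := c) (Or.inl rfl)]
    simp [hc]
  have hnext : o (L.next c.upper) = false := by rw [ho.next_of_crosses _ _ c.crosses, hoc]; rfl
  have e1 : L.outHalf o c.upper = (c.upper, false) := by simp [outHalf, hoc]
  have e2 : L.outHalf o (L.next c.upper) = (c.upper, true) := by simp [outHalf, hnext]
  have hm : ∀ b, L.mate (insert c S) (c.upper, b) = L.mate S (c.upper, !b) := by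
    intro b
    by_cases h : L.Oriented S c.upper
    · have h' : ¬ L.Oriented (insert c S) c.upper := by tauto
      simp [mate, h, h']
    · simp [mate, h, hO.2 h]
  refine Equiv.ext fun v => ?_
  by_cases h1 : v = c.upper
  · subst h1
    rw [Equiv.Perm.mul_swap_apply_left, circlePerm_apply, circlePerm_apply, e1, e2, hm]
    rfl
  by_cases h2 : v = L.next c.upper
  · subst h2
    rw [Equiv.Perm.mul_swap_apply_right, circlePerm_apply, circlePerm_apply, e1, e2, hm]
    rfl
  rw [Equiv.Perm.mul_swap_apply_of_ne _ h1 h2, circlePerm_apply, circlePerm_apply]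
  -- The outgoing half-edge at `v` is not at `c`: the halves of the upper edge sit at the two
  -- excluded vertices, and those of the lower edge are incoming.
  have hne : ∀ c' : L.Crossing, c'.upper = (L.outHalf o v).1 ∨ c'.lower = (L.outHalf o v).1 →
      c' ≠ c := by
    rintro c' h rfl
    have hv := L.halfVertex_outHalf o v
    have hout := L.outgoing_outHalf o v
    generalize L.outHalf o v = a at h hv hout
    obtain ⟨i, b⟩ := a
    rcases h with h | h <;> subst h <;> cases b
    · exact h1 hv.symm
    · exact h2 hv.symm
    · have := ho.of_crosses _ _ c'.crosses
      simp_all [Outgoing]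
    · have := ho.of_crosses _ _ c'.crosses
      have := ho.next_of_crosses _ _ c'.crosses.symm'
      simp_all [Outgoing]
  have hO' : L.Oriented (insert c S) (L.outHalf o v).1 ↔ L.Oriented S (L.outHalf o v).1 := by
    unfold Oriented
    refine forall_congr' fun c' => forall_congr' fun h => ?_
    simp [hne c' h]
  unfold mate
  simp only [hO']

/-- Changing the smoothing at a crossing either merges two circles or splits a circle. -/
theorem circle_insert_ne_iff {S : Finset L.Crossing} {c : L.Crossing} (hc : c ∉ S) :
    L.circle (insert c S) c.upper ≠ L.circle (insert c S) (L.next c.upper) ↔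
      L.circle S c.upper = L.circle S (L.next c.upper) := by
  classical
  have key : ∀ o, L.IsAlternating o → o c.upper = true →
      (L.circle (insert c S) c.upper ≠ L.circle (insert c S) (L.next c.upper) ↔
        L.circle S c.upper = L.circle S (L.next c.upper)) := by
    intro o ho hoc
    rw [Ne, L.circle_eq_iff_sameCycle ho, L.circle_eq_iff_sameCycle ho,
      L.circlePerm_insert ho hc hoc]
    refine ⟨fun h => ?_, fun h => Equiv.Perm.not_sameCycle_mul_swap _ (L.next_ne _).symm h⟩
    by_contra h'
    exact h (Equiv.Perm.sameCycle_mul_swap _ h')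
  -- If the upper edge of `c` is incoming, the reversed source-sink orientation is used.
  obtain ⟨o, ho⟩ := L.exists_isAlternating
  cases h : o c.upper
  · exact key _ ho.not (by simp [h])
  · exact key _ ho h

end PeriodicLink

/-! ## Change of one smoothing -/

namespace PeriodicLink

variable {m : ℕ} (L : PeriodicLink m)

/-- The circle through `v` passes through the crossing `c`. -/
def Meets (S : Finset L.Crossing) (c : L.Crossing) (v : Fin L.size) : Prop :=
  L.circle S v = L.circle S c.upper ∨ L.circle S v = L.circle S (L.next c.upper)

variable {L} in
theorem Meets.congr {S : Finset L.Crossing} {c : L.Crossing} {v w : Fin L.size}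
    (h : L.circle S v = L.circle S w) : L.Meets S c v ↔ L.Meets S c w := by
  unfold Meets
  rw [h]

/-- Each of the two arcs at `c` has an end on the upper edge, whichever smoothing is chosen. This is
why `Meets` need only mention the upper edge. -/
theorem meets_lower (S : Finset L.Crossing) (c : L.Crossing) :
    L.Meets S c c.lower ∧ L.Meets S c (L.next c.lower) := by
  by_cases h : c.IsPositive ↔ c ∉ S
  · exact ⟨Or.inr (Quot.sound (Joined.oriented₂ c h)),
      Or.inl (Quot.sound (Joined.oriented₁ c h)).symm⟩
  · exact ⟨Or.inl (Quot.sound (Joined.unoriented₁ c h)).symm,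
      Or.inr (Quot.sound (Joined.unoriented₂ c h)).symm⟩

/-- Arcs away from `c` are common to both smoothings, and the arcs at `c` join only vertices whose
circles pass through `c`. No inclusion between the states is assumed, so the same argument serves
for adding and for removing `c`. -/
theorem circle_eq_or_meets {S S' : Finset L.Crossing} {c : L.Crossing}
    (hS : ∀ c', c' ≠ c → (c' ∈ S' ↔ c' ∈ S)) {v w : Fin L.size}
    (h : L.circle S' v = L.circle S' w) :
    L.circle S v = L.circle S w ∨ (L.Meets S c v ∧ L.Meets S c w) := by
  have h' := Quot.eqvGen_exact h
  clear h
  have hm := L.meets_lower S c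
  induction h' with
  | rel x y h =>
    cases h with
    | edge i h => exact Or.inl (Quot.sound (Joined.edge x h))
    | oriented₁ c' h =>
      by_cases hc : c' = c
      · subst hc
        exact Or.inr ⟨Or.inl rfl, hm.2⟩
      · rw [hS c' hc] at h
        exact Or.inl (Quot.sound (Joined.oriented₁ c' h))
    | oriented₂ c' h =>
      by_cases hc : c' = c
      · subst hc
        exact Or.inr ⟨hm.1, Or.inr rfl⟩
      · rw [hS c' hc] at h
        exact Or.inl (Quot.sound (Joined.oriented₂ c' h))
    | unoriented₁ c' h =>
      by_cases hc : c' = c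
      · subst hc
        exact Or.inr ⟨Or.inl rfl, hm.1⟩
      · rw [hS c' hc] at h
        exact Or.inl (Quot.sound (Joined.unoriented₁ c' h))
    | unoriented₂ c' h =>
      by_cases hc : c' = c
      · subst hc
        exact Or.inr ⟨Or.inr rfl, hm.2⟩
      · rw [hS c' hc] at h
        exact Or.inl (Quot.sound (Joined.unoriented₂ c' h))
  | refl x => exact Or.inl rfl
  | symm x y _ ih => exact ih.imp Eq.symm And.symm
  | trans x y z _ _ ih1 ih2 =>
    rcases ih1 with h1 | h1
    · rcases ih2 with h2 | h2
      · exact Or.inl (h1.trans h2)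
      · exact Or.inr ⟨(Meets.congr h1).2 h2.1, h2.2⟩
    · rcases ih2 with h2 | h2
      · exact Or.inr ⟨h1.1, (Meets.congr h2).1 h1.2⟩
      · exact Or.inr ⟨h1.1, h2.2⟩

theorem circle_eq_or_meets_of_insert {S : Finset L.Crossing} {c : L.Crossing} {v w : Fin L.size}
    (h : L.circle (insert c S) v = L.circle (insert c S) w) :
    L.circle S v = L.circle S w ∨ (L.Meets S c v ∧ L.Meets S c w) :=
  L.circle_eq_or_meets (fun c' hc' => by simp [hc']) h

theorem circle_insert_eq_or_meets {S : Finset L.Crossing} {c : L.Crossing} {v w : Fin L.size}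
    (h : L.circle S v = L.circle S w) : L.circle (insert c S) v = L.circle (insert c S) w ∨
      (L.Meets (insert c S) c v ∧ L.Meets (insert c S) c w) :=
  L.circle_eq_or_meets (fun c' hc' => by simp [hc']) h

theorem meets_insert {S : Finset L.Crossing} {c : L.Crossing} {v : Fin L.size} :
    L.Meets (insert c S) c v ↔ L.Meets S c v := by
  constructor
  · rintro (h | h)
    · exact (L.circle_eq_or_meets_of_insert h).elim Or.inl And.left
    · exact (L.circle_eq_or_meets_of_insert h).elim Or.inr And.left
  · rintro (h | h)
    · exact (L.circle_insert_eq_or_meets h).elim Or.inl And.left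
    · exact (L.circle_insert_eq_or_meets h).elim Or.inr And.left

theorem circle_insert_iff {S : Finset L.Crossing} {c : L.Crossing} {v w : Fin L.size}
    (hv : ¬ L.Meets S c v) :
    L.circle (insert c S) v = L.circle (insert c S) w ↔ L.circle S v = L.circle S w := by
  constructor
  · exact fun h => (L.circle_eq_or_meets_of_insert h).elim id fun h => absurd h.1 hv
  · exact fun h => (L.circle_insert_eq_or_meets h).elim id
      fun h => absurd (L.meets_insert.1 h.1) hv

/-- The circles that avoid `c` are the same before and after the change; the bijection is realised
by choosing a vertex on each circle. -/
theorem sum_circles_not_meets (S : Finset L.Crossing) (c : L.Crossing)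
    (f : L.Circles S → ℤ) (f' : L.Circles (insert c S) → ℤ)
    (h : ∀ v, ¬ L.Meets S c v → f' (L.circle _ v) = f (L.circle _ v)) :
    (∑ᶠ x ∈ {x | ∀ v, x = L.circle S v → ¬ L.Meets S c v}, f x) =
      ∑ᶠ x ∈ {x | ∀ v, x = L.circle (insert c S) v → ¬ L.Meets S c v}, f' x := by
  refine finsum_mem_eq_of_bijOn (fun x => L.circle (insert c S) (Quot.out x)) ⟨?_, ?_, ?_⟩ ?_
  · intro x hx v hv hm
    have h1 := hx _ (Quot.out_eq x).symm
    rw [L.circle_insert_iff h1] at hv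
    exact h1 ((Meets.congr hv).2 hm)
  · intro x hx y hy hxy
    have h1 := hx _ (Quot.out_eq x).symm
    have := (L.circle_insert_iff h1).1 hxy
    exact (Quot.out_eq x).symm.trans (this.trans (Quot.out_eq y))
  · intro y hy
    obtain ⟨w, rfl⟩ := Quot.exists_rep y
    have hw : ¬ L.Meets S c w := hy w rfl
    refine ⟨L.circle S w, fun v hv => by rwa [← Meets.congr hv], ?_⟩
    have : L.circle S (Quot.out (L.circle S w)) = L.circle S w := Quot.out_eq _
    exact (L.circle_insert_iff (by rwa [Meets.congr this])).2 this
  · intro x hx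
    have h1 := hx _ (Quot.out_eq x).symm
    exact (congrArg f (Quot.out_eq x).symm).trans (h _ h1).symm

open scoped Classical in
-- The circles that pass through `c` are those of the two ends of its upper edge, and these may
-- coincide. The set summed over first is described by `S` even when `T` is `insert c S`, so that
-- the sums before and after the change can be compared.
theorem sum_circles_eq (S : Finset L.Crossing) (c : L.Crossing) (T : Finset L.Crossing)
    (hT : ∀ v, L.Meets T c v ↔ L.Meets S c v) (f : L.Circles T → ℤ) :
    ∑ x, f x = (∑ᶠ x ∈ {x | ∀ v, x = L.circle T v → ¬ L.Meets S c v}, f x) +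
      (f (L.circle T c.upper) + if L.circle T c.upper = L.circle T (L.next c.upper) then 0
        else f (L.circle T (L.next c.upper))) := by
  classical
  set A : Set (L.Circles T) := {x | ∀ v, x = L.circle T v → ¬ L.Meets S c v} with hA
  have hAc : Aᶜ = {L.circle T c.upper, L.circle T (L.next c.upper)} := by
    ext x
    obtain ⟨w, rfl⟩ := Quot.exists_rep x
    change ¬ (∀ v, L.circle T w = L.circle T v → ¬ L.Meets S c v) ↔ L.Meets T c w
    constructor
    · intro h
      push Not at h
      obtain ⟨v, hv, h⟩ := h
      exact (Meets.congr hv).2 ((hT v).2 h)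
    · exact fun h h' => h' w rfl ((hT w).1 h)
  have h1 : ∑ x, f x = ∑ᶠ x ∈ A ∪ Aᶜ, f x := by
    rw [Set.union_compl_self, finsum_mem_univ, finsum_eq_sum_of_fintype]
  rw [h1, finsum_mem_union disjoint_compl_right (Set.toFinite _) (Set.toFinite _), hAc]
  congr 1
  split_ifs with h
  · rw [h, Set.pair_eq_singleton, finsum_mem_singleton, add_zero]
  · rw [finsum_mem_pair h]

/-- Comparison of sums over the circles when two circles are merged. -/
theorem sum_circles_merge {S : Finset L.Crossing} {c : L.Crossing} (hc : c ∉ S)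
    (hm : L.circle S c.upper ≠ L.circle S (L.next c.upper))
    (f : L.Circles S → ℤ) (f' : L.Circles (insert c S) → ℤ)
    (h : ∀ v, ¬ L.Meets S c v → f' (L.circle _ v) = f (L.circle _ v)) :
    ∑ x, f x + f' (L.circle _ c.upper) =
      ∑ x, f' x + (f (L.circle _ c.upper) + f (L.circle _ (L.next c.upper))) := by
  have hm' : L.circle (insert c S) c.upper = L.circle (insert c S) (L.next c.upper) := by
    by_contra h'
    exact hm ((L.circle_insert_ne_iff hc).1 h')
  rw [L.sum_circles_eq S c S (fun _ => Iff.rfl), L.sum_circles_eq S c _ (fun _ => L.meets_insert),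
    L.sum_circles_not_meets S c f f' h, if_neg hm, if_pos hm']
  ring

/-- Comparison of sums over the circles when a circle is split. -/
theorem sum_circles_split {S : Finset L.Crossing} {c : L.Crossing} (hc : c ∉ S)
    (hm : L.circle S c.upper = L.circle S (L.next c.upper))
    (f : L.Circles S → ℤ) (f' : L.Circles (insert c S) → ℤ)
    (h : ∀ v, ¬ L.Meets S c v → f' (L.circle _ v) = f (L.circle _ v)) :
    ∑ x, f x + (f' (L.circle _ c.upper) + f' (L.circle _ (L.next c.upper))) =
      ∑ x, f' x + f (L.circle _ c.upper) := by
  have hm' := (L.circle_insert_ne_iff hc).2 hm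
  rw [L.sum_circles_eq S c S (fun _ => Iff.rfl), L.sum_circles_eq S c _ (fun _ => L.meets_insert),
    L.sum_circles_not_meets S c f f' h, if_pos hm, if_neg hm']
  ring

theorem card_circles_merge {S : Finset L.Crossing} {c : L.Crossing} (hc : c ∉ S)
    (hm : L.circle S c.upper ≠ L.circle S (L.next c.upper)) :
    (Fintype.card (L.Circles S) : ℤ) = Fintype.card (L.Circles (insert c S)) + 1 := by
  have := L.sum_circles_merge hc hm (fun _ => 1) (fun _ => 1) (fun _ _ => rfl)
  simp only [Finset.sum_const, Finset.card_univ, nsmul_eq_mul, mul_one] at this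
  linarith

theorem card_circles_split {S : Finset L.Crossing} {c : L.Crossing} (hc : c ∉ S)
    (hm : L.circle S c.upper = L.circle S (L.next c.upper)) :
    (Fintype.card (L.Circles (insert c S)) : ℤ) = Fintype.card (L.Circles S) + 1 := by
  have := L.sum_circles_split hc hm (fun _ => 1) (fun _ => 1) (fun _ _ => rfl)
  simp only [Finset.sum_const, Finset.card_univ, nsmul_eq_mul, mul_one] at this
  linarith

/-! ### Degrees -/

theorem edgeCoeff_ne_zero {c : L.Crossing} {E E' : L.EnhancedState}
    (h : L.edgeCoeff c E E' ≠ 0) : c ∉ E.state ∧ E'.state = insert c E.state := by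
  by_contra h'
  exact h (by unfold edgeCoeff; exact if_neg h')

theorem hDegree_of_edgeCoeff_ne_zero {c : L.Crossing} {E E' : L.EnhancedState}
    (h : L.edgeCoeff c E E' ≠ 0) : E'.hDegree = E.hDegree + 1 := by
  obtain ⟨hc, hS⟩ := L.edgeCoeff_ne_zero h
  unfold EnhancedState.hDegree
  rw [hS, Finset.card_insert_of_notMem hc]
  push_cast
  ring

/-- Multiplication and comultiplication both lower the sum of the labels, counted as `1` for the
unit and `-1` for `X`, by one; this compensates the additional 1-smoothed crossing. The circles away
from `c` keep their labels. -/
theorem qDegree_of_edgeCoeff_ne_zero {c : L.Crossing} {E E' : L.EnhancedState}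
    (h : L.edgeCoeff c E E' ≠ 0) : E'.qDegree = E.qDegree := by
  obtain ⟨hc, hS⟩ := L.edgeCoeff_ne_zero h
  obtain ⟨⟨T, l'⟩, hl'⟩ := E'
  obtain rfl : T = insert c E.state := hS
  set E' : L.EnhancedState := ⟨(insert c E.state, l'), hl'⟩ with hE'
  unfold edgeCoeff at h
  rw [if_pos ⟨hc, rfl⟩] at h
  unfold saddleCoeff at h
  have hagree : L.AgreeOff E E' c.upper (L.next c.upper) := by
    by_contra h'
    exact h (if_neg h')
  rw [if_pos hagree] at h
  have hag : ∀ v, ¬ L.Meets E.state c v →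
      (if E'.circleLabel (L.circle _ v) then (1 : ℤ) else -1) =
        if E.circleLabel (L.circle _ v) then 1 else -1 := by
    intro v hv
    have : E'.label v = E.label v := hagree v (fun h => hv (Or.inl h)) (fun h => hv (Or.inr h))
    change (if E'.label v then (1 : ℤ) else -1) = if E.label v then 1 else -1
    rw [this]
  have hcard : (E'.state.card : ℤ) = E.state.card + 1 := by
    change ((insert c E.state).card : ℤ) = _
    rw [Finset.card_insert_of_notMem hc]
    push_cast
    rfl
  unfold EnhancedState.qDegree
  rw [hcard]
  by_cases hm : L.circle E.state c.upper = L.circle E.state (L.next c.upper)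
  · have hm' := (L.circle_insert_ne_iff hc).2 hm
    rw [if_neg (fun h => h.1 hm), if_pos ⟨hm, hm'⟩] at h
    have key := L.sum_circles_split hc hm
      (fun x => if E.circleLabel x then (1 : ℤ) else -1)
      (fun x => if E'.circleLabel x then (1 : ℤ) else -1) hag
    change _ + ((if E'.label c.upper then (1 : ℤ) else -1) +
      (if E'.label (L.next c.upper) then (1 : ℤ) else -1)) =
      (∑ x : L.Circles E'.state, _) + (if E.label c.upper then (1 : ℤ) else -1) at key
    have h3 : (if E'.label c.upper then (1 : ℤ) else -1) +
        (if E'.label (L.next c.upper) then (1 : ℤ) else -1) + 1 =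
        (if E.label c.upper then (1 : ℤ) else -1) := by
      revert h
      generalize E.label c.upper = a
      generalize E'.label c.upper = b
      generalize E'.label (L.next c.upper) = d
      revert a b d
      decide
    linarith
  · have hm' : L.circle (insert c E.state) c.upper = L.circle (insert c E.state) (L.next c.upper) := by
      by_contra h'
      exact hm ((L.circle_insert_ne_iff hc).1 h')
    rw [if_pos ⟨hm, hm'⟩] at h
    have key := L.sum_circles_merge hc hm
      (fun x => if E.circleLabel x then (1 : ℤ) else -1)
      (fun x => if E'.circleLabel x then (1 : ℤ) else -1) hag
    change _ + (if E'.label c.upper then (1 : ℤ) else -1) =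
      (∑ x : L.Circles E'.state, _) + ((if E.label c.upper then (1 : ℤ) else -1) +
      (if E.label (L.next c.upper) then (1 : ℤ) else -1)) at key
    have h3 : (if E.label c.upper then (1 : ℤ) else -1) +
        (if E.label (L.next c.upper) then (1 : ℤ) else -1) =
        (if E'.label c.upper then (1 : ℤ) else -1) + 1 := by
      revert h
      generalize E'.label c.upper = a
      generalize E.label c.upper = b
      generalize E.label (L.next c.upper) = d
      revert a b d
      decide
    linarith

theorem khDiff_mem (F : Type) [Field F] {i k : ℤ} {f : L.Chain F} (hf : f ∈ L.khGraded F i k) :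
    L.khDiff F f ∈ L.khGraded F (i + 1) k := by
  intro E' hE'
  simp only [khDiff, Matrix.mulVecLin_apply, Matrix.mulVec, dotProduct, Matrix.of_apply] at hE'
  obtain ⟨E, -, hE⟩ := Finset.exists_ne_zero_of_sum_ne_zero hE'
  obtain ⟨h1, h2⟩ := hf E (right_ne_zero_of_mul hE)
  have h3 : L.diffCoeff E E' ≠ 0 := by
    intro h0
    apply left_ne_zero_of_mul hE
    rw [h0, Int.cast_zero]
  obtain ⟨c, -, hc⟩ := Finset.exists_ne_zero_of_sum_ne_zero h3
  have h4 := right_ne_zero_of_mul hc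
  rw [L.hDegree_of_edgeCoeff_ne_zero h4, L.qDegree_of_edgeCoeff_ne_zero h4, h1, h2]
  exact ⟨rfl, rfl⟩

/-! ### Invariance of the bidegree under the rotation. -/

theorem hDegree_rotEnhanced (E : L.EnhancedState) : (L.rotEnhanced E).hDegree = E.hDegree := by
  unfold EnhancedState.hDegree
  rw [rotEnhanced_state, rotState, Finset.card_map]

theorem qDegree_rotEnhanced (E : L.EnhancedState) : (L.rotEnhanced E).qDegree = E.qDegree := by
  unfold EnhancedState.qDegree
  have h1 : (L.rotEnhanced E).state.card = E.state.card := by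
    rw [rotEnhanced_state, rotState, Finset.card_map]
  have h2 : ∑ x, (if E.circleLabel x then (1 : ℤ) else -1) =
      ∑ x, if (L.rotEnhanced E).circleLabel x then (1 : ℤ) else -1 := by
    let g : L.Circles E.state → L.Circles (L.rotEnhanced E).state :=
      Quot.lift (fun v => L.circle _ (L.rotVertex v))
        (fun v w h => L.circle_rot_eq _ _ _ (Quot.sound h))
    refine Fintype.sum_bijective g ⟨?_, ?_⟩ _ _ ?_
    · intro x y
      obtain ⟨v, rfl⟩ := Quot.exists_rep x
      obtain ⟨w, rfl⟩ := Quot.exists_rep y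
      exact fun h => (L.circle_rotEnhanced_iff E v w).1 h
    · intro y
      obtain ⟨w, rfl⟩ := Quot.exists_rep y
      obtain ⟨v, rfl⟩ := L.rotVertex.surjective w
      exact ⟨L.circle _ v, rfl⟩
    · intro x
      obtain ⟨v, rfl⟩ := Quot.exists_rep x
      change (if E.label v then (1 : ℤ) else -1) =
        if (L.rotEnhanced E).label (L.rotVertex v) then 1 else -1
      rw [rotEnhanced_label]
  rw [h1, h2]

theorem khRot_mem (F : Type) [Field F] {i k : ℤ} {f : L.Chain F} (hf : f ∈ L.khGraded F i k) :
    L.khRot F f ∈ L.khGraded F i k := by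
  intro E' hE'
  obtain ⟨E, rfl⟩ := L.rotEnhanced.surjective E'
  rw [khRot_apply] at hE'
  rw [hDegree_rotEnhanced, qDegree_rotEnhanced]
  exact hf E (right_ne_zero_of_mul hE')

end PeriodicLink

/-! ## The square of the differential -/

namespace PeriodicLink

variable {m : ℕ} (L : PeriodicLink m)

namespace EnhancedState

variable {L}

open scoped Classical in
/-- The enhanced state with the label of the circle through `v` replaced. -/
noncomputable def setLabel (E : L.EnhancedState) (v : Fin L.size) (b : Bool) : L.EnhancedState :=
  ⟨(E.state, fun w => if L.circle E.state w = L.circle E.state v then b else E.label w), by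
    intro x y h
    have h' : L.circle E.state x = L.circle E.state y := Quot.sound h
    simp only [h', E.label_eq h']⟩

theorem setLabel_state (E : L.EnhancedState) (v : Fin L.size) (b : Bool) :
    (E.setLabel v b).state = E.state := rfl

open scoped Classical in
theorem setLabel_label (E : L.EnhancedState) (v : Fin L.size) (b : Bool) (w : Fin L.size) :
    (E.setLabel v b).label w =
      if L.circle E.state w = L.circle E.state v then b else E.label w := rfl

theorem setLabel_label_of_eq (E : L.EnhancedState) {v w : Fin L.size} (b : Bool)
    (h : L.circle E.state w = L.circle E.state v) : (E.setLabel v b).label w = b := by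
  rw [setLabel_label, if_pos h]

theorem setLabel_label_of_ne (E : L.EnhancedState) {v w : Fin L.size} (b : Bool)
    (h : L.circle E.state w ≠ L.circle E.state v) : (E.setLabel v b).label w = E.label w := by
  rw [setLabel_label, if_neg h]

theorem setLabel_congr (E : L.EnhancedState) {v w : Fin L.size} (b : Bool)
    (h : L.circle E.state v = L.circle E.state w) : E.setLabel v b = E.setLabel w b := by
  refine EnhancedState.ext rfl fun x => ?_
  rw [setLabel_label, setLabel_label, h]

theorem ext_iff_of_state {E E' : L.EnhancedState} (h : E.state = E'.state) :
    E = E' ↔ ∀ v, E.label v = E'.label v :=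
  ⟨fun h v => by rw [h], fun h' => EnhancedState.ext h h'⟩

/-- A basis element multiplied by the variable of a circle. -/
theorem setLabel_eq_iff (E E' : L.EnhancedState) (v : Fin L.size) (b : Bool) :
    (E.label v = b ∧ E.setLabel v (!b) = E') ↔ (E'.label v = !b ∧ E = E'.setLabel v b) := by
  constructor
  · rintro ⟨h, rfl⟩
    refine ⟨E.setLabel_label_of_eq _ rfl, EnhancedState.ext rfl fun w => ?_⟩
    rw [setLabel_label, setLabel_state]
    split_ifs with h'
    · rw [E.label_eq h', h]
    · rw [setLabel_label_of_ne _ _ h']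
  · rintro ⟨h, rfl⟩
    refine ⟨E'.setLabel_label_of_eq _ rfl, EnhancedState.ext rfl fun w => ?_⟩
    rw [setLabel_label, setLabel_state]
    split_ifs with h'
    · rw [E'.label_eq h', h]
    · rw [setLabel_label_of_ne _ _ h']

end EnhancedState

/-! ### The variables of the circles and linearity of the edge maps. -/

variable (F : Type) [Field F]

open scoped Classical in
/-- The basis element of the Khovanov complex given by an enhanced state. -/
noncomputable def basisChain (E : L.EnhancedState) : L.Chain F := Pi.single E 1

/-- The action of the variable of the circle through `v`. -/
noncomputable def mulVar (v : Fin L.size) : Module.End F (L.Chain F) where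
  toFun f E := if E.label v then 0 else f (E.setLabel v true)
  map_add' f g := by ext E; by_cases h : E.label v <;> simp [h]
  map_smul' a f := by ext E; by_cases h : E.label v <;> simp [h]

theorem mulVar_apply (v : Fin L.size) (f : L.Chain F) (E : L.EnhancedState) :
    L.mulVar F v f E = if E.label v then 0 else f (E.setLabel v true) := rfl

theorem mulVar_basisChain_of_true {v : Fin L.size} {E : L.EnhancedState} (h : E.label v = true) :
    L.mulVar F v (L.basisChain F E) = L.basisChain F (E.setLabel v false) := by
  classical
  funext E'
  have key := EnhancedState.setLabel_eq_iff E' E v false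
  simp only [Bool.not_false, h, true_and] at key
  rw [mulVar_apply, basisChain, basisChain, Pi.single_apply, Pi.single_apply]
  by_cases h1 : E'.label v = true
  · rw [if_pos h1, if_neg fun h2 => by simp [key.2 h2] at h1]
  · rw [if_neg h1]
    refine if_congr ?_ rfl rfl
    rw [← key]
    simp [h1]

theorem mulVar_basisChain_of_false {v : Fin L.size} {E : L.EnhancedState} (h : E.label v = false) :
    L.mulVar F v (L.basisChain F E) = 0 := by
  classical
  funext E'
  rw [mulVar_apply, basisChain, Pi.single_apply, Pi.zero_apply]
  split_ifs with h1 h2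
  · rfl
  · rw [← h2, E'.setLabel_label_of_eq _ rfl] at h
    cases h
  · rfl

theorem mulVar_comm (v w : Fin L.size) (f : L.Chain F) :
    L.mulVar F v (L.mulVar F w f) = L.mulVar F w (L.mulVar F v f) := by
  funext E
  simp only [mulVar_apply]
  by_cases h : L.circle E.state v = L.circle E.state w
  · rw [E.setLabel_label_of_eq true h.symm, E.setLabel_label_of_eq true h]
    simp
  · rw [E.setLabel_label_of_ne true h, E.setLabel_label_of_ne true (Ne.symm h)]
    have : (E.setLabel v true).setLabel w true = (E.setLabel w true).setLabel v true := by
      refine EnhancedState.ext rfl fun x => ?_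
      by_cases hw : L.circle E.state x = L.circle E.state w
      · rw [(E.setLabel v true).setLabel_label_of_eq true hw]
        by_cases hv : L.circle E.state x = L.circle E.state v
        · rw [(E.setLabel w true).setLabel_label_of_eq true hv]
        · rw [(E.setLabel w true).setLabel_label_of_ne true hv, E.setLabel_label_of_eq true hw]
      · rw [(E.setLabel v true).setLabel_label_of_ne true hw]
        by_cases hv : L.circle E.state x = L.circle E.state v
        · rw [(E.setLabel w true).setLabel_label_of_eq true hv, E.setLabel_label_of_eq true hv]
        · rw [(E.setLabel w true).setLabel_label_of_ne true hv, E.setLabel_label_of_ne true hw,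
            E.setLabel_label_of_ne true hv]
    rw [this]
    split_ifs <;> rfl

/-- The edge map of the cube of resolutions. -/
noncomputable def edgeMap (c : L.Crossing) : Module.End F (L.Chain F) :=
  Matrix.mulVecLin (Matrix.of fun E' E => (L.edgeCoeff c E E' : F))

theorem edgeMap_apply (c : L.Crossing) (f : L.Chain F) (E' : L.EnhancedState) :
    L.edgeMap F c f E' = ∑ E, (L.edgeCoeff c E E' : F) * f E := rfl

theorem edgeMap_basisChain (c : L.Crossing) (E E' : L.EnhancedState) :
    L.edgeMap F c (L.basisChain F E) E' = (L.edgeCoeff c E E' : F) := by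
  classical
  rw [edgeMap_apply]
  simp [basisChain, Pi.single_apply]

theorem agreeOff_iff (E E' : L.EnhancedState) (c : L.Crossing) :
    L.AgreeOff E E' c.upper (L.next c.upper) ↔
      ∀ v, ¬ L.Meets E.state c v → E'.label v = E.label v := by
  unfold AgreeOff Meets
  refine forall_congr' fun v => ?_
  tauto

/-- The type of circles depends on the state, so the equal states have to be identified before the
conditions on circles can be compared. -/
theorem saddleCoeff_congr {E₁ E₂ E₁' E₂' : L.EnhancedState} {u u' : Fin L.size}
    (hS : E₁.state = E₂.state) (hS' : E₁'.state = E₂'.state)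
    (ha : L.AgreeOff E₁ E₁' u u' ↔ L.AgreeOff E₂ E₂' u u')
    (h1 : E₁.label u = E₂.label u) (h2 : E₁.label u' = E₂.label u')
    (h3 : E₁'.label u = E₂'.label u) (h4 : E₁'.label u' = E₂'.label u') :
    L.saddleCoeff E₁ E₁' u u' = L.saddleCoeff E₂ E₂' u u' := by
  obtain ⟨⟨S₁, l₁⟩, _⟩ := E₁
  obtain ⟨⟨S₂, l₂⟩, _⟩ := E₂
  obtain ⟨⟨S₁', l₁'⟩, _⟩ := E₁'
  obtain ⟨⟨S₂', l₂'⟩, _⟩ := E₂'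
  obtain rfl : S₁ = S₂ := hS
  obtain rfl : S₁' = S₂' := hS'
  classical
  unfold saddleCoeff
  rw [h1, h2, h3, h4]
  exact if_congr ha rfl rfl

theorem saddleCoeff_of_not_agreeOff {E E' : L.EnhancedState} {u u' : Fin L.size}
    (h : ¬ L.AgreeOff E E' u u') : L.saddleCoeff E E' u u' = 0 := by
  unfold saddleCoeff; exact if_neg h

theorem saddleCoeff_merge {E E' : L.EnhancedState} {u u' : Fin L.size}
    (h : L.AgreeOff E E' u u') (hm : L.circle E.state u ≠ L.circle E.state u')
    (hm' : L.circle E'.state u = L.circle E'.state u') :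
    L.saddleCoeff E E' u u' = mulCoeff (E.label u) (E.label u') (E'.label u) := by
  unfold saddleCoeff; rw [if_pos h, if_pos ⟨hm, hm'⟩]

theorem saddleCoeff_split {E E' : L.EnhancedState} {u u' : Fin L.size}
    (h : L.AgreeOff E E' u u') (hm : L.circle E.state u = L.circle E.state u')
    (hm' : L.circle E'.state u ≠ L.circle E'.state u') :
    L.saddleCoeff E E' u u' = comulCoeff (E.label u) (E'.label u) (E'.label u') := by
  unfold saddleCoeff; rw [if_pos h, if_neg (fun h => h.1 hm), if_pos ⟨hm, hm'⟩]

theorem edgeCoeff_of_state {c : L.Crossing} {E E' : L.EnhancedState}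
    (h : c ∉ E.state) (h' : E'.state = insert c E.state) :
    L.edgeCoeff c E E' = L.saddleCoeff E E' c.upper (L.next c.upper) := by
  unfold edgeCoeff; exact if_pos ⟨h, h'⟩

/-- This is the matrix form of the fact that an edge map commutes with multiplication by the
variable of the circle through `v`. If that circle passes through `c`, it expresses that the product
and the coproduct of `F[X]/(X²)` are linear in each circle involved, which is checked on all labels.
Otherwise the circle and its label pass through the saddle unchanged. -/
theorem edgeCoeff_setLabel (c : L.Crossing) (E E' : L.EnhancedState) (v : Fin L.size) :
    (if E.label v then L.edgeCoeff c (E.setLabel v false) E' else 0) =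
      if E'.label v then 0 else L.edgeCoeff c E (E'.setLabel v true) := by
  by_cases hst : c ∉ E.state ∧ E'.state = insert c E.state
  swap
  · have e1 : L.edgeCoeff c (E.setLabel v false) E' = 0 := by
      unfold edgeCoeff; exact if_neg hst
    have e2 : L.edgeCoeff c E (E'.setLabel v true) = 0 := by
      unfold edgeCoeff; exact if_neg hst
    rw [e1, e2, ite_self, ite_self]
  have e1 : L.edgeCoeff c (E.setLabel v false) E' =
      L.saddleCoeff (E.setLabel v false) E' c.upper (L.next c.upper) := by
    unfold edgeCoeff; exact if_pos hst
  have e2 : L.edgeCoeff c E (E'.setLabel v true) =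
      L.saddleCoeff E (E'.setLabel v true) c.upper (L.next c.upper) := by
    unfold edgeCoeff; exact if_pos hst
  rw [e1, e2]
  obtain ⟨hc, hS⟩ := hst
  clear e1 e2
  by_cases hv : L.Meets E.state c v
  · -- the circle through `v` takes part in the saddle
    have hv' : L.Meets E'.state c v := by rw [hS]; exact L.meets_insert.2 hv
    have hne : ∀ {w}, ¬ L.Meets E.state c w → L.circle E.state w ≠ L.circle E.state v :=
      fun h h' => h ((Meets.congr h').2 hv)
    have hne' : ∀ {w}, ¬ L.Meets E.state c w → L.circle E'.state w ≠ L.circle E'.state v :=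
      fun h h' => h (by
        have := (Meets.congr h').2 hv'
        rw [hS] at this
        exact L.meets_insert.1 this)
    have ha : L.AgreeOff (E.setLabel v false) E' c.upper (L.next c.upper) ↔
        L.AgreeOff E E' c.upper (L.next c.upper) := by
      rw [agreeOff_iff, agreeOff_iff]
      refine forall_congr' fun w => forall_congr' fun hw => ?_
      rw [E.setLabel_label_of_ne _ (hne hw)]
    have ha' : L.AgreeOff E (E'.setLabel v true) c.upper (L.next c.upper) ↔
        L.AgreeOff E E' c.upper (L.next c.upper) := by
      rw [agreeOff_iff, agreeOff_iff]
      refine forall_congr' fun w => forall_congr' fun hw => ?_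
      rw [E'.setLabel_label_of_ne _ (hne' hw)]
    by_cases hA : L.AgreeOff E E' c.upper (L.next c.upper)
    swap
    · rw [L.saddleCoeff_of_not_agreeOff (mt ha.1 hA), L.saddleCoeff_of_not_agreeOff (mt ha'.1 hA),
        ite_self, ite_self]
    by_cases hm : L.circle E.state c.upper = L.circle E.state (L.next c.upper)
    swap
    · have hm' : L.circle E'.state c.upper = L.circle E'.state (L.next c.upper) := by
        rw [hS]
        by_contra h'
        exact hm ((L.circle_insert_ne_iff hc).1 h')
      rw [L.saddleCoeff_merge (ha.2 hA) hm hm', L.saddleCoeff_merge (ha'.2 hA) hm hm']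
      have hvv : L.circle E'.state c.upper = L.circle E'.state v := by
        rcases hv' with h | h
        · exact h.symm
        · rw [h, hm']
      rw [E'.setLabel_label_of_eq _ hvv, ← E'.label_eq hvv]
      rcases hv with h | h
      · rw [E.setLabel_label_of_eq _ h.symm, E.setLabel_label_of_ne _ (by rw [h]; exact Ne.symm hm),
          E.label_eq h]
        generalize E.label c.upper = a
        generalize E.label (L.next c.upper) = b
        generalize E'.label c.upper = d
        revert a b d
        decide
      · rw [E.setLabel_label_of_eq _ h.symm, E.setLabel_label_of_ne _ (by rw [h]; exact hm),
          E.label_eq h]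
        generalize E.label c.upper = a
        generalize E.label (L.next c.upper) = b
        generalize E'.label c.upper = d
        revert a b d
        decide
    · have hm' : L.circle E'.state c.upper ≠ L.circle E'.state (L.next c.upper) := by
        rw [hS]
        exact (L.circle_insert_ne_iff hc).2 hm
      rw [L.saddleCoeff_split (ha.2 hA) hm hm', L.saddleCoeff_split (ha'.2 hA) hm hm']
      have hvv : L.circle E.state c.upper = L.circle E.state v := by
        rcases hv with h | h
        · exact h.symm
        · rw [h, hm]
      rw [E.setLabel_label_of_eq _ hvv, ← E.label_eq hvv]
      rcases hv' with h | h
      · rw [E'.setLabel_label_of_eq _ h.symm, E'.setLabel_label_of_ne _ (by rw [h]; exact hm'.symm),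
          E'.label_eq h]
        generalize E.label c.upper = a
        generalize E'.label (L.next c.upper) = b
        generalize E'.label c.upper = d
        revert a b d
        decide
      · rw [E'.setLabel_label_of_eq _ h.symm, E'.setLabel_label_of_ne _ (by rw [h]; exact hm'),
          E'.label_eq h]
        generalize E.label c.upper = a
        generalize E'.label (L.next c.upper) = b
        generalize E'.label c.upper = d
        revert a b d
        decide
  · -- the circle through `v` does not take part in the saddle
    have hcirc : ∀ w, L.circle E'.state w = L.circle E'.state v ↔
        L.circle E.state w = L.circle E.state v := by
      intro w
      rw [hS, eq_comm, L.circle_insert_iff hv, eq_comm]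
    have hu : L.circle E.state c.upper ≠ L.circle E.state v := fun h => hv (Or.inl h.symm)
    have hu' : L.circle E.state (L.next c.upper) ≠ L.circle E.state v :=
      fun h => hv (Or.inr h.symm)
    -- A saddle away from the circle of `v` preserves the label at `v`, so a coefficient between
    -- different labels vanishes.
    have hzero : ∀ E₁ E₁' : L.EnhancedState, E₁.state = E.state → E₁.label v ≠ E₁'.label v →
        L.saddleCoeff E₁ E₁' c.upper (L.next c.upper) = 0 := by
      intro E₁ E₁' h1 h2
      refine L.saddleCoeff_of_not_agreeOff fun hA => h2 ?_
      rw [agreeOff_iff] at hA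
      exact (hA v (by rw [h1]; exact hv)).symm
    cases h1 : E.label v <;> cases h2 : E'.label v
    · rw [hzero E (E'.setLabel v true) rfl (by rw [h1, E'.setLabel_label_of_eq _ rfl]; decide)]
      rfl
    · rfl
    · simp only [Bool.false_eq_true, ↓reduceIte]
      refine L.saddleCoeff_congr rfl rfl ?_ (E.setLabel_label_of_ne _ hu)
        (E.setLabel_label_of_ne _ hu') (E'.setLabel_label_of_ne _ (mt (hcirc _).1 hu)).symm
        (E'.setLabel_label_of_ne _ (mt (hcirc _).1 hu')).symm
      rw [agreeOff_iff, agreeOff_iff]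
      refine forall_congr' fun w => ?_
      by_cases hw : L.circle E.state w = L.circle E.state v
      · rw [E.setLabel_label_of_eq _ hw, E'.setLabel_label_of_eq _ ((hcirc w).2 hw),
          E'.label_eq ((hcirc w).2 hw), E.label_eq hw, h1, h2]
        simp
      · rw [E.setLabel_label_of_ne _ hw, E'.setLabel_label_of_ne _ (mt (hcirc w).1 hw)]
        rfl
    · rw [hzero (E.setLabel v false) E' rfl (by rw [h2, E.setLabel_label_of_eq _ rfl]; decide)]
      rfl

theorem chain_ext {f g : L.Chain F →ₗ[F] L.Chain F}
    (h : ∀ E, f (L.basisChain F E) = g (L.basisChain F E)) : f = g := by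
  classical
  refine LinearMap.pi_ext' fun E => LinearMap.ext_ring ?_
  exact h E

theorem edgeMap_mulVar (c : L.Crossing) (v : Fin L.size) (f : L.Chain F) :
    L.edgeMap F c (L.mulVar F v f) = L.mulVar F v (L.edgeMap F c f) := by
  suffices h : L.edgeMap F c * L.mulVar F v = L.mulVar F v * L.edgeMap F c from
    LinearMap.congr_fun h f
  refine L.chain_ext F fun E => funext fun E' => ?_
  rw [Module.End.mul_apply, Module.End.mul_apply, mulVar_apply, edgeMap_basisChain]
  have h := congrArg (Int.cast : ℤ → F) (L.edgeCoeff_setLabel c E E' v)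
  rw [apply_ite Int.cast, apply_ite Int.cast, Int.cast_zero] at h
  rw [← h]
  cases hE : E.label v
  · rw [L.mulVar_basisChain_of_false F hE]
    simp
  · rw [L.mulVar_basisChain_of_true F hE, edgeMap_basisChain]
    simp

/-! ### Units of the smoothings and commuting faces of the cube. -/

/-- The enhanced state in which all circles are labelled `1`. -/
def oneState (S : Finset L.Crossing) : L.EnhancedState := ⟨(S, fun _ => true), fun _ _ _ => rfl⟩

theorem oneState_label (S : Finset L.Crossing) (v : Fin L.size) :
    (L.oneState S).label v = true := rfl

/-- A submodule that contains the units and is stable under the variables is everything. -/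
theorem mem_of_oneState_mem (W : Submodule F (L.Chain F))
    (h1 : ∀ S, L.basisChain F (L.oneState S) ∈ W) (h2 : ∀ v, ∀ f ∈ W, L.mulVar F v f ∈ W)
    (f : L.Chain F) : f ∈ W := by
  classical
  -- Induction on the number of vertices labelled `X`: relabelling one such circle by `1` lowers the
  -- number, and multiplication by its variable restores the state.
  have key : ∀ n, ∀ E : L.EnhancedState,
      (Finset.univ.filter fun v => E.label v = false).card = n → L.basisChain F E ∈ W := by
    intro n
    induction n using Nat.strong_induction_on with
    | _ n ih =>
      intro E hE
      by_cases h : ∃ v, E.label v = false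
      · obtain ⟨v, hv⟩ := h
        have h3 : E = (E.setLabel v true).setLabel v false :=
          ((EnhancedState.setLabel_eq_iff E (E.setLabel v true) v false).1 ⟨hv, rfl⟩).2
        have h4 : (E.setLabel v true).label v = true := E.setLabel_label_of_eq _ rfl
        rw [h3, ← L.mulVar_basisChain_of_true F h4]
        refine h2 _ _ (ih _ ?_ _ rfl)
        rw [← hE]
        refine Finset.card_lt_card ⟨fun w hw => ?_, fun hsub => ?_⟩
        · simp only [Finset.mem_filter, Finset.mem_univ, true_and] at hw ⊢
          rw [EnhancedState.setLabel_label] at hw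
          split_ifs at hw
          exact hw
        · have := hsub (show v ∈ _ by simpa using hv)
          simp [h4] at this
      · push Not at h
        have : E = L.oneState E.state := by
          refine EnhancedState.ext rfl fun v => ?_
          rw [oneState_label]
          simpa using h v
        rw [this]
        exact h1 _
  have hf : f = ∑ E, f E • L.basisChain F E := by
    funext E'
    simp [Finset.sum_apply, basisChain, Pi.single_apply]
  rw [hf]
  exact Submodule.sum_mem _ fun E _ => Submodule.smul_mem _ _ (key _ E rfl)

/-- The unit of a smoothing. -/
noncomputable def unit (S : Finset L.Crossing) : L.Chain F := L.basisChain F (L.oneState S)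

theorem mulVar_unit_congr {S : Finset L.Crossing} {v w : Fin L.size}
    (h : L.circle S v = L.circle S w) : L.mulVar F v (L.unit F S) = L.mulVar F w (L.unit F S) := by
  rw [unit, L.mulVar_basisChain_of_true F (L.oneState_label S v),
    L.mulVar_basisChain_of_true F (L.oneState_label S w), EnhancedState.setLabel_congr _ _ h]

theorem edgeMap_unit_of_mem {S : Finset L.Crossing} {c : L.Crossing} (hc : c ∈ S) :
    L.edgeMap F c (L.unit F S) = 0 := by
  funext E'
  rw [unit, edgeMap_basisChain]
  unfold edgeCoeff
  rw [if_neg fun h => h.1 hc, Int.cast_zero]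
  rfl

theorem edgeMap_unit_apply {S : Finset L.Crossing} {c : L.Crossing}
    (E' : L.EnhancedState) (h : E'.state ≠ insert c S) :
    L.edgeMap F c (L.unit F S) E' = 0 := by
  rw [unit, edgeMap_basisChain]
  unfold edgeCoeff
  rw [if_neg fun h' => h h'.2, Int.cast_zero]

/-- This is `1 * 1 = 1` in the algebra of the merged circle. -/
theorem edgeMap_unit_merge {S : Finset L.Crossing} {c : L.Crossing} (hc : c ∉ S)
    (hm : L.circle S c.upper ≠ L.circle S (L.next c.upper)) :
    L.edgeMap F c (L.unit F S) = L.unit F (insert c S) := by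
  classical
  have hm' : L.circle (insert c S) c.upper = L.circle (insert c S) (L.next c.upper) := by
    by_contra h'
    exact hm ((L.circle_insert_ne_iff hc).1 h')
  funext E'
  by_cases hS : E'.state = insert c S
  swap
  · rw [L.edgeMap_unit_apply F E' hS, unit, basisChain, Pi.single_apply, if_neg]
    rintro rfl
    exact hS rfl
  rw [unit, edgeMap_basisChain, unit, basisChain, Pi.single_apply]
  have hmm : L.circle E'.state c.upper = L.circle E'.state (L.next c.upper) := by rwa [hS]
  rw [L.edgeCoeff_of_state hc hS]
  have hAi : L.AgreeOff (L.oneState S) E' c.upper (L.next c.upper) ↔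
      ∀ v, ¬ L.Meets S c v → E'.label v = true := L.agreeOff_iff _ _ _
  have hE : E' = L.oneState (insert c S) ↔ (∀ v, ¬ L.Meets S c v → E'.label v = true) ∧
      E'.label c.upper = true := by
    rw [EnhancedState.ext_iff_of_state hS]
    simp only [oneState_label]
    refine ⟨fun h => ⟨fun v _ => h v, h _⟩, fun h v => ?_⟩
    by_cases hv : L.Meets S c v
    · have := L.meets_insert.2 hv
      rw [← hS] at this
      rcases this with h' | h'
      · rw [E'.label_eq h', h.2]
      · rw [E'.label_eq h', ← E'.label_eq hmm, h.2]
    · exact h.1 v hv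
  by_cases hA : ∀ v, ¬ L.Meets S c v → E'.label v = true
  · rw [L.saddleCoeff_merge (hAi.2 hA) hm hmm, oneState_label, oneState_label]
    cases hl : E'.label c.upper
    · rw [if_neg (by rw [hE, hl]; simp)]
      simp [mulCoeff]
    · rw [if_pos (hE.2 ⟨hA, hl⟩)]
      simp [mulCoeff]
  · rw [L.saddleCoeff_of_not_agreeOff (mt hAi.1 hA), if_neg (fun h => hA (hE.1 h).1), Int.cast_zero]

/-- This is `Δ(1) = X ⊗ 1 + 1 ⊗ X`, with the factors `X` written as the variables of the two new
circles. -/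
theorem edgeMap_unit_split {S : Finset L.Crossing} {c : L.Crossing} (hc : c ∉ S)
    (hm : L.circle S c.upper = L.circle S (L.next c.upper)) :
    L.edgeMap F c (L.unit F S) = L.mulVar F c.upper (L.unit F (insert c S)) +
      L.mulVar F (L.next c.upper) (L.unit F (insert c S)) := by
  classical
  have hm' := (L.circle_insert_ne_iff hc).2 hm
  have hunit : L.unit F (insert c S) = L.basisChain F (L.oneState (insert c S)) := rfl
  rw [hunit, L.mulVar_basisChain_of_true F (L.oneState_label _ _),
    L.mulVar_basisChain_of_true F (L.oneState_label _ _)]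
  funext E'
  by_cases hS : E'.state = insert c S
  swap
  · rw [L.edgeMap_unit_apply F E' hS, Pi.add_apply, basisChain, basisChain, Pi.single_apply,
      Pi.single_apply, if_neg, if_neg, add_zero]
    · rintro rfl
      exact hS rfl
    · rintro rfl
      exact hS rfl
  rw [unit, edgeMap_basisChain, Pi.add_apply, basisChain, basisChain, Pi.single_apply,
    Pi.single_apply]
  have hmm : L.circle E'.state c.upper ≠ L.circle E'.state (L.next c.upper) := by rwa [hS]
  rw [L.edgeCoeff_of_state hc hS]
  have hAi : L.AgreeOff (L.oneState S) E' c.upper (L.next c.upper) ↔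
      ∀ v, ¬ L.Meets S c v → E'.label v = true := L.agreeOff_iff _ _ _
  have hE : ∀ v v', (v = c.upper ∧ v' = L.next c.upper) ∨ (v = L.next c.upper ∧ v' = c.upper) →
      (E' = (L.oneState (insert c S)).setLabel v false ↔
        (∀ v, ¬ L.Meets S c v → E'.label v = true) ∧ E'.label v = false ∧ E'.label v' = true) := by
    intro v v' hvv
    rw [EnhancedState.ext_iff_of_state hS]
    have hyes : ∀ {w}, L.circle (insert c S) w = L.circle (insert c S) v →
        ((L.oneState (insert c S)).setLabel v false).label w = false := fun h =>
      EnhancedState.setLabel_label_of_eq _ _ h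
    have hno : ∀ {w}, L.circle (insert c S) w ≠ L.circle (insert c S) v →
        ((L.oneState (insert c S)).setLabel v false).label w = true := fun h =>
      EnhancedState.setLabel_label_of_ne _ _ h
    have hvM : L.Meets (insert c S) c v := by
      rcases hvv with ⟨rfl, rfl⟩ | ⟨rfl, rfl⟩
      · exact Or.inl rfl
      · exact Or.inr rfl
    have hne : L.circle (insert c S) v' ≠ L.circle (insert c S) v := by
      rcases hvv with ⟨rfl, rfl⟩ | ⟨rfl, rfl⟩
      · exact hm'.symm
      · exact hm'
    constructor
    · refine fun h => ⟨fun w hw => ?_, ?_, ?_⟩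
      · rw [h, hno]
        exact fun h' => hw (L.meets_insert.1 ((Meets.congr h').2 hvM))
      · rw [h, hyes rfl]
      · rw [h, hno hne]
    · rintro ⟨h1, h2, h3⟩ w
      by_cases hw : L.Meets S c w
      · have := L.meets_insert.2 hw
        have hcase : L.circle (insert c S) w = L.circle (insert c S) v ∨
            L.circle (insert c S) w = L.circle (insert c S) v' := by
          rcases hvv with ⟨rfl, rfl⟩ | ⟨rfl, rfl⟩
          · exact this
          · exact this.symm
        rcases hcase with h' | h'
        · rw [hyes h', E'.label_eq (v := w) (w := v) (by rwa [hS]), h2]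
        · rw [hno (by rw [h']; exact hne), E'.label_eq (v := w) (w := v') (by rwa [hS]), h3]
      · rw [hno, h1 w hw]
        exact fun h' => hw (L.meets_insert.1 ((Meets.congr h').2 hvM))
  have hE1 := hE c.upper (L.next c.upper) (Or.inl ⟨rfl, rfl⟩)
  have hE2 := hE (L.next c.upper) c.upper (Or.inr ⟨rfl, rfl⟩)
  by_cases hA : ∀ v, ¬ L.Meets S c v → E'.label v = true
  · rw [L.saddleCoeff_split (hAi.2 hA) hm hmm, oneState_label]
    simp only [hE1, hE2, and_iff_right hA]
    cases h1 : E'.label c.upper <;> cases h2 : E'.label (L.next c.upper) <;>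
      simp [comulCoeff]
  · rw [L.saddleCoeff_of_not_agreeOff (mt hAi.1 hA), if_neg (fun h => hA (hE1.1 h).1), if_neg (fun h => hA (hE2.1 h).1),
      Int.cast_zero, add_zero]

theorem edgeMap_edgeMap_unit_of_mem {S : Finset L.Crossing} {c c' : L.Crossing}
    (h : c = c' ∨ c ∈ S ∨ c' ∈ S) : L.edgeMap F c' (L.edgeMap F c (L.unit F S)) = 0 := by
  by_cases hc : c ∈ S
  · rw [L.edgeMap_unit_of_mem F hc, map_zero]
  have hc' : c' ∈ insert c S := by
    rcases h with rfl | h | h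
    · exact Finset.mem_insert_self _ _
    · exact absurd h hc
    · exact Finset.mem_insert_of_mem h
  by_cases hm : L.circle S c.upper = L.circle S (L.next c.upper)
  · rw [L.edgeMap_unit_split F hc hm, map_add, edgeMap_mulVar, edgeMap_mulVar,
      L.edgeMap_unit_of_mem F hc']
    simp
  · rw [L.edgeMap_unit_merge F hc hm, L.edgeMap_unit_of_mem F hc']

set_option maxHeartbeats 800000 in
-- Each of the four edges of the face is a merger or a split and changes the number of circles by
-- one. Both paths end with the same number of circles, which excludes ten of the sixteen patterns.
-- In the remaining six, the formulas for the images of the units are compared; this needs an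
-- argument about circles only when each path contains one split and one merger and both begin in
-- the same way.
theorem edgeMap_edgeMap_unit (S : Finset L.Crossing) (c c' : L.Crossing) :
    L.edgeMap F c' (L.edgeMap F c (L.unit F S)) =
      L.edgeMap F c (L.edgeMap F c' (L.unit F S)) := by
  by_cases h0 : c = c' ∨ c ∈ S ∨ c' ∈ S
  · rw [L.edgeMap_edgeMap_unit_of_mem F h0, L.edgeMap_edgeMap_unit_of_mem F (by tauto)]
  push Not at h0
  obtain ⟨hne, hc, hc'⟩ := h0
  have hd : c' ∉ insert c S := by simp [hne.symm, hc']
  have hd' : c ∉ insert c' S := by simp [hne, hc]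
  have hcomm : insert c (insert c' S) = insert c' (insert c S) := Finset.insert_comm _ _ _
  have n1m := L.card_circles_merge hc
  have n1s := L.card_circles_split hc
  have n2m := L.card_circles_merge hc'
  have n2s := L.card_circles_split hc'
  have n3m := L.card_circles_merge hd
  have n3s := L.card_circles_split hd
  have n4m := L.card_circles_merge hd'
  have n4s := L.card_circles_split hd'
  have p1 := L.circle_insert_ne_iff hc
  have p2 := L.circle_insert_ne_iff hc'
  have p3 := L.circle_insert_ne_iff hd
  have p4 := L.circle_insert_ne_iff hd'
  rw [hcomm] at n4m n4s p4
  by_cases h1 : L.circle S c.upper = L.circle S (L.next c.upper) <;>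
  by_cases h2 : L.circle S c'.upper = L.circle S (L.next c'.upper) <;>
  by_cases h3 : L.circle (insert c S) c'.upper = L.circle (insert c S) (L.next c'.upper) <;>
  by_cases h4 : L.circle (insert c' S) c.upper = L.circle (insert c' S) (L.next c.upper)
  -- two splits in both orders
  · rw [L.edgeMap_unit_split F hc h1, L.edgeMap_unit_split F hc' h2]
    simp only [map_add, edgeMap_mulVar, L.edgeMap_unit_split F hd h3,
      L.edgeMap_unit_split F hd' h4, hcomm]
    rw [L.mulVar_comm F c.upper c'.upper, L.mulVar_comm F c.upper (L.next c'.upper),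
      L.mulVar_comm F (L.next c.upper) c'.upper,
      L.mulVar_comm F (L.next c.upper) (L.next c'.upper)]
    abel
  · have := n1s h1; have := n2s h2; have := n3s h3; have := n4m h4; omega
  · have := n1s h1; have := n2s h2; have := n3m h3; have := n4s h4; omega
  -- a split followed by a merger in both orders
  · rw [L.edgeMap_unit_split F hc h1, L.edgeMap_unit_split F hc' h2]
    simp only [map_add, edgeMap_mulVar, L.edgeMap_unit_merge F hd h3,
      L.edgeMap_unit_merge F hd' h4, hcomm]
    have q3 : L.circle (insert c' (insert c S)) c'.upper =
        L.circle (insert c' (insert c S)) (L.next c'.upper) :=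
      not_not.1 (mt p3.1 h3)
    have q4 : L.circle (insert c' (insert c S)) c.upper =
        L.circle (insert c' (insert c S)) (L.next c.upper) := not_not.1 (mt p4.1 h4)
    -- The ends of `c'` were on one circle and are separated by the change at `c`, so their circles
    -- pass through `c`. After the second change all four variables belong to one circle, and both
    -- paths give twice that variable.
    have hw : L.Meets (insert c S) c c'.upper := by
      rcases L.circle_insert_eq_or_meets (c := c) h2 with h | h
      · exact absurd h h3
      · exact h.1
    have key : ∀ u, L.circle (insert c S) c'.upper = L.circle (insert c S) u →
        L.circle (insert c' (insert c S)) c'.upper = L.circle (insert c' (insert c S)) u := by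
      intro u hu
      rcases L.circle_insert_eq_or_meets (c := c') hu with h | h
      · exact h
      · rcases h.2 with h | h
        · exact h.symm
        · rw [h, q3]
    have q : L.circle (insert c' (insert c S)) c'.upper =
        L.circle (insert c' (insert c S)) c.upper := by
      rcases hw with h | h
      · exact key _ h
      · rw [key _ h, q4]
    rw [L.mulVar_unit_congr F q4.symm, L.mulVar_unit_congr F q3.symm, L.mulVar_unit_congr F q]
  · have := n1s h1; have := n2m h2; have := n3s h3; have := n4s h4; omega
  · -- a split and a merger
    rw [L.edgeMap_unit_split F hc h1, L.edgeMap_unit_merge F hc' h2]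
    have := n1s h1; have := n2m h2; have := n3s h3; have := n4m h4; omega
  · rw [L.edgeMap_unit_split F hc h1, L.edgeMap_unit_merge F hc' h2]
    simp only [map_add, edgeMap_mulVar, L.edgeMap_unit_merge F hd h3,
      L.edgeMap_unit_split F hd' h4, hcomm]
  · have := n1s h1; have := n2m h2; have := n3m h3; have := n4m h4; omega
  · have := n1m h1; have := n2s h2; have := n3s h3; have := n4s h4; omega
  · rw [L.edgeMap_unit_merge F hc h1, L.edgeMap_unit_split F hc' h2]
    simp only [map_add, edgeMap_mulVar, L.edgeMap_unit_split F hd h3,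
      L.edgeMap_unit_merge F hd' h4, hcomm]
  · have := n1m h1; have := n2s h2; have := n3m h3; have := n4s h4; omega
  · have := n1m h1; have := n2s h2; have := n3m h3; have := n4m h4; omega
  -- a merger followed by a split in both orders
  · rw [L.edgeMap_unit_merge F hc h1, L.edgeMap_unit_merge F hc' h2,
      L.edgeMap_unit_split F hd h3, L.edgeMap_unit_split F hd' h4, hcomm]
    have q4 : L.circle (insert c' (insert c S)) c.upper ≠
        L.circle (insert c' (insert c S)) (L.next c.upper) := p4.2 h4
    have q1 : L.circle (insert c S) c.upper = L.circle (insert c S) (L.next c.upper) :=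
      not_not.1 (mt p1.1 h1)
    -- The change at `c` joined the two circles at `c'`, so the merged circle passes through both
    -- crossings.
    have hw : L.circle (insert c S) c'.upper = L.circle (insert c S) c.upper := by
      rcases L.circle_eq_or_meets_of_insert h3 with h | h
      · exact absurd h h2
      · rcases L.meets_insert.2 h.1 with h | h
        · exact h
        · rw [h, q1]
    -- Splitting the merged circle gives the same pair of circles whether it is described by the
    -- ends at `c` or by those at `c'`, so the two sums of variables agree up to order.
    have hu : L.Meets (insert c' (insert c S)) c' c.upper :=
      L.meets_insert.2 (Or.inl hw.symm)
    have hu' : L.Meets (insert c' (insert c S)) c' (L.next c.upper) :=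
      L.meets_insert.2 (Or.inl (hw.trans q1).symm)
    rcases hu with h | h <;> rcases hu' with h' | h'
    · exact absurd (h.trans h'.symm) q4
    · rw [L.mulVar_unit_congr F h, L.mulVar_unit_congr F h']
    · rw [L.mulVar_unit_congr F h, L.mulVar_unit_congr F h', add_comm]
    · exact absurd (h.trans h'.symm) q4
  · have := n1m h1; have := n2m h2; have := n3s h3; have := n4m h4; omega
  · have := n1m h1; have := n2m h2; have := n3m h3; have := n4s h4; omega
  · rw [L.edgeMap_unit_merge F hc h1, L.edgeMap_unit_merge F hc' h2,
      L.edgeMap_unit_merge F hd h3, L.edgeMap_unit_merge F hd' h4, hcomm]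

/-- The faces of the cube of resolutions commute. -/
theorem edgeMap_comm (c c' : L.Crossing) (f : L.Chain F) :
    L.edgeMap F c' (L.edgeMap F c f) = L.edgeMap F c (L.edgeMap F c' f) := by
  refine L.mem_of_oneState_mem F
    (LinearMap.eqLocus (L.edgeMap F c' * L.edgeMap F c) (L.edgeMap F c * L.edgeMap F c'))
    (fun S => L.edgeMap_edgeMap_unit F S c c') (fun v f hf => ?_) f
  rw [LinearMap.mem_eqLocus] at hf ⊢
  simp only [Module.End.mul_apply] at hf ⊢
  rw [edgeMap_mulVar, edgeMap_mulVar, edgeMap_mulVar, edgeMap_mulVar, hf]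

/-! ### Signs and the vanishing of the square of the differential. -/

theorem wedgeSign_of_edgeCoeff {c : L.Crossing} {E E' : L.EnhancedState}
    (h : L.edgeCoeff c E E' ≠ 0) : wedgeSign c E.state = wedgeSign c E'.state := by
  rw [(L.edgeCoeff_ne_zero h).2]
  unfold wedgeSign
  rw [Finset.filter_insert, if_neg (lt_irrefl c)]

/-- The sign of `c` does not depend on whether `c` itself belongs to the state, so it can be read
off at the target; the differential is then a signed sum of edge maps. -/
theorem khDiff_apply (f : L.Chain F) (E' : L.EnhancedState) :
    L.khDiff F f E' = ∑ c, (wedgeSign c E'.state : F) * L.edgeMap F c f E' := by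
  simp only [khDiff, Matrix.mulVecLin_apply, Matrix.mulVec, dotProduct, Matrix.of_apply,
    edgeMap_apply, diffCoeff, Finset.mul_sum]
  rw [Finset.sum_comm]
  refine Finset.sum_congr rfl fun E _ => ?_
  push_cast
  rw [Finset.sum_mul]
  refine Finset.sum_congr rfl fun c _ => ?_
  by_cases h : L.edgeCoeff c E E' = 0
  · simp [h]
  · rw [L.wedgeSign_of_edgeCoeff h, mul_assoc]

/-- The inner sign is evaluated at the source of the edge map of `c`, which is the target state with
`c` removed. -/
theorem edgeMap_khDiff (c : L.Crossing) (f : L.Chain F) (E : L.EnhancedState) :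
    L.edgeMap F c (L.khDiff F f) E =
      ∑ c', (wedgeSign c' (E.state.erase c) : F) * L.edgeMap F c (L.edgeMap F c' f) E := by
  rw [edgeMap_apply]
  simp only [khDiff_apply, Finset.mul_sum]
  rw [Finset.sum_comm]
  refine Finset.sum_congr rfl fun c' _ => ?_
  rw [edgeMap_apply, Finset.mul_sum]
  refine Finset.sum_congr rfl fun E' _ => ?_
  by_cases h : L.edgeCoeff c E' E = 0
  · simp [h]
  · obtain ⟨h1, h2⟩ := L.edgeCoeff_ne_zero h
    rw [h2, Finset.erase_insert h1]
    ring

theorem edgeMap_apply_of_notMem {c : L.Crossing} (f : L.Chain F) {E : L.EnhancedState}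
    (h : c ∉ E.state) : L.edgeMap F c f E = 0 := by
  rw [edgeMap_apply]
  refine Finset.sum_eq_zero fun E' _ => ?_
  by_cases h0 : L.edgeCoeff c E' E = 0
  · simp [h0]
  · rw [(L.edgeCoeff_ne_zero h0).2] at h
    exact absurd (Finset.mem_insert_self _ _) h

theorem edgeMap_edgeMap_self (c : L.Crossing) (f : L.Chain F) :
    L.edgeMap F c (L.edgeMap F c f) = 0 := by
  funext E
  rw [edgeMap_apply]
  refine Finset.sum_eq_zero fun E' _ => ?_
  by_cases h0 : L.edgeCoeff c E' E = 0
  · simp [h0]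
  · rw [L.edgeMap_apply_of_notMem F f (L.edgeCoeff_ne_zero h0).1, mul_zero]

end PeriodicLink

/-- Removing the smaller of the two crossings reverses the sign of the larger one, while removing
the larger leaves the sign of the smaller unchanged. Commuting faces thus become anticommuting. -/
theorem wedgeSign_mul_wedgeSign_erase {α : Type} [LinearOrder α] {S : Finset α} {c c' : α}
    (hne : c ≠ c') (hc : c ∈ S) (hc' : c' ∈ S) :
    wedgeSign c S * wedgeSign c' (S.erase c) = -(wedgeSign c' S * wedgeSign c (S.erase c')) := by
  have key : ∀ {a b : α}, a < b → a ∈ S →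
      wedgeSign a (S.erase b) = wedgeSign a S ∧ wedgeSign b (S.erase a) = -wedgeSign b S := by
    intro a b hab ha
    constructor
    · unfold wedgeSign
      rw [Finset.filter_erase, Finset.erase_eq_of_notMem]
      simp [hab.le]
    · unfold wedgeSign
      have hmem : a ∈ S.filter (fun s => s < b) := by simp [ha, hab]
      rw [Finset.filter_erase, ← Finset.card_erase_add_one hmem, pow_succ]
      ring
  rcases lt_or_gt_of_ne hne with h | h
  · rw [(key h hc).1, (key h hc).2]
    ring
  · rw [(key h hc').1, (key h hc').2]
    ring

namespace PeriodicLink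

variable {m : ℕ} (L : PeriodicLink m) (F : Type) [Field F]

theorem khDiff_khDiff (f : L.Chain F) : L.khDiff F (L.khDiff F f) = 0 := by
  funext E
  rw [khDiff_apply]
  simp only [edgeMap_khDiff, Finset.mul_sum]
  rw [← Finset.sum_product', Pi.zero_apply]
  -- The two orders in which two crossings are changed cancel; the diagonal terms vanish by
  -- themselves.
  refine Finset.sum_involution (fun p _ => (p.2, p.1)) ?_ ?_ ?_ ?_
  · rintro ⟨c, c'⟩ -
    simp only
    rw [L.edgeMap_comm F c c' f]
    by_cases hne : c = c'
    · subst hne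
      simp [edgeMap_edgeMap_self]
    by_cases hc : c ∈ E.state
    swap
    · simp [L.edgeMap_apply_of_notMem F _ hc]
    by_cases hc' : c' ∈ E.state
    swap
    · simp [L.edgeMap_comm F c' c, L.edgeMap_apply_of_notMem F _ hc']
    have := congrArg (Int.cast : ℤ → F) (wedgeSign_mul_wedgeSign_erase hne hc hc')
    push_cast at this
    rw [← mul_assoc, ← mul_assoc, this]
    ring
  · rintro ⟨c, c'⟩ - h h'
    obtain rfl : c' = c := (Prod.mk.inj h').1
    apply h
    simp [edgeMap_edgeMap_self]
  · intro a _
    exact Finset.mem_univ _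
  · intro a _
    rfl

end PeriodicLink

/-! ## Equivariant homology over a semisimple group algebra -/

open CategoryTheory in
/-- A projective resolution of a projective object is contractible. -/
theorem CategoryTheory.ProjectiveResolution.exists_contraction {C : Type*} [Category C] [Abelian C]
    {M : C} [Projective M] (P : ProjectiveResolution M) :
    ∃ (σ : M ⟶ P.complex.X 0) (h : ∀ a, P.complex.X a ⟶ P.complex.X (a + 1))
      (ε : P.complex.X 0 ⟶ M), P.complex.d 1 0 ≫ ε = 0 ∧ σ ≫ ε = 𝟙 M ∧
      ε ≫ σ + h 0 ≫ P.complex.d 1 0 = 𝟙 _ ∧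
      ∀ a, P.complex.d (a + 1) a ≫ h a + h (a + 1) ≫ P.complex.d (a + 2) (a + 1) = 𝟙 _ := by
  have he : Epi (P.π.f 0) := inferInstance
  let ε : P.complex.X 0 ⟶ M := P.π.f 0
  have he' : Epi ε := he
  let σ : M ⟶ P.complex.X 0 := Projective.factorThru (𝟙 M) ε
  have hσ : σ ≫ ε = 𝟙 M := Projective.factorThru_comp _ _
  -- A section of the augmentation exists because `M` is projective. The map `𝟙 - P.π ≫ s` then
  -- covers zero on `M` and is null-homotopic; the components of the homotopy form the contraction.
  let s : (ChainComplex.single₀ C).obj M ⟶ P.complex := (P.complex.fromSingle₀Equiv M).symm σ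
  have hs0 : s.f 0 = σ := ChainComplex.fromSingle₀Equiv_symm_apply_f_zero _
  have hs : s ≫ P.π = 𝟙 _ := by
    refine HomologicalComplex.from_single_hom_ext ?_
    rw [HomologicalComplex.comp_f, hs0]
    exact hσ
  have hg : (𝟙 P.complex - P.π ≫ s) ≫ P.π = 0 := by
    rw [Preadditive.sub_comp, Category.assoc, hs, Category.id_comp, Category.comp_id, sub_self]
  let H := ProjectiveResolution.liftHomotopyZero (𝟙 P.complex - P.π ≫ s) hg
  refine ⟨σ, fun a => H.hom a (a + 1), ε, P.complex_d_comp_π_f_zero, hσ, ?_, fun a => ?_⟩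
  · have h0 := H.comm 0
    rw [Homotopy.dNext_zero_chainComplex, Homotopy.prevD_chainComplex] at h0
    simp only [HomologicalComplex.sub_f_apply, HomologicalComplex.id_f, HomologicalComplex.comp_f,
      hs0, HomologicalComplex.zero_f, add_zero, zero_add] at h0
    rw [← h0]
    exact add_sub_cancel _ _
  · have h0 := H.comm (a + 1)
    rw [Homotopy.dNext_succ_chainComplex, Homotopy.prevD_chainComplex] at h0
    simp only [HomologicalComplex.sub_f_apply, HomologicalComplex.id_f, HomologicalComplex.comp_f,
      HomologicalComplex.zero_f, add_zero, ProjectiveResolution.π_f_succ, Limits.zero_comp,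
      sub_zero] at h0
    exact h0.symm

namespace PeriodicLink

variable {m : ℕ} [NeZero m] (L : PeriodicLink m) {F : Type} [Field F]
  (M : ModuleCat.{0} (CyclicAlgebra F m))

/-- The homomorphisms of modules over the group algebra from `M` to the Khovanov complex. -/
abbrev KhHom : Type := M →ₗ[CyclicAlgebra F m] L.ChainModule F

/-- The differential induced on `Hom(M, C)`. -/
noncomputable def homDiff : L.KhHom M →ₗ[F] L.KhHom M where
  toFun φ := L.khDiffEquivariant F ∘ₗ φ
  map_add' _ _ := LinearMap.comp_add _ _ _
  map_smul' c _ := LinearMap.ext fun _ => (L.khDiff F).map_smul c _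

/-- The part `Hom(M, C^{i,k})` of `Hom(M, C)`. -/
noncomputable def homGraded (i k : ℤ) : Submodule F (L.KhHom M) where
  carrier := {φ | ∀ x, CyclicModule.toVec _ _ (φ x) ∈ L.khGraded F i k}
  zero_mem' := fun _ => Submodule.zero_mem _
  add_mem' hφ hψ := fun x => Submodule.add_mem _ (hφ x) (hψ x)
  smul_mem' c _ hφ := fun x => Submodule.smul_mem _ c (hφ x)

theorem homDiff_mem {i k : ℤ} {φ : L.KhHom M} (h : φ ∈ L.homGraded M i k) :
    L.homDiff M φ ∈ L.homGraded M (i + 1) k := fun x => L.khDiff_mem F (h x)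

theorem homDiff_homDiff (φ : L.KhHom M) : L.homDiff M (L.homDiff M φ) = 0 :=
  LinearMap.ext fun x => L.khDiff_khDiff F (φ x)

/-- Cocycles of `Hom(M, C)`. -/
noncomputable def homCocycles (i k : ℤ) : Submodule F (L.KhHom M) :=
  LinearMap.ker (L.homDiff M) ⊓ L.homGraded M i k

/-- Coboundaries of `Hom(M, C)`. -/
noncomputable def homCoboundaries (i k : ℤ) : Submodule F (L.KhHom M) :=
  (L.homGraded M (i - 1) k).map (L.homDiff M)

theorem homCoboundaries_le (i k : ℤ) : L.homCoboundaries M i k ≤ L.homCocycles M i k := by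
  rintro _ ⟨φ, hφ, rfl⟩
  refine ⟨L.homDiff_homDiff M φ, ?_⟩
  have := L.homDiff_mem M hφ
  rwa [sub_add_cancel] at this

/-- Subtraction on `ℕ` is truncated, so the formula for `a = 0` involves `P.d 0 0`, which is zero.
-/
theorem ekhDiff_zero (φ : L.EKhCochain M) :
    L.ekhDiff M φ 0 = L.khDiffEquivariant F ∘ₗ φ 0 := by
  have h : (CategoryTheory.projectiveResolution M).complex.d 0 (0 - 1) = 0 :=
    HomologicalComplex.shape _ _ _ (by simp)
  change (-1 : F) ^ 0 • (L.khDiffEquivariant F ∘ₗ φ 0) +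
    φ (0 - 1) ∘ₗ ((CategoryTheory.projectiveResolution M).complex.d 0 (0 - 1)).hom = _
  rw [h, pow_zero, one_smul, ModuleCat.hom_zero, LinearMap.comp_zero, add_zero]

theorem ekhDiff_succ (φ : L.EKhCochain M) (a : ℕ) :
    L.ekhDiff M φ (a + 1) = (-1 : F) ^ (a + 1) • (L.khDiffEquivariant F ∘ₗ φ (a + 1)) +
      φ a ∘ₗ ((CategoryTheory.projectiveResolution M).complex.d (a + 1) a).hom := rfl

/-- A homomorphism from `M` as a cochain of the total complex, by means of an augmentation. -/
noncomputable def augment (ε : (CategoryTheory.projectiveResolution M).complex.X 0 ⟶ M) :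
    L.KhHom M →ₗ[F] L.EKhCochain M where
  toFun φ := fun a => match a with
    | 0 => φ ∘ₗ ε.hom
    | _ + 1 => 0
  map_add' φ ψ := by
    funext a
    cases a
    · rfl
    · exact (add_zero 0).symm
  map_smul' c φ := by
    funext a
    cases a
    · rfl
    · exact (smul_zero c).symm

/-- If `M` is projective, the equivariant Khovanov homology is the homology of `Hom(M, C)`. -/
theorem exists_ekh_equiv [CategoryTheory.Projective M] (i k : ℤ) :
    Nonempty (L.EKh M i k ≃ₗ[F]
      (L.homCocycles M i k ⧸ (L.homCoboundaries M i k).submoduleOf (L.homCocycles M i k))) := by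
  set P := (CategoryTheory.projectiveResolution M).complex with hP
  obtain ⟨σ, h, ε, hdε, hσε, h0, hsucc⟩ :
    ∃ (σ : M ⟶ P.X 0) (h : ∀ a, P.X a ⟶ P.X (a + 1)) (ε : P.X 0 ⟶ M), _ :=
    (CategoryTheory.projectiveResolution M).exists_contraction
  have hdeg : ∀ {x : L.ChainModule F} {i : ℤ},
      CyclicModule.toVec _ _ x ∈ L.khGraded F (i - ((0 : ℕ) : ℤ)) k ↔
        CyclicModule.toVec _ _ x ∈ L.khGraded F i k := by
    intro x i
    rw [Nat.cast_zero, sub_zero]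
  have hdε' : ∀ x, ε.hom ((P.d 1 0).hom x) = 0 := fun x =>
    LinearMap.congr_fun (congrArg ModuleCat.Hom.hom hdε) x
  have hσε' : ∀ x, ε.hom (σ.hom x) = x := fun x =>
    LinearMap.congr_fun (congrArg ModuleCat.Hom.hom hσε) x
  have h0' : ∀ x, σ.hom (ε.hom x) + (P.d 1 0).hom ((h 0).hom x) = x := fun x =>
    LinearMap.congr_fun (congrArg ModuleCat.Hom.hom h0) x
  have hsucc' : ∀ a x, (h a).hom ((P.d (a + 1) a).hom x) +
      (P.d (a + 2) (a + 1)).hom ((h (a + 1)).hom x) = x := fun a x =>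
    LinearMap.congr_fun (congrArg ModuleCat.Hom.hom (hsucc a)) x
  have haug : ∀ φ ∈ L.homCocycles M i k,
      L.augment M ε φ ∈ LinearMap.ker (L.ekhDiff M) ⊓ L.ekhGraded M i k := by
    rintro φ ⟨h1, h2⟩
    have h1' : ∀ x, L.khDiffEquivariant F (φ x) = 0 := fun x => LinearMap.congr_fun h1 x
    refine ⟨?_, ?_⟩
    · change L.ekhDiff M _ = 0
      funext a
      rcases a with _ | _ | a
      · rw [ekhDiff_zero]
        exact LinearMap.ext fun x => h1' (ε.hom x)
      · rw [ekhDiff_succ]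
        refine LinearMap.ext fun x => ?_
        change (-1 : F) ^ (0 + 1) • L.khDiffEquivariant F 0 + φ (ε.hom ((P.d 1 0).hom x)) = 0
        rw [map_zero, smul_zero, hdε', map_zero, add_zero]
      · rw [ekhDiff_succ]
        refine LinearMap.ext fun x => ?_
        change (-1 : F) ^ (a + 1 + 1) • L.khDiffEquivariant F 0 + 0 = (0 : L.ChainModule F)
        rw [map_zero, smul_zero, add_zero]
    · intro a x
      cases a with
      | zero => exact hdeg.2 (h2 (ε.hom x))
      | succ a => exact Submodule.zero_mem _
  let f₀ : L.homCocycles M i k →ₗ[F] ↥(LinearMap.ker (L.ekhDiff M) ⊓ L.ekhGraded M i k) :=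
    (L.augment M ε).restrict haug
  let f : L.homCocycles M i k →ₗ[F] L.EKh M i k := (Submodule.mkQ _) ∘ₗ f₀
  have hsurj : Function.Surjective f := by
    intro y
    obtain ⟨⟨φ, hφ, hφg⟩, rfl⟩ := Submodule.mkQ_surjective _ y
    have hφ' : L.ekhDiff M φ = 0 := hφ
    have hz : ∀ x, L.khDiffEquivariant F (φ 0 x) = 0 := by
      have := congrFun hφ' 0
      rw [ekhDiff_zero] at this
      exact fun x => LinearMap.congr_fun this x
    -- This is the cocycle equation in resolution degree `a + 1`, solved for its first term.
    have hc : ∀ a x, L.khDiffEquivariant F (φ (a + 1) x) =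
        (-1 : F) ^ a • φ a ((P.d (a + 1) a).hom x) := by
      intro a x
      have := LinearMap.congr_fun (congrFun hφ' (a + 1)) x
      rw [ekhDiff_succ] at this
      change (-1 : F) ^ (a + 1) • L.khDiffEquivariant F (φ (a + 1) x) +
        φ a ((P.d (a + 1) a).hom x) = 0 at this
      rw [eq_neg_of_add_eq_zero_right this, pow_succ, mul_neg_one, neg_smul, neg_neg, smul_smul,
        ← pow_add, ← two_mul, pow_mul]
      simp
    have hψ : φ 0 ∘ₗ σ.hom ∈ L.homCocycles M i k :=
      ⟨LinearMap.ext fun x => hz (σ.hom x), fun x => hdeg.1 (hφg 0 (σ.hom x))⟩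
    refine ⟨⟨_, hψ⟩, ?_⟩
    -- Composition with the contraction moves a cocycle to resolution degree `0`: it differs by the
    -- coboundary of `w` from the cocycle obtained by restricting along `σ` and augmenting.
    let w : L.EKhCochain M := fun a => φ (a + 1) ∘ₗ (h a).hom
    have key : φ - L.augment M ε (φ 0 ∘ₗ σ.hom) = L.ekhDiff M w := by
      funext a
      cases a with
      | zero =>
        refine Eq.trans (LinearMap.ext fun x => ?_) (L.ekhDiff_zero M w).symm
        change φ 0 x - φ 0 (σ.hom (ε.hom x)) = L.khDiffEquivariant F (φ (0 + 1) ((h 0).hom x))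
        rw [hc, pow_zero, one_smul, sub_eq_iff_eq_add, ← map_add, add_comm, h0']
      | succ a =>
        refine Eq.trans (LinearMap.ext fun x => ?_) (L.ekhDiff_succ M w a).symm
        change φ (a + 1) x - 0 = (-1 : F) ^ (a + 1) •
          L.khDiffEquivariant F (φ (a + 1 + 1) ((h (a + 1)).hom x)) +
          φ (a + 1) ((h a).hom ((P.d (a + 1) a).hom x))
        rw [hc, smul_smul, ← pow_add, ← two_mul, pow_mul, neg_one_sq, one_pow, one_smul, sub_zero]
        exact (congrArg (φ (a + 1)) (hsucc' a x).symm).trans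
          (((φ (a + 1)).map_add _ _).trans (add_comm _ _))
    rw [eq_comm]
    refine (Submodule.Quotient.eq _).2 ?_
    change φ - L.augment M ε (φ 0 ∘ₗ σ.hom) ∈ (L.ekhGraded M (i - 1) k).map (L.ekhDiff M)
    rw [key]
    refine ⟨_, fun a x => ?_, rfl⟩
    have := hφg (a + 1) ((h a).hom x)
    push_cast at this
    rwa [show i - ((a : ℤ) + 1) = i - 1 - a by ring] at this
  have hker : LinearMap.ker f = (L.homCoboundaries M i k).submoduleOf (L.homCocycles M i k) := by
    ext ⟨φ, hφ⟩
    change (Submodule.Quotient.mk (f₀ ⟨φ, hφ⟩) : L.EKh M i k) = 0 ↔ φ ∈ L.homCoboundaries M i k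
    rw [Submodule.Quotient.mk_eq_zero]
    change L.augment M ε φ ∈ (L.ekhGraded M (i - 1) k).map (L.ekhDiff M) ↔ _
    constructor
    · rintro ⟨ψ, hψ, e⟩
      -- Restriction along the section `σ` of the augmentation turns a primitive in the total
      -- complex into one in `Hom(M, C)`.
      refine ⟨ψ 0 ∘ₗ σ.hom, fun x => hdeg.1 (hψ 0 (σ.hom x)), LinearMap.ext fun x => ?_⟩
      have e0 := congrFun e 0
      rw [ekhDiff_zero] at e0
      have e1 := LinearMap.congr_fun e0 (σ.hom x)
      change L.khDiffEquivariant F (ψ 0 (σ.hom x)) = φ (ε.hom (σ.hom x)) at e1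
      rw [hσε'] at e1
      exact e1
    · rintro ⟨ψ, hψ, rfl⟩
      refine ⟨L.augment M ε ψ, fun a x => ?_, ?_⟩
      · cases a with
        | zero => exact hdeg.2 (hψ (ε.hom x))
        | succ a => exact Submodule.zero_mem _
      · funext a
        rcases a with _ | _ | a
        · rw [ekhDiff_zero]
          rfl
        · rw [ekhDiff_succ]
          refine LinearMap.ext fun x => ?_
          change (-1 : F) ^ (0 + 1) • L.khDiffEquivariant F 0 + ψ (ε.hom ((P.d 1 0).hom x)) = 0
          rw [map_zero, smul_zero, hdε', map_zero, add_zero]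
        · rw [ekhDiff_succ]
          refine LinearMap.ext fun x => ?_
          change (-1 : F) ^ (a + 1 + 1) • L.khDiffEquivariant F 0 + 0 = (0 : L.ChainModule F)
          rw [map_zero, smul_zero, add_zero]
  exact ⟨((Submodule.quotEquivOfEq _ _ hker.symm).trans (f.quotKerEquivOfSurjective hsurj)).symm⟩

/-- A nonzero homomorphism takes a value with a nonzero coordinate, and this coordinate is an
enhanced state of the given bidegree; there are finitely many of them. -/
theorem finite_setOf_homGraded_ne_bot : {p : ℤ × ℤ | L.homGraded M p.1 p.2 ≠ ⊥}.Finite := by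
  refine (Set.finite_range fun E : L.EnhancedState => (E.hDegree, E.qDegree)).subset ?_
  rintro ⟨i, k⟩ h
  obtain ⟨φ, hφ, h0⟩ := Submodule.exists_mem_ne_zero_of_ne_bot h
  obtain ⟨x, hx⟩ : ∃ x, φ x ≠ 0 := by
    by_contra hcon
    push Not at hcon
    exact h0 (LinearMap.ext hcon)
  obtain ⟨E, hE⟩ : ∃ E, CyclicModule.toVec _ _ (φ x) E ≠ 0 := by
    by_contra hcon
    push Not at hcon
    exact hx (funext hcon)
  obtain ⟨rfl, rfl⟩ := hφ x E hE
  exact ⟨E, rfl⟩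

/-! ### Dimensions and Euler characteristics. -/

section Finite

variable [Module.Finite F (L.KhHom M)]

/-- Rank and nullity of the differential on `Hom(M, C^{i,k})`: the image consists of the
coboundaries one degree higher. -/
theorem finrank_homGraded (i k : ℤ) : (Module.finrank F (L.homGraded M i k) : ℤ) =
    Module.finrank F (L.homCocycles M i k) + Module.finrank F (L.homCoboundaries M (i + 1) k) := by
  have h := LinearMap.finrank_range_add_finrank_ker ((L.homDiff M).domRestrict (L.homGraded M i k))
  rw [LinearMap.range_domRestrict] at h
  have h1 : L.homCoboundaries M (i + 1) k = (L.homGraded M i k).map (L.homDiff M) := by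
    rw [homCoboundaries, add_sub_cancel_right]
  have h2 : Module.finrank F (LinearMap.ker ((L.homDiff M).domRestrict (L.homGraded M i k))) =
      Module.finrank F (L.homCocycles M i k) := by
    rw [LinearMap.ker_domRestrict, ← Submodule.finrank_map_subtype_eq, Submodule.map_comap_subtype,
      homCocycles, inf_comm]
  rw [h1, ← h2, ← h]
  push_cast
  ring

variable [CategoryTheory.Projective M]

theorem finrank_ekh (i k : ℤ) : (Module.finrank F (L.EKh M i k) : ℤ) =
    Module.finrank F (L.homCocycles M i k) - Module.finrank F (L.homCoboundaries M i k) := by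
  obtain ⟨e⟩ := L.exists_ekh_equiv M i k
  rw [e.finrank_eq, eq_sub_iff_add_eq,
    ← (Submodule.submoduleOfEquivOfLe (L.homCoboundaries_le M i k)).finrank_eq]
  exact_mod_cast Submodule.finrank_quotient_add_finrank _

theorem ekhFinite_of_projective : L.EKhFinite M := by
  constructor
  · intro i k
    obtain ⟨e⟩ := L.exists_ekh_equiv M i k
    exact Module.Finite.equiv e.symm
  · refine (L.finite_setOf_homGraded_ne_bot M).subset ?_
    rintro ⟨i, k⟩ h h0
    obtain ⟨e⟩ := L.exists_ekh_equiv M i k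
    have hs : Subsingleton (L.homCocycles M i k) := by
      rw [Submodule.subsingleton_iff_eq_bot, homCocycles]
      change L.homGraded M i k = ⊥ at h0
      rw [h0, inf_bot_eq]
    have h' : Nontrivial (L.EKh M i k) := h
    have := e.symm.nontrivial
    obtain ⟨a, b, hab⟩ := this
    obtain ⟨a, rfl⟩ := Submodule.mkQ_surjective _ a
    obtain ⟨b, rfl⟩ := Submodule.mkQ_surjective _ b
    exact hab (congrArg _ (Subsingleton.elim a b))

/-- The equivariant Jones polynomial as an Euler characteristic of `Hom(M, C)`. -/
theorem equivariantJones_eq : L.equivariantJones M =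
    ∑ᶠ p : ℤ × ℤ, LaurentPolynomial.C ((p.1.negOnePow : ℤ) *
      Module.finrank F (L.homGraded M p.1 p.2)) * LaurentPolynomial.T p.2 := by
  have hz : ∀ p : ℤ × ℤ, L.homGraded M p.1 p.2 = ⊥ →
      Module.finrank F (L.homCocycles M p.1 p.2) = 0 := by
    intro p h
    rw [homCocycles, h, inf_bot_eq, finrank_bot]
  have hb : ∀ p : ℤ × ℤ, L.homGraded M (p.1 - 1) p.2 = ⊥ →
      Module.finrank F (L.homCoboundaries M p.1 p.2) = 0 := by
    intro p h
    rw [homCoboundaries, h, Submodule.map_bot, finrank_bot]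
  -- Coboundaries enter the dimension of the cochains one degree lower than that of the cohomology,
  -- hence with the opposite sign. The two sums agree after this shift, once the supports are known
  -- to be finite so that `finsum` can be split.
  let e : ℤ × ℤ ≃ ℤ × ℤ := Equiv.prodCongr (Equiv.addRight 1) (Equiv.refl _)
  let z : ℤ × ℤ → LaurentPolynomial ℤ := fun p => LaurentPolynomial.C ((p.1.negOnePow : ℤ) *
      Module.finrank F (L.homCocycles M p.1 p.2)) * LaurentPolynomial.T p.2
  let b : ℤ × ℤ → LaurentPolynomial ℤ := fun p => LaurentPolynomial.C ((p.1.negOnePow : ℤ) *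
      Module.finrank F (L.homCoboundaries M p.1 p.2)) * LaurentPolynomial.T p.2
  have hfin := L.finite_setOf_homGraded_ne_bot M
  have hzf : z.support.Finite := by
    refine hfin.subset fun p hp h0 => hp ?_
    simp only [z, hz p h0]
    simp
  have hbf : (fun p => b (e p)).support.Finite := by
    refine hfin.subset fun p hp h0 => hp ?_
    have : Module.finrank F (L.homCoboundaries M (e p).1 (e p).2) = 0 := by
      apply hb
      change L.homGraded M (p.1 + 1 - 1) p.2 = ⊥
      rw [add_sub_cancel_right, h0]
    simp only [b, this]
    simp
  have hbf' : b.support.Finite := by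
    have := hbf.image e
    refine this.subset fun p hp => ⟨e.symm p, ?_, e.apply_symm_apply p⟩
    simpa [Function.mem_support] using hp
  have h1 : L.equivariantJones M = ∑ᶠ p, (z p - b p) := by
    unfold equivariantJones
    refine finsum_congr fun p => ?_
    simp only [z, b]
    rw [finrank_ekh, mul_sub, map_sub, sub_mul]
  have h2 : (∑ᶠ p : ℤ × ℤ, LaurentPolynomial.C ((p.1.negOnePow : ℤ) *
      Module.finrank F (L.homGraded M p.1 p.2)) * LaurentPolynomial.T p.2) =
      ∑ᶠ p, (z p - b (e p)) := by
    refine finsum_congr fun p => ?_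
    have : b (e p) = LaurentPolynomial.C (((p.1 + 1).negOnePow : ℤ) *
      Module.finrank F (L.homCoboundaries M (p.1 + 1) p.2)) * LaurentPolynomial.T p.2 := rfl
    rw [this, finrank_homGraded, Int.negOnePow_succ, mul_add, map_add, add_mul]
    simp only [z, Units.val_neg, neg_mul, map_neg, sub_neg_eq_add]
  rw [h1, h2, finsum_sub_distrib hzf hbf', finsum_sub_distrib hzf hbf, finsum_comp_equiv e]

end Finite

end PeriodicLink

/-! ## Homomorphisms from a quotient of the polynomial ring -/

/-- The case `m = 1` is included: the residue `1` then has value `0`, but `T` is the identity. -/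
theorem pow_one_val {m : ℕ} {R : Type*} [Monoid R] {T : R} (hT : T ^ m = 1) : T ^ (1 : ZMod m).val = T := by
  rw [ZMod.val_one_eq_one_mod, ← pow_eq_pow_mod 1 hT, pow_one]

theorem mulLeft_root_pow {m : ℕ} {F : Type} [Field F] {f : F[X]} (hf : f ∣ X ^ m - 1) :
    (LinearMap.mulLeft F (AdjoinRoot.root f) : Module.End F (AdjoinRoot f)) ^ m = 1 := by
  have h : AdjoinRoot.root f ^ m = 1 := by
    simpa [sub_eq_zero] using AdjoinRoot.mk_eq_zero.2 hf
  rw [LinearMap.pow_mulLeft, h, LinearMap.mulLeft_one]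
  rfl

section CyclicModule

variable {F : Type} [Field F] {m : ℕ} [NeZero m]

variable {V W : Type} [AddCommGroup V] [Module F V] [AddCommGroup W] [Module F W]
  {T : Module.End F V} {hT : T ^ m = 1} {U : Module.End F W} {hU : U ^ m = 1}

theorem CyclicModule.toVec_generator_smul (v : CyclicModule T hT) :
    CyclicModule.toVec T hT (MonoidAlgebra.single (Multiplicative.ofAdd (1 : ZMod m)) (1 : F) • v) =
      T (CyclicModule.toVec T hT v) := by
  rw [CyclicModule.toVec_smul, Representation.asAlgebraHom_single, one_smul]
  change (T ^ (1 : ZMod m).val) _ = _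
  rw [pow_one_val hT]

theorem CyclicModule.map_apply (φ : CyclicModule T hT →ₗ[CyclicAlgebra F m] CyclicModule U hU)
    (v : V) : CyclicModule.toVec U hU (φ ((CyclicModule.toVec T hT).symm (T v))) =
      U (CyclicModule.toVec U hU (φ ((CyclicModule.toVec T hT).symm v))) := by
  rw [← CyclicModule.toVec_generator_smul, ← map_smul]
  congr 2
  refine (CyclicModule.toVec T hT).injective ?_
  rw [CyclicModule.toVec_generator_smul, LinearEquiv.apply_symm_apply, LinearEquiv.apply_symm_apply]

/-- A linear map that intertwines the actions of the generator is linear over `F[ℤ/m]`. -/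
noncomputable def CyclicModule.mapOfIntertwines (ψ : V →ₗ[F] W) (h : ∀ v, ψ (T v) = U (ψ v)) :
    CyclicModule T hT →ₗ[CyclicAlgebra F m] CyclicModule U hU where
  toFun v := (CyclicModule.toVec U hU).symm (ψ (CyclicModule.toVec T hT v))
  map_add' v w := by simp
  map_smul' a v := by
    refine (CyclicModule.toVec U hU).injective ?_
    simp only [RingHom.id_apply, LinearEquiv.apply_symm_apply, CyclicModule.toVec_smul]
    induction a using MonoidAlgebra.induction_linear with
    | zero => simp
    | add x y hx hy => simp [hx, hy]
    | single g c =>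
      have hn : ∀ (n : ℕ) v, ψ ((T ^ n) v) = (U ^ n) (ψ v) := by
        intro n
        induction n with
        | zero => intro v; rfl
        | succ n ih => intro v; rw [pow_succ', pow_succ', Module.End.mul_apply,
            Module.End.mul_apply, h, ih]
      simp only [Representation.asAlgebraHom_single, LinearMap.smul_apply, map_smul]
      congr 1
      exact hn _ _

/-- A homomorphism over the group algebra commutes with the generator, hence with every polynomial
in it. On a module generated by one vector it is thus determined by its value there. -/
theorem CyclicModule.map_aeval (φ : CyclicModule T hT →ₗ[CyclicAlgebra F m] CyclicModule U hU)
    (p : F[X]) (v : V) :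
    CyclicModule.toVec U hU (φ ((CyclicModule.toVec T hT).symm (aeval T p v))) =
      aeval U p (CyclicModule.toVec U hU (φ ((CyclicModule.toVec T hT).symm v))) := by
  induction p using Polynomial.induction_on generalizing v with
  | C c =>
    rw [aeval_C, aeval_C, Module.algebraMap_end_apply, Module.algebraMap_end_apply]
    have h : (CyclicModule.toVec T hT).symm (c • v) = c • (CyclicModule.toVec T hT).symm v := rfl
    rw [h, LinearMap.map_smul_of_tower]
    rfl
  | add p q hp hq => simp only [map_add, LinearMap.add_apply, hp, hq]
  | monomial n c h =>
    rw [pow_succ, ← mul_assoc, map_mul (aeval T) _ X, map_mul (aeval U) _ X,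
      Module.End.mul_apply, Module.End.mul_apply, h,
      aeval_X, aeval_X, CyclicModule.map_apply]

/-- The value of a homomorphism at a vector. -/
noncomputable def CyclicModule.evalAt (v : V) :
    (CyclicModule T hT →ₗ[CyclicAlgebra F m] CyclicModule U hU) →ₗ[F] W where
  toFun φ := CyclicModule.toVec U hU (φ ((CyclicModule.toVec T hT).symm v))
  map_add' _ _ := rfl
  map_smul' _ _ := rfl

variable {f : F[X]} {v : V}

theorem CyclicModule.evalAt_injective (hv : ∀ w, ∃ p : F[X], aeval T p v = w) : Function.Injective
    (CyclicModule.evalAt v : (CyclicModule T hT →ₗ[CyclicAlgebra F m] CyclicModule U hU) →ₗ[F] W) := by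
  intro φ ψ h
  refine LinearMap.ext fun x => ?_
  obtain ⟨p, hp⟩ := hv (CyclicModule.toVec T hT x)
  refine (CyclicModule.toVec U hU).injective ?_
  have h1 := CyclicModule.map_aeval φ p v
  have h2 := CyclicModule.map_aeval ψ p v
  rw [hp, LinearEquiv.symm_apply_apply] at h1 h2
  exact h1.trans ((congrArg (aeval U p) h).trans h2.symm)

/-- If `V` is isomorphic to `F[X]/(f)`, then `Hom(V, W)` is the kernel of `f` in `W`. -/
theorem CyclicModule.exists_evalAt_eq (hv : ∀ w, ∃ p : F[X], aeval T p v = w)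
    (hf : ∀ p : F[X], aeval T p v = 0 → f ∣ p) {w : W} (hw : aeval U f w = 0) :
    ∃ φ : CyclicModule T hT →ₗ[CyclicAlgebra F m] CyclicModule U hU,
      CyclicModule.evalAt v φ = w := by
  choose g hg using hv
  -- The annihilator of `v` lies in the ideal of `f`, which kills `w`; so the value at `p(T) v` can
  -- be defined as `p(U) w`, whatever polynomial is chosen.
  have key : ∀ p q : F[X], aeval T p v = aeval T q v → aeval U p w = aeval U q w := by
    intro p q h
    rw [← sub_eq_zero, ← LinearMap.sub_apply, ← map_sub] at h ⊢
    obtain ⟨s, hs⟩ := hf _ h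
    rw [hs, mul_comm, map_mul, Module.End.mul_apply, hw, map_zero]
  let ψ : V →ₗ[F] W :=
    { toFun := fun x => aeval U (g x) w
      map_add' := fun x y => by
        rw [← LinearMap.add_apply, ← map_add]
        exact key _ _ (by rw [map_add, LinearMap.add_apply, hg, hg, hg])
      map_smul' := fun c x => by
        rw [RingHom.id_apply, ← LinearMap.smul_apply, ← map_smul]
        exact key _ _ (by rw [map_smul, LinearMap.smul_apply, hg, hg]) }
  have hψ : ∀ x, ψ (T x) = U (ψ x) := by
    intro x
    change aeval U (g (T x)) w = U (aeval U (g x) w)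
    have h := key (g (T x)) (X * g x) (by
      rw [map_mul, aeval_X, Module.End.mul_apply, hg, hg])
    rw [h, map_mul, aeval_X, Module.End.mul_apply]
  refine ⟨CyclicModule.mapOfIntertwines ψ hψ, ?_⟩
  change aeval U (g v) w = w
  rw [key (g v) 1 (by rw [hg, map_one, Module.End.one_apply]), map_one, Module.End.one_apply]

theorem CyclicModule.aeval_evalAt (φ : CyclicModule T hT →ₗ[CyclicAlgebra F m] CyclicModule U hU)
    (hf : aeval T f v = 0) : aeval U f (CyclicModule.evalAt v φ) = 0 := by
  have := CyclicModule.map_aeval φ f v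
  rw [hf, map_zero, map_zero, map_zero] at this
  exact this.symm

theorem aeval_mulLeft_root (f p : F[X]) :
    aeval (LinearMap.mulLeft F (AdjoinRoot.root f)) p 1 = AdjoinRoot.mk f p := by
  change aeval (Algebra.lmul F (AdjoinRoot f) (AdjoinRoot.root f)) p 1 = _
  rw [aeval_algHom_apply, AdjoinRoot.aeval_eq]
  exact mul_one _

end CyclicModule

theorem LinearMap.aeval_restrict_apply {F V : Type*} [Field F] [AddCommGroup V] [Module F V]
    {T : Module.End F V} {W : Submodule F V} (h : ∀ x ∈ W, T x ∈ W) (p : F[X]) (x : W) :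
    (aeval (T.restrict h) p x : V) = aeval T p x := by
  induction p using Polynomial.induction_on generalizing x with
  | C c => simp
  | add p q hp hq => simp [hp, hq]
  | monomial n c ih =>
    rw [pow_succ, ← mul_assoc, map_mul _ _ X, map_mul _ _ X,
      Module.End.mul_apply, Module.End.mul_apply, ih,
      aeval_X, aeval_X]
    rfl

/-! ### Homomorphisms from `F[X]/(f)` to the Khovanov complex. -/

namespace PeriodicLink

variable {m : ℕ} [NeZero m] (L : PeriodicLink m) {F : Type} [Field F]

/-- The action of the rotation on `C^{i,k}`. -/
noncomputable def khRotGraded (F : Type) [Field F] (i k : ℤ) : Module.End F (L.khGraded F i k) :=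
  (L.khRot F).restrict fun _ hf => L.khRot_mem F hf

variable {f : F[X]} (hf : f ∣ X ^ m - 1)

/-- The value of a homomorphism to the Khovanov complex at the generator of `F[X]/(f)`. -/
noncomputable def polyEval : L.KhHom (polyModule m f hf) →ₗ[F] L.Chain F :=
  CyclicModule.evalAt (hT := mulLeft_root_pow hf) (1 : AdjoinRoot f)

theorem exists_aeval_root_eq (f : F[X]) (w : AdjoinRoot f) :
    ∃ p : F[X], aeval (LinearMap.mulLeft F (AdjoinRoot.root f)) p 1 = w := by
  obtain ⟨p, rfl⟩ := AdjoinRoot.mk_surjective w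
  exact ⟨p, aeval_mulLeft_root f p⟩

theorem polyEval_injective : Function.Injective (L.polyEval hf) :=
  CyclicModule.evalAt_injective (exists_aeval_root_eq f)

instance : Module.Finite F (L.KhHom (polyModule m f hf)) :=
  Module.Finite.of_injective (L.polyEval hf) (L.polyEval_injective hf)

/-- A homomorphism is given by the image of `1`, which can be any chain killed by `f` of the
rotation. The homomorphism has bidegree `(i, k)` as soon as this image has, because the rotation
preserves the bidegree. -/
theorem map_polyEval_homGraded (i k : ℤ) : (L.homGraded (polyModule m f hf) i k).map (L.polyEval hf) =
    (LinearMap.ker (aeval (L.khRotGraded F i k) f)).map (L.khGraded F i k).subtype := by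
  ext g
  constructor
  · rintro ⟨φ, hφ, rfl⟩
    refine ⟨⟨_, hφ _⟩, ?_, rfl⟩
    refine Subtype.ext ?_
    rw [khRotGraded, LinearMap.aeval_restrict_apply]
    exact CyclicModule.aeval_evalAt (hT := mulLeft_root_pow hf) φ
      ((aeval_mulLeft_root f f).trans AdjoinRoot.mk_self)
  · rintro ⟨⟨g, hg⟩, hg', rfl⟩
    have h0 : aeval (L.khRot F) f g = 0 := by
      have := congrArg Subtype.val (LinearMap.mem_ker.1 hg')
      rwa [khRotGraded, LinearMap.aeval_restrict_apply] at this
    obtain ⟨φ, hφ⟩ : ∃ φ, L.polyEval hf φ = g :=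
      CyclicModule.exists_evalAt_eq (exists_aeval_root_eq f) (fun p hp => by
        rwa [aeval_mulLeft_root, AdjoinRoot.mk_eq_zero] at hp) h0
    refine ⟨φ, fun x => ?_, hφ⟩
    obtain ⟨p, hp⟩ := exists_aeval_root_eq f x
    have h1 := CyclicModule.map_aeval (hT := mulLeft_root_pow hf) φ p (1 : AdjoinRoot f)
    have h3 := congrArg (fun y : AdjoinRoot f => CyclicModule.toVec _ _
      (φ ((CyclicModule.toVec _ (mulLeft_root_pow hf)).symm y))) hp
    have h2 : CyclicModule.toVec _ _ (φ x) = aeval (L.khRot F) p g :=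
      h3.symm.trans (h1.trans (congrArg (aeval (L.khRot F) p) hφ))
    rw [h2]
    have h4 := LinearMap.aeval_restrict_apply (W := L.khGraded F i k)
      (fun _ hf => L.khRot_mem F hf) p ⟨g, hg⟩
    rw [← h4]
    exact Subtype.property _

theorem finrank_homGraded_polyModule (i k : ℤ) :
    Module.finrank F (L.homGraded (polyModule m f hf) i k) =
      Module.finrank F (LinearMap.ker (aeval (L.khRotGraded F i k) f)) := by
  rw [((L.homGraded _ i k).equivMapOfInjective _ (L.polyEval_injective hf)).finrank_eq,
    map_polyEval_homGraded, Submodule.finrank_map_subtype_eq]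

/-- Maschke's theorem: the order `m` of the group is invertible in `F_r`, so the group algebra is
semisimple and all its modules are projective. -/
theorem projective_of_coprime (r : ℕ) [Fact r.Prime] (hrm : Nat.gcd r m = 1)
    (M : ModuleCat.{0} (CyclicAlgebra (ZMod r) m)) : CategoryTheory.Projective M := by
  have : NeZero (Nat.card (Multiplicative (ZMod m)) : ZMod r) := by
    constructor
    rw [Nat.card_congr Multiplicative.toAdd, Nat.card_zmod, Ne, ZMod.natCast_eq_zero_iff]
    intro h
    exact (Fact.out : r.Prime).one_lt.ne' (Nat.dvd_one.1 (hrm ▸ Nat.dvd_gcd dvd_rfl h))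
  have : Module.Projective (CyclicAlgebra (ZMod r) m) M :=
    Module.projective_of_isSemisimpleRing (CyclicAlgebra (ZMod r) m) M
  exact (IsProjective.iff_projective M).1 this

end PeriodicLink

/-! ## Kernels of polynomials in an endomorphism -/

section Kernel

variable {F V : Type*} [Field F] [AddCommGroup V] [Module F V]

/-- Through `T` the kernel becomes a vector space over the field `F[X]/(f)`, whose degree over `F`
is that of `f`. -/
theorem natDegree_dvd_finrank_ker_aeval (T : Module.End F V) {f : F[X]} (hf : Irreducible f) :
    f.natDegree ∣ Module.finrank F (LinearMap.ker (aeval T f)) := by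
  have : Fact (Irreducible f) := ⟨hf⟩
  have hT : ∀ x ∈ LinearMap.ker (aeval T f), T x ∈ LinearMap.ker (aeval T f) := by
    intro x hx
    have h : aeval T f (T x) = aeval T (f * X) x := by
      rw [map_mul, aeval_X, Module.End.mul_apply]
    rw [LinearMap.mem_ker] at hx ⊢
    rw [h, mul_comm, map_mul, Module.End.mul_apply, hx, map_zero]
  have h0 : aeval (T.restrict hT) f = 0 := by
    refine LinearMap.ext fun x => Subtype.ext ?_
    rw [LinearMap.aeval_restrict_apply]
    exact x.2
  let φ : AdjoinRoot f →ₐ[F] Module.End F (LinearMap.ker (aeval T f)) :=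
    Ideal.Quotient.liftₐ (Ideal.span {f}) (aeval (T.restrict hT)) fun p hp => by
      obtain ⟨s, rfl⟩ := Ideal.mem_span_singleton.1 hp
      rw [map_mul, h0, zero_mul]
  let : Module (AdjoinRoot f) (LinearMap.ker (aeval T f)) := Module.compHom _ φ.toRingHom
  have : IsScalarTower F (AdjoinRoot f) (LinearMap.ker (aeval T f)) := by
    refine ⟨fun c a x => ?_⟩
    change φ (c • a) x = c • φ a x
    rw [map_smul, LinearMap.smul_apply]
  have hd : Module.finrank F (AdjoinRoot f) = f.natDegree :=
    (AdjoinRoot.powerBasis hf.ne_zero).finrank.trans (AdjoinRoot.powerBasis_dim hf.ne_zero)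
  rw [← hd]
  have : Module.Finite F (AdjoinRoot f) := (AdjoinRoot.powerBasis hf.ne_zero).finite
  exact ⟨_, (Module.finrank_mul_finrank F (AdjoinRoot f) _).symm⟩

variable [Module.Finite F V]

theorem finrank_ker_aeval_mul (T : Module.End F V) {p q : F[X]} (h : IsCoprime p q) :
    Module.finrank F (LinearMap.ker (aeval T (p * q))) =
      Module.finrank F (LinearMap.ker (aeval T p)) + Module.finrank F (LinearMap.ker (aeval T q)) := by
  rw [← sup_ker_aeval_eq_ker_aeval_mul_of_coprime T h, ← Submodule.finrank_sup_add_finrank_inf_eq,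
    (disjoint_ker_aeval_of_isCoprime T h).eq_bot, finrank_bot, add_zero]

/-- Factors of a separable product are coprime, so the kernel of the product is the direct sum of
their kernels. -/
theorem finrank_ker_aeval_prod (T : Module.End F V) {ι : Type*} (s : Finset ι) (f : ι → F[X])
    (h : (∏ i ∈ s, f i).Separable) : Module.finrank F (LinearMap.ker (aeval T (∏ i ∈ s, f i))) =
      ∑ i ∈ s, Module.finrank F (LinearMap.ker (aeval T (f i))) := by
  classical
  induction s using Finset.induction_on with
  | empty =>
    have : LinearMap.ker (1 : Module.End F V) = ⊥ := LinearMap.ker_id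
    rw [Finset.prod_empty, Finset.sum_empty, map_one, this, finrank_bot]
  | insert a s ha ih =>
    rw [Finset.prod_insert ha] at h ⊢
    rw [Finset.sum_insert ha, finrank_ker_aeval_mul T h.isCoprime, ih h.of_mul_right]

end Kernel

/-! ## Cyclotomic cosets and cyclotomic polynomials -/

section Cosets

variable {m r : ℕ} [NeZero m]

theorem mem_cyclotomicCoset {a b : ZMod m} :
    b ∈ cyclotomicCoset m r a ↔ ∃ k : ℕ, a * (r : ZMod m) ^ k = b := by
  simp [cyclotomicCoset]

theorem mem_cyclotomicCoset_self (a : ZMod m) : a ∈ cyclotomicCoset m r a :=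
  mem_cyclotomicCoset.2 ⟨0, by rw [pow_zero, mul_one]⟩

theorem cyclotomicCoset_subset {a b : ZMod m} (h : b ∈ cyclotomicCoset m r a) :
    cyclotomicCoset m r b ⊆ cyclotomicCoset m r a := by
  intro c hc
  obtain ⟨k, rfl⟩ := mem_cyclotomicCoset.1 h
  obtain ⟨l, rfl⟩ := mem_cyclotomicCoset.1 hc
  exact mem_cyclotomicCoset.2 ⟨k + l, by rw [pow_add, mul_assoc]⟩

/-- Some positive power of `r` is `1` modulo `m`, so multiplication by powers of `r` can be undone
by further powers; cosets therefore partition `ℤ/m`. -/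
theorem mem_cyclotomicCoset_symm (hrm : Nat.gcd r m = 1) {a b : ZMod m}
    (h : b ∈ cyclotomicCoset m r a) : a ∈ cyclotomicCoset m r b := by
  obtain ⟨k, rfl⟩ := mem_cyclotomicCoset.1 h
  obtain ⟨n, hn, h1⟩ : ∃ n, 0 < n ∧ (r : ZMod m) ^ n = 1 := by
    refine ⟨Nat.totient m, Nat.totient_pos.2 (NeZero.pos m), ?_⟩
    rw [← ZMod.coe_unitOfCoprime r hrm, ← Units.val_pow_eq_pow_val, ZMod.pow_totient, Units.val_one]
  obtain ⟨n, rfl⟩ := Nat.exists_eq_add_of_lt hn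
  refine mem_cyclotomicCoset.2 ⟨n * k, ?_⟩
  rw [mul_assoc, ← pow_add, show k + n * k = (0 + n + 1) * k by ring, pow_mul, h1, one_pow, mul_one]

theorem cyclotomicCoset_eq_iff (hrm : Nat.gcd r m = 1) {a b : ZMod m} :
    cyclotomicCoset m r b = cyclotomicCoset m r a ↔ b ∈ cyclotomicCoset m r a := by
  refine ⟨fun h => h ▸ mem_cyclotomicCoset_self b, fun h => ?_⟩
  exact (cyclotomicCoset_subset h).antisymm
    (cyclotomicCoset_subset (mem_cyclotomicCoset_symm hrm h))

theorem mem_cosetsOfGcd {χ : CyclotomicCosets m r} {d : ℕ} :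
    χ ∈ cosetsOfGcd m r d ↔ ∀ a ∈ χ.1, Nat.gcd a.val m = d := by
  simp [cosetsOfGcd]

theorem gcd_val_of_mem_cyclotomicCoset (hrm : Nat.gcd r m = 1) {a b : ZMod m}
    (h : b ∈ cyclotomicCoset m r a) : Nat.gcd b.val m = Nat.gcd a.val m := by
  obtain ⟨k, rfl⟩ := mem_cyclotomicCoset.1 h
  rw [← Nat.cast_pow, ZMod.val_mul, ZMod.val_natCast, Nat.mul_mod_mod, (Nat.mod_modEq _ m).gcd_eq]
  exact Nat.Coprime.gcd_mul_right_cancel _ (Nat.Coprime.pow_left k hrm)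

variable [Fact r.Prime] {K : Type*} [Field K] [Algebra (ZMod r) K] {ξ : K}

theorem pow_val_injective (hξ : IsPrimitiveRoot ξ m) :
    Function.Injective fun u : ZMod m => ξ ^ u.val := fun u v h =>
  ZMod.val_injective m (hξ.pow_inj (ZMod.val_lt u) (ZMod.val_lt v) h)

/-- The order of `ξ ^ u` is `m / gcd(u, m)`, and `g ↦ m / g` is an involution on the divisors of
`m`. -/
theorem isPrimitiveRoot_pow_val_iff (hξ : IsPrimitiveRoot ξ m) {d : ℕ} (hd : d ∣ m) (u : ZMod m) :
    IsPrimitiveRoot (ξ ^ u.val) d ↔ Nat.gcd u.val m = m / d := by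
  have hm := NeZero.pos m
  obtain ⟨g, hg⟩ : ∃ g, g = Nat.gcd u.val m := ⟨_, rfl⟩
  have hgm : g ∣ m := hg ▸ Nat.gcd_dvd_right _ _
  have h1 : orderOf (ξ ^ u.val) = m / g := by
    rw [IsOfFinOrder.orderOf_pow ξ _ (isOfFinOrder_iff_pow_eq_one.2 ⟨m, hm, hξ.pow_eq_one⟩),
      ← hξ.eq_orderOf, Nat.gcd_comm, hg]
  rw [IsPrimitiveRoot.iff_orderOf, h1, ← hg]
  constructor
  · rintro rfl
    rw [Nat.div_div_self hgm hm.ne']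
  · rintro rfl
    rw [Nat.div_div_self hd hm.ne']

/-- The cyclotomic polynomial is the product of the polynomials of its cyclotomic cosets. -/
theorem prod_cosetPoly (hrm : Nat.gcd r m = 1) (hξ : IsPrimitiveRoot ξ m) {d : ℕ} (hd : d ∣ m) :
    ∏ χ ∈ cosetsOfGcd m r (m / d), cosetPoly hξ χ = cyclotomic d (ZMod r) := by
  classical
  refine map_injective _ (algebraMap (ZMod r) K).injective ?_
  have hdpos : 0 < d := Nat.pos_of_dvd_of_pos hd (NeZero.pos m)
  have hprim : IsPrimitiveRoot (ξ ^ (m / d)) d := by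
    refine hξ.pow (NeZero.pos m) ?_
    rw [Nat.div_mul_cancel hd]
  rw [map_cyclotomic, cyclotomic_eq_prod_X_sub_primitiveRoots hprim, Polynomial.map_prod]
  let S : Finset (ZMod m) := Finset.univ.filter fun u => Nat.gcd u.val m = m / d
  let c : ZMod m → CyclotomicCosets m r := fun a => ⟨cyclotomicCoset m r a, a, rfl⟩
  have himg : S.image (fun u => ξ ^ u.val) = primitiveRoots d K := by
    ext z
    rw [mem_primitiveRoots hdpos, Finset.mem_image]
    constructor
    · rintro ⟨u, hu, rfl⟩
      exact (isPrimitiveRoot_pow_val_iff hξ hd u).2 (Finset.mem_filter.1 hu).2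
    · intro hz
      have hz1 : z ^ m = 1 := by
        obtain ⟨e, rfl⟩ := hd
        rw [pow_mul, hz.pow_eq_one, one_pow]
      obtain ⟨i, hi, rfl⟩ := hξ.eq_pow_of_pow_eq_one hz1
      have hv : ξ ^ (i : ZMod m).val = ξ ^ i := by
        rw [ZMod.val_natCast, Nat.mod_eq_of_lt hi]
      refine ⟨i, Finset.mem_filter.2 ⟨Finset.mem_univ _, ?_⟩, hv⟩
      rw [← hv] at hz
      exact (isPrimitiveRoot_pow_val_iff hξ hd i).1 hz
  have hS : ∀ u ∈ S, c u ∈ cosetsOfGcd m r (m / d) := fun u hu => mem_cosetsOfGcd.2 fun a ha =>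
    (gcd_val_of_mem_cyclotomicCoset hrm ha).trans (Finset.mem_filter.1 hu).2
  -- The primitive `d`-th roots of unity correspond to the residues `u` with `gcd(u, m) = m / d`,
  -- and these residues are grouped by their cosets.
  rw [← himg, Finset.prod_image fun u _ v _ h => pow_val_injective hξ h,
    ← Finset.prod_fiberwise_of_maps_to hS]
  refine Finset.prod_congr rfl fun χ hχ => ?_
  rw [cosetPoly_map]
  refine Finset.prod_congr ?_ fun _ _ => rfl
  ext u
  obtain ⟨a, ha⟩ := χ.2
  have hc : c u = χ ↔ u ∈ χ.1 := by
    rw [ha, ← cyclotomicCoset_eq_iff hrm, ← ha]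
    exact Subtype.ext_iff
  rw [Finset.mem_filter, hc]
  exact ⟨fun hu => ⟨Finset.mem_filter.2 ⟨Finset.mem_univ _, mem_cosetsOfGcd.1 hχ u hu⟩, hu⟩,
    fun hu => hu.2⟩

theorem cosetPoly_dvd_cyclotomic (hrm : Nat.gcd r m = 1) (hξ : IsPrimitiveRoot ξ m) {d : ℕ}
    (hd : d ∣ m) {χ : CyclotomicCosets m r} (hχ : χ ∈ cosetsOfGcd m r d) :
    cosetPoly hξ χ ∣ cyclotomic (m / d) (ZMod r) := by
  rw [← prod_cosetPoly hrm hξ (Nat.div_dvd_of_dvd hd), Nat.div_div_self hd (NeZero.ne m)]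
  exact Finset.dvd_prod_of_mem _ hχ

/-- For `a` in the coset, `f_χ` is associated with the minimal polynomial of `ξ ^ a`: it vanishes at
`ξ ^ a`, and conversely all its roots are images of `ξ ^ a` under powers of Frobenius, hence roots
of that minimal polynomial. -/
theorem irreducible_cosetPoly (hξ : IsPrimitiveRoot ξ m) (χ : CyclotomicCosets m r) :
    Irreducible (cosetPoly hξ χ) := by
  classical
  obtain ⟨a, ha⟩ := χ.2
  set α := ξ ^ a.val with hα
  have hint : IsIntegral (ZMod r) α := by
    refine IsIntegral.of_pow (NeZero.pos m) ?_
    rw [hα, ← pow_mul, mul_comm, pow_mul, hξ.pow_eq_one, one_pow]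
    exact isIntegral_one
  refine Associated.irreducible (associated_of_dvd_dvd (minpoly.dvd _ _ ?_) ?_)
    (minpoly.irreducible hint)
  · rw [aeval_def, ← eval_map, cosetPoly_map, eval_prod]
    refine Finset.prod_eq_zero (i := a) (ha ▸ mem_cyclotomicCoset_self a) ?_
    rw [eval_sub, eval_X, eval_C, sub_self]
  · rw [← Polynomial.map_dvd_map' (algebraMap (ZMod r) K), cosetPoly_map]
    refine Finset.prod_dvd_of_coprime ?_ ?_
    · intro u _ v _ huv
      exact pairwise_coprime_X_sub_C (pow_val_injective hξ) huv
    · intro u hu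
      rw [ha] at hu
      obtain ⟨k, rfl⟩ := mem_cyclotomicCoset.1 hu
      rw [dvd_iff_isRoot, IsRoot, eval_map_algebraMap]
      have hk : ξ ^ (a * (r : ZMod m) ^ k).val = α ^ r ^ k := by
        rw [hα, ← pow_mul, ← Nat.cast_pow, ZMod.val_mul, ZMod.val_natCast, Nat.mul_mod_mod]
        exact (pow_eq_pow_mod _ hξ.pow_eq_one).symm
      rw [hk]
      clear hk hu
      induction k with
      | zero => rw [pow_zero, pow_one, minpoly.aeval]
      | succ k ih =>
        have := aeval_algHom_apply (FiniteField.frobeniusAlgHom (ZMod r) K) (α ^ r ^ k)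
          (minpoly (ZMod r) α)
        rw [ih, map_zero, FiniteField.frobeniusAlgHom_apply, ZMod.card, ← pow_mul, ← pow_succ] at this
        exact this

/-- An irreducible factor over `F_r` of the cyclotomic polynomial of index `m / d` has degree equal
to the order of `r` modulo `m / d`. -/
theorem natDegree_cosetPoly (hrm : Nat.gcd r m = 1) (hξ : IsPrimitiveRoot ξ m) {d : ℕ}
    (hd : d ∣ m) {χ : CyclotomicCosets m r} (hχ : χ ∈ cosetsOfGcd m r d) :
    (cosetPoly hξ χ).natDegree = multOrder (m / d) r := by
  have hco : r.Coprime (m / d) := Nat.Coprime.coprime_dvd_right (Nat.div_dvd_of_dvd hd) hrm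
  rw [natDegree_of_dvd_cyclotomic_of_irreducible (p := r) (f := 1)
    (by rw [ZMod.card, pow_one]) hco (cosetPoly_dvd_cyclotomic hrm hξ hd hχ)
    (irreducible_cosetPoly hξ χ), multOrder, ← orderOf_units, ZMod.coe_unitOfCoprime, pow_one]

end Cosets

/-! ## The Jones polynomial as a graded Euler characteristic -/

theorem separable_X_pow_sub_one {m r : ℕ} [Fact r.Prime] (hrm : Nat.gcd r m = 1) :
    (X ^ m - 1 : (ZMod r)[X]).Separable := by
  rw [X_pow_sub_one_separable_iff, Ne, ZMod.natCast_eq_zero_iff]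
  intro h
  exact (Fact.out : r.Prime).one_lt.ne' (Nat.dvd_one.1 (hrm ▸ Nat.dvd_gcd dvd_rfl h))

namespace PeriodicLink

variable {m : ℕ} (L : PeriodicLink m)

/-- The bidegree of an enhanced state. -/
noncomputable def EnhancedState.bidegree {L : PeriodicLink m} (E : L.EnhancedState) : ℤ × ℤ :=
  (E.hDegree, E.qDegree)

/-- The bidegrees of the enhanced states. -/
noncomputable def bidegrees : Finset (ℤ × ℤ) :=
  Finset.univ.image (EnhancedState.bidegree (L := L))

/-- The graded Euler characteristic of graded dimensions `n`. -/
noncomputable def eulerChar (n : ℤ × ℤ → ℕ) : LaurentPolynomial ℤ :=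
  ∑ p ∈ L.bidegrees, LaurentPolynomial.C ((p.1.negOnePow : ℤ) * n p) * LaurentPolynomial.T p.2

theorem eulerChar_sum {ι : Type*} (s : Finset ι) (n : ι → ℤ × ℤ → ℕ) :
    L.eulerChar (fun p => ∑ i ∈ s, n i p) = ∑ i ∈ s, L.eulerChar (n i) := by
  simp only [eulerChar]
  rw [Finset.sum_comm]
  refine Finset.sum_congr rfl fun p _ => ?_
  rw [← Finset.sum_mul, ← map_sum, Nat.cast_sum, Finset.mul_sum]

theorem eulerChar_mul (c : ℕ) (n : ℤ × ℤ → ℕ) :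
    L.eulerChar (fun p => c * n p) = (c : ℤ) • L.eulerChar n := by
  rw [eulerChar, eulerChar, Finset.smul_sum]
  refine Finset.sum_congr rfl fun p _ => ?_
  rw [LaurentPolynomial.smul_eq_C_mul, ← mul_assoc, ← map_mul, Nat.cast_mul, mul_left_comm]

open scoped Classical in
-- The graded part consists of the functions that vanish off the enhanced states of bidegree `p`,
-- and so has these states as a basis.
theorem finrank_khGraded (F : Type) [Field F] (p : ℤ × ℤ) :
    Module.finrank F (L.khGraded F p.1 p.2) =
      (Finset.univ.filter fun E : L.EnhancedState => E.bidegree = p).card := by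
  have h : L.khGraded F p.1 p.2 = ⨅ E ∈ {E : L.EnhancedState | E.bidegree ≠ p},
      LinearMap.ker (LinearMap.proj E : L.Chain F →ₗ[F] F) := by
    ext f
    simp only [Submodule.mem_iInf, LinearMap.mem_ker, LinearMap.proj_apply]
    refine forall_congr' fun E => ?_
    have h : (E.hDegree = p.1 ∧ E.qDegree = p.2) ↔ E.bidegree = p :=
      (Prod.ext_iff (x := E.bidegree) (y := p)).symm
    change (f E ≠ 0 → E.hDegree = p.1 ∧ E.qDegree = p.2) ↔ (E.bidegree ≠ p → f E = 0)
    rw [h]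
    tauto
  have hd : Disjoint {E : L.EnhancedState | E.bidegree = p} {E | E.bidegree ≠ p} :=
    disjoint_compl_right
  have e := LinearMap.iInfKerProjEquiv F (fun _ : L.EnhancedState => F) hd
    (Set.union_compl_self _).ge
  rw [h, e.finrank_eq, Module.finrank_fintype_fun_eq_card, ← Set.toFinset_card]
  congr 1
  ext E
  simp

/-- Enhanced states as states with a labelling of the circles. -/
noncomputable def enhancedStateEquiv : L.EnhancedState ≃ Σ S : Finset L.Crossing, L.Circles S → Bool where
  toFun E := ⟨E.state, E.circleLabel⟩
  invFun x := ⟨(x.1, fun v => x.2 (L.circle x.1 v)), fun _ _ h => congrArg x.2 (Quot.sound h)⟩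
  left_inv _ := rfl
  right_inv _ := Sigma.ext rfl (heq_of_eq (funext fun y => Quot.inductionOn y fun _ => rfl))

/-- Expanding `(q + q⁻¹)` to the number of circles amounts to summing over the labellings of the
circles, so the Kauffman state sum becomes a sum over enhanced states. -/
theorem jones_eq_sum : L.jones = ∑ E : L.EnhancedState,
    LaurentPolynomial.C (E.hDegree.negOnePow : ℤ) * LaurentPolynomial.T E.qDegree := by
  classical
  rw [← L.enhancedStateEquiv.symm.sum_comp, Fintype.sum_sigma, jones, Finset.mul_sum]
  refine Finset.sum_congr rfl fun S _ => ?_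
  have h1 : (LaurentPolynomial.T 1 + LaurentPolynomial.T (-1) : LaurentPolynomial ℤ) ^
      Fintype.card (L.Circles S) = ∑ l : L.Circles S → Bool,
        LaurentPolynomial.T (∑ x, if l x then 1 else -1) := by
    have h2 : (LaurentPolynomial.T 1 + LaurentPolynomial.T (-1) : LaurentPolynomial ℤ) =
        ∑ b : Bool, LaurentPolynomial.T (if b then 1 else -1) := by simp
    have h3 : ∀ (s : Finset (L.Circles S)) (g : L.Circles S → ℤ),
        (LaurentPolynomial.T (∑ x ∈ s, g x) : LaurentPolynomial ℤ) =
          ∏ x ∈ s, LaurentPolynomial.T (g x) := by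
      intro s g
      induction s using Finset.induction_on with
      | empty => rfl
      | insert a s ha ih =>
        rw [Finset.sum_insert ha, Finset.prod_insert ha, LaurentPolynomial.T_add, ih]
    rw [h2, ← Finset.card_univ, ← Finset.prod_const, Finset.prod_univ_sum, Fintype.piFinset_univ]
    exact Finset.sum_congr rfl fun l _ => (h3 _ _).symm
  rw [h1, Finset.mul_sum, Finset.mul_sum]
  refine Finset.sum_congr rfl fun l _ => ?_
  have hh : (L.enhancedStateEquiv.symm ⟨S, l⟩).hDegree = S.card - L.nNeg := rfl
  have hq : (L.enhancedStateEquiv.symm ⟨S, l⟩).qDegree =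
      (∑ x, if l x then 1 else -1) + S.card + L.nPos - 2 * L.nNeg := by
    have hl : ∀ x : L.Circles S, (L.enhancedStateEquiv.symm ⟨S, l⟩).circleLabel x = l x :=
      fun x => Quot.inductionOn x fun _ => rfl
    change (∑ x : L.Circles S, if (L.enhancedStateEquiv.symm ⟨S, l⟩).circleLabel x then (1 : ℤ)
      else -1) + S.card + L.nPos - 2 * L.nNeg = _
    simp only [hl]
  rw [hh, hq, neg_pow (LaurentPolynomial.T 1 : LaurentPolynomial ℤ), LaurentPolynomial.T_pow]
  have hs : (LaurentPolynomial.C (((S.card : ℤ) - L.nNeg).negOnePow : ℤ) : LaurentPolynomial ℤ) =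
      (-1) ^ L.nNeg * (-1) ^ S.card := by
    rw [Int.negOnePow_sub, Int.negOnePow_def, Int.negOnePow_def]
    simp [mul_comm]
  rw [hs, show (∑ x, if l x then 1 else -1) + (S.card : ℤ) + L.nPos - 2 * L.nNeg =
    ((L.nPos : ℤ) - 2 * L.nNeg) + ((S.card : ℤ) * 1) + (∑ x, if l x then 1 else -1) by ring,
    LaurentPolynomial.T_add, LaurentPolynomial.T_add]
  ring

/-- The Jones polynomial is the graded Euler characteristic of the Khovanov complex. -/
theorem jones_eq (F : Type) [Field F] :
    L.jones = L.eulerChar fun p => Module.finrank F (L.khGraded F p.1 p.2) := by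
  classical
  rw [jones_eq_sum, eulerChar, ← Finset.sum_fiberwise_of_maps_to (t := L.bidegrees)
    (g := EnhancedState.bidegree) fun E _ => Finset.mem_image_of_mem _ (Finset.mem_univ E)]
  refine Finset.sum_congr rfl fun p _ => ?_
  rw [finrank_khGraded, Finset.sum_congr rfl (g := fun _ =>
    LaurentPolynomial.C (p.1.negOnePow : ℤ) * LaurentPolynomial.T p.2), Finset.sum_const]
  · rw [mul_comm (p.1.negOnePow : ℤ), map_mul, mul_assoc, nsmul_eq_mul, map_natCast]
  · intro E hE
    rw [← (Finset.mem_filter.1 hE).2]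
    rfl

variable {F : Type} [Field F]

/-- Equivariant Jones polynomials are additive for factorizations into coprime polynomials. -/
theorem eulerChar_prod {ι : Type*} (s : Finset ι) (f : ι → F[X]) (h : (∏ i ∈ s, f i).Separable) :
    (L.eulerChar fun p => Module.finrank F
      (LinearMap.ker (aeval (L.khRotGraded F p.1 p.2) (∏ i ∈ s, f i)))) =
    ∑ i ∈ s, L.eulerChar fun p => Module.finrank F
      (LinearMap.ker (aeval (L.khRotGraded F p.1 p.2) (f i))) := by
  rw [← eulerChar_sum]
  congr 1
  funext p
  exact finrank_ker_aeval_prod _ _ _ h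

variable [NeZero m]

/-- The equivariant Jones polynomial of `F[X]/(f)` as a graded Euler characteristic. -/
theorem equivariantJones_polyModule {f : F[X]} (hf : f ∣ X ^ m - 1)
    [CategoryTheory.Projective (polyModule m f hf)] :
    L.equivariantJones (polyModule m f hf) = L.eulerChar fun p =>
      Module.finrank F (LinearMap.ker (aeval (L.khRotGraded F p.1 p.2) f)) := by
  classical
  simp only [equivariantJones_eq, finrank_homGraded_polyModule]
  refine finsum_eq_sum_of_support_subset _ fun p hp => ?_
  -- Outside the bidegrees of enhanced states the complex is zero, so the infinite sum reduces to
  -- the finite one defining `eulerChar`.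
  by_contra h
  have h0 : Module.finrank F (L.khGraded F p.1 p.2) = 0 := by
    rw [finrank_khGraded, Finset.card_eq_zero, Finset.filter_eq_empty_iff]
    rintro E - rfl
    exact h (Finset.mem_image_of_mem _ (Finset.mem_univ E))
  have h1 : Module.finrank F (LinearMap.ker (aeval (L.khRotGraded F p.1 p.2) f)) = 0 :=
    Nat.eq_zero_of_le_zero (h0 ▸ Submodule.finrank_le _)
  refine hp ?_
  simp [h1]

theorem aeval_khRotGraded (i k : ℤ) : aeval (L.khRotGraded F i k) (X ^ m - 1 : F[X]) = 0 := by
  refine LinearMap.ext fun x => Subtype.ext ?_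
  rw [khRotGraded, LinearMap.aeval_restrict_apply, map_sub, map_pow, aeval_X, map_one,
    L.khRot_pow, sub_self]
  rfl

/-! ### Decomposition over divisors and cosets, and integrality. -/

variable {r : ℕ} [Fact r.Prime] {K : Type*} [Field K] [Algebra (ZMod r) K] {ξ : K}

/-- The Jones polynomial is the sum of the equivariant Jones polynomials of the modules
`F_r[ξ_d]`. -/
theorem jones_eq_sum_equivariantJones (hrm : Nat.gcd r m = 1) :
    L.jones = ∑ d ∈ m.divisors, L.eulerChar fun p => Module.finrank (ZMod r)
      (LinearMap.ker (aeval (L.khRotGraded (ZMod r) p.1 p.2) (cyclotomic d (ZMod r)))) := by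
  have hp := prod_cyclotomic_eq_X_pow_sub_one (NeZero.pos m) (ZMod r)
  rw [← L.eulerChar_prod m.divisors _ (by rw [hp]; exact separable_X_pow_sub_one hrm),
    L.jones_eq (ZMod r)]
  congr 1
  funext p
  rw [hp, aeval_khRotGraded, LinearMap.ker_zero, finrank_top]

/-- For cosets in `C(m,r)_{m/d}` the normalising factor is `1 / f_{d,r}`, because `m / (m / d) = d`;
it cancels with the factor in front. What remains is additivity over the factorization of `Φ_d` into
the polynomials `f_χ`. -/
theorem smul_jonesDivisor (hrm : Nat.gcd r m = 1) (hξ : IsPrimitiveRoot ξ m) {d : ℕ} (hd : d ∣ m) :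
    (multOrder d r : ℚ) • L.jonesDivisor r hξ d = laurentToRat (L.eulerChar fun p =>
      Module.finrank (ZMod r)
        (LinearMap.ker (aeval (L.khRotGraded (ZMod r) p.1 p.2) (cyclotomic d (ZMod r))))) := by
  have hm := NeZero.pos m
  have hpos : (multOrder d r : ℚ) ≠ 0 := by
    have h : r.Coprime d := Nat.Coprime.coprime_dvd_right hd hrm
    rw [multOrder, ← ZMod.coe_unitOfCoprime r h, orderOf_units]
    have : NeZero d := ⟨(Nat.pos_of_dvd_of_pos hd hm).ne'⟩
    exact_mod_cast (orderOf_pos _).ne'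
  rw [← prod_cosetPoly hrm hξ hd, eulerChar_prod, map_sum, jonesDivisor, Finset.smul_sum]
  · refine Finset.sum_congr rfl fun χ hχ => ?_
    have := projective_of_coprime r hrm (polyModule m _ (cosetPoly_dvd hξ χ))
    rw [jonesCoset, smul_smul, Nat.div_div_self hd hm.ne', mul_one_div_cancel hpos, one_smul]
    exact congrArg _ (L.equivariantJones_polyModule (cosetPoly_dvd hξ χ))
  · rw [prod_cosetPoly hrm hξ hd]
    refine (separable_X_pow_sub_one hrm).of_dvd ?_
    rw [← prod_cyclotomic_eq_X_pow_sub_one hm]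
    exact Finset.dvd_prod_of_mem _ (Nat.mem_divisors.2 ⟨hd, hm.ne'⟩)

/-- In each bidegree the dimension of the kernel of `f_χ` is a multiple of `deg f_χ = f_{m/d,r}`.
The integral polynomial is the Euler characteristic of the quotients. -/
theorem exists_jonesCoset_eq (hrm : Nat.gcd r m = 1) (hξ : IsPrimitiveRoot ξ m) {d : ℕ} (hd : d ∣ m)
    {χ : CyclotomicCosets m r} (hχ : χ ∈ cosetsOfGcd m r d) :
    ∃ E : LaurentPolynomial ℤ, laurentToRat E = L.jonesCoset hξ d χ := by
  have := projective_of_coprime r hrm (polyModule m _ (cosetPoly_dvd hξ χ))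
  have hirr := irreducible_cosetPoly hξ χ
  have hdeg := natDegree_cosetPoly hrm hξ hd hχ
  choose n hn using fun p : ℤ × ℤ =>
    natDegree_dvd_finrank_ker_aeval (L.khRotGraded (ZMod r) p.1 p.2) hirr
  refine ⟨L.eulerChar n, ?_⟩
  have h : L.equivariantJones (cosetModule hξ χ) = (multOrder (m / d) r : ℤ) • L.eulerChar n := by
    rw [← eulerChar_mul, ← hdeg]
    refine (L.equivariantJones_polyModule (cosetPoly_dvd hξ χ)).trans ?_
    simp only [hn]
  have hpos : (multOrder (m / d) r : ℚ) ≠ 0 := by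
    rw [← hdeg]
    exact_mod_cast hirr.natDegree_pos.ne'
  rw [jonesCoset, h, map_zsmul, ← Int.cast_smul_eq_zsmul ℚ, smul_smul, Int.cast_natCast,
    one_div_mul_cancel hpos, one_smul]

end PeriodicLink

/-! ### The decomposition of the Jones polynomial. -/

theorem mainTheorem10 (m r : ℕ) [NeZero m] [Fact r.Prime] (hrm : Nat.gcd r m = 1)
    (L : PeriodicLink m) {K : Type*} [Field K] [Algebra (ZMod r) K] (ξ : K)
    (hξ : IsPrimitiveRoot ξ m) :
    (∀ d, d ∣ m → ∀ χ ∈ cosetsOfGcd m r d,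
      L.EKhFinite (cosetModule hξ χ) ∧
        ∃ E : LaurentPolynomial ℤ, laurentToRat E = L.jonesCoset hξ d χ) ∧
    (∀ d (hd : d ∣ m),
      L.EKhFinite (cyclotomicModule m r d hd) ∧
        (multOrder d r : ℚ) • L.jonesDivisor r hξ d =
          laurentToRat (L.equivariantJones (cyclotomicModule m r d hd))) ∧
    laurentToRat L.jones = ∑ d ∈ m.divisors, (multOrder d r : ℚ) • L.jonesDivisor r hξ d := by
  refine ⟨fun d hd χ hχ => ⟨?_, L.exists_jonesCoset_eq hrm hξ hd hχ⟩, fun d hd => ⟨?_, ?_⟩, ?_⟩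
  · have := PeriodicLink.projective_of_coprime r hrm (cosetModule hξ χ)
    have : Module.Finite (ZMod r) (L.KhHom (cosetModule hξ χ)) :=
      inferInstanceAs (Module.Finite (ZMod r) (L.KhHom (polyModule _ _ (cosetPoly_dvd hξ χ))))
    exact L.ekhFinite_of_projective _
  · have := PeriodicLink.projective_of_coprime r hrm (cyclotomicModule m r d hd)
    have : Module.Finite (ZMod r) (L.KhHom (cyclotomicModule m r d hd)) := by
      rw [cyclotomicModule]
      infer_instance
    exact L.ekhFinite_of_projective _
  · have := PeriodicLink.projective_of_coprime r hrm (cyclotomicModule m r d hd)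
    rw [cyclotomicModule] at this ⊢
    rw [L.smul_jonesDivisor hrm hξ hd, L.equivariantJones_polyModule]
  · rw [L.jones_eq_sum_equivariantJones hrm, map_sum]
    exact Finset.sum_congr rfl fun d hd =>
      (L.smul_jonesDivisor hrm hξ (Nat.dvd_of_mem_divisors hd)).symm
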